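/- All bornological vector spaces are complex, convex and complete, and $\hat\otimes$ is their completed projective tensor product. A *bornological quantum group* is an essential bornological $*$-algebra $\mathcal A$ with the approximation property (involution $a\mapsto\overline a$), together with: - a coproduct, i.e. a coassociative essential bounded $*$-homomorphism $\Delta:\mathcal A\to\mathcal M(\mathcal A\hat\otimes\mathcal A)$ into the multipliers such that $a\otimes b\mapsto\Delta(a)(b\otimes1)$ and $a\otimes b\mapsto(1\otimes a)\Delta(b)$ define bounded maps of $\mathcal A\hat\otimes\mathcal A$ into itself; - a bounded linear functional $\phi$ that is positive ($\phi(\overline aa)\ge0$), faithful ($\phi(\overline aa)=0$ only for $a=0$) and left invariant ($(\iota\otimes\phi)\Delta(a)=\phi(a)1$); - a counit, i.e. an essential homomorphism $\epsilon:\mathcal A\to\mathbb C$ with $(\epsilon\otimes\iota)\Delta(a)=a=(\iota\otimes\epsilon)\Delta(a)$; - an antipode, i.e. a bounded algebra and coalgebra antiautomorphism $S$ of $\mathcal A$ with $\mathrm m(S\otimes\iota)(\Delta(a)(1\otimes b))=\epsilon(a)b$ and $\mathrm m(\iota\otimes S)((a\otimes1)\Delta(b))=\epsilon(b)a$. Let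 $\mathcal A=\mathcal A(\mathbb G)$ be a bornological quantum group. For $a\in\mathcal A$ let $\mathfrak F(a)$ be the functional $b\mapsto\phi(ba)$, and let $\mathcal A(\hat{\mathbb G})=\{\mathfrak F(a)\mid a\in\mathcal A\}$, with the bornology carried over by the bijection $\mathfrak F$. **Statement.** There is a unique multiplier $\delta_{\mathbb G}$ of $\mathcal A$ with $(\phi\otimes\iota)\Delta(a)=\phi(a)\delta_{\mathbb G}$ for all $a$, and $\mathcal A(\hat{\mathbb G})$ is a bornological quantum group with the operations given, for $x,y\in\mathcal A(\hat{\mathbb G})$ and $a,b\in\mathcal A$, by $$(xy,a)=(x\otimes y,\Delta(a)),\quad (\hat\Delta(x),a\otimes b)=(x,ba),\quad \hat\epsilon(x)=(x,1),\quad (\hat S^{\pm1}(x),a)=(x,S^{\mp1}(a)),$$ with the involution $$(x^*,a)=\overline{\bigl(x,\overline{S(a)}\bigr)},\qquad\text{so that}\qquad (x,\overline a)=\overline{\bigl(\hat S^{-1}(x)^*,a\bigr)},$$ and with positive faithful left invariant integral $\hat\phi(\mathfrak F(a))=\epsilon(a)$. Here $\hat\epsilon(\mathfrak F(f))=(\mathfrak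 F(f),1)=\phi(f)$. Moreover, for all $f,g\in\mathcal A$, $$\mathfrak F(f)\mathfrak F(g)=\mathfrak F(f*g),\qquad \mathfrak F(f)^*=\mathfrak F(f^*),\qquad \epsilon(f^**g)=\phi(\overline fg),$$ where $f*g=(\iota\otimes\phi)\bigl((1\otimes S^{-1}(g))\Delta(f)\bigr)$ and $f^*=\overline{S(f)}\,\delta_{\mathbb G}$. -/

import Mathlib

open Bornology Set
open scoped Pointwise ENNReal

universe u v w x


/-- A completant disk: a balanced convex set `D` whose gauge `p_D` is a norm on the linear span
of `D` for which this span is complete.  For a disk, `p_D v < ε` implies `v ∈ ε • D`, and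
`v ∈ ε • D` implies `p_D v ≤ ε`, so both clauses are expressed by membership in `ε • D`. -/
structure IsCompletantDisk {V : Type u} [AddCommGroup V] [Module ℂ V] (D : Set V) : Prop where
  balanced : Balanced ℂ D
  convex : Convex ℝ D
  separated : ∀ x : V, (∀ ε : ℝ, 0 < ε → x ∈ ε • D) → x = 0
  complete : ∀ s : ℕ → V, (∀ n, s n ∈ Submodule.span ℂ D) →
    (∀ ε : ℝ, 0 < ε → ∃ N, ∀ m ≥ N, ∀ n ≥ N, s m - s n ∈ ε • D) →
    ∃ y ∈ Submodule.span ℂ D, ∀ ε : ℝ, 0 < ε → ∃ N, ∀ n ≥ N, s n - y ∈ ε • D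

/-- Complete convex bornological vector spaces over `ℂ`. -/
class CompleteBornSpace (V : Type u) [AddCommGroup V] [Module ℂ V] [Bornology V] : Prop where
  bounded_add : ∀ {s t : Set V}, IsBounded s → IsBounded t → IsBounded (s + t)
  bounded_smul : ∀ (c : ℂ) {s : Set V}, IsBounded s → IsBounded (c • s)
  bounded_hull : ∀ {s : Set V}, IsBounded s → IsBounded (convexHull ℝ (balancedHull ℂ s))
  exists_disk : ∀ {s : Set V}, IsBounded s → ∃ D, s ⊆ D ∧ IsBounded D ∧ IsCompletantDisk D

/-- Bounded maps. -/
def IsBdd {V : Type u} {W : Type v} [Bornology V] [Bornology W] (f : V → W) : Prop :=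
  ∀ s : Set V, IsBounded s → IsBounded (f '' s)

/-- Bounded maps of two variables that are semilinear along `σ` in each variable.  Here `σ` is the
identity (bilinear maps) or complex conjugation (maps that are antilinear in both variables). -/
structure IsBddBilin {V : Type u} {W : Type v} {X : Type w}
    [AddCommGroup V] [Module ℂ V] [Bornology V] [AddCommGroup W] [Module ℂ W] [Bornology W]
    [AddCommGroup X] [Module ℂ X] [Bornology X] (σ : ℂ →+* ℂ) (β : V → W → X) : Prop where
  add_left : ∀ a a' b, β (a + a') b = β a b + β a' b
  add_right : ∀ a b b', β a (b + b') = β a b + β a b'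
  smul_left : ∀ (c : ℂ) a b, β (c • a) b = σ c • β a b
  smul_right : ∀ (c : ℂ) a b, β a (c • b) = σ c • β a b
  bdd : ∀ s t, IsBounded s → IsBounded t → IsBounded (image2 β s t)

/-- Relatively compact subsets of the Banach space spanned by some bounded completant disk. -/
def IsBornPrecompact {V : Type u} [AddCommGroup V] [Module ℂ V] [Bornology V] (K : Set V) : Prop :=
  ∃ D : Set V, IsBounded D ∧ IsCompletantDisk D ∧ K ⊆ Submodule.span ℂ D ∧
    ∀ ε : ℝ, 0 < ε → ∃ F : Set V, F.Finite ∧ K ⊆ F + ε • D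

/-- The approximation property: the identity is a limit of bounded finite rank operators, uniformly
on compact sets. -/
def HasApproximationProperty (V : Type u) [AddCommGroup V] [Module ℂ V] [Bornology V] : Prop :=
  ∀ K : Set V, IsBornPrecompact K → ∃ D : Set V, IsBounded D ∧ ∀ ε : ℝ, 0 < ε →
    ∃ T : V →ₗ[ℂ] V, IsBdd T ∧ FiniteDimensional ℂ (LinearMap.range T) ∧
      ∀ x ∈ K, T x - x ∈ ε • D

namespace IsCompletantDisk

variable {V : Type u} {W : Type v} [AddCommGroup V] [Module ℂ V] [AddCommGroup W] [Module ℂ W]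
variable {D : Set V}

theorem add_mem (hD : IsCompletantDisk D) {r s : ℝ} (hr : 0 ≤ r) (hs : 0 ≤ s) {a b : V}
    (ha : a ∈ r • D) (hb : b ∈ s • D) : a + b ∈ (r + s) • D := by
  rw [hD.convex.add_smul hr hs]
  exact Set.add_mem_add ha hb

theorem smul_mem (hD : IsCompletantDisk D) {r : ℝ} (c : ℂ) {s : ℝ}
    (hs : ‖c‖ * r ≤ s) (hr : 0 ≤ r) {a : V} (ha : a ∈ r • D) : c • a ∈ s • D := by
  obtain ⟨d, hd, rfl⟩ := ha
  have hs0 : 0 ≤ s := (by positivity : 0 ≤ ‖c‖ * r).trans hs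
  rcases hs0.eq_or_lt with h0 | h0
  · have hc : c * (r : ℂ) = 0 := by
      rw [← norm_eq_zero, norm_mul, Complex.norm_real, Real.norm_of_nonneg hr]
      exact le_antisymm (h0 ▸ hs) (by positivity)
    refine ⟨d, hd, ?_⟩
    change s • d = c • r • d
    rw [← Complex.coe_smul r d, smul_smul, hc, ← h0, zero_smul, zero_smul]
  · refine ⟨(c * r / s) • d, hD.balanced.smul_mem ?_ hd, ?_⟩
    · rw [norm_div, norm_mul, Complex.norm_real, Complex.norm_real, Real.norm_of_nonneg hr,
        Real.norm_of_nonneg hs0]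
      exact (div_le_one h0).2 hs
    · change s • ((c * r / s) • d) = c • r • d
      rw [← Complex.coe_smul r d, ← Complex.coe_smul s, smul_smul, smul_smul]
      congr 1
      have : (s : ℂ) ≠ 0 := by exact_mod_cast h0.ne'
      field_simp

theorem mono (hD : IsCompletantDisk D) {r s : ℝ} (hr : 0 ≤ r) (hrs : r ≤ s) {a : V}
    (ha : a ∈ r • D) : a ∈ s • D := by
  simpa using hD.smul_mem (1 : ℂ) (s := s) (by simpa using hrs) hr ha

theorem neg_mem (hD : IsCompletantDisk D) {r : ℝ} (hr : 0 ≤ r) {a : V}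
    (ha : a ∈ r • D) : -a ∈ r • D := by
  simpa using hD.smul_mem (-1 : ℂ) (s := r) (by simp) hr ha

theorem sub_mem (hD : IsCompletantDisk D) {r s : ℝ} (hr : 0 ≤ r) (hs : 0 ≤ s) {a b : V}
    (ha : a ∈ r • D) (hb : b ∈ s • D) : a - b ∈ (r + s) • D := by
  rw [sub_eq_add_neg]
  exact hD.add_mem hr hs ha (hD.neg_mem hs hb)

theorem sum_mem (hD : IsCompletantDisk D) (hne : D.Nonempty) {ι : Type x} (t : Finset ι)
    (c : ι → ℂ) (y : ι → V) (hy : ∀ i, c i ≠ 0 → y i ∈ D) :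
    ∑ i ∈ t, c i • y i ∈ (∑ i ∈ t, ‖c i‖) • D := by
  classical
  have hz : (0 : V) ∈ (0 : ℝ) • D := by
    obtain ⟨d, hd⟩ := hne
    exact ⟨d, hd, zero_smul ℝ d⟩
  induction t using Finset.induction_on with
  | empty => simpa using hz
  | insert i t hi ih =>
    rw [Finset.sum_insert hi, Finset.sum_insert hi]
    refine hD.add_mem (norm_nonneg _) (Finset.sum_nonneg fun _ _ => norm_nonneg _) ?_ ih
    by_cases h : c i = 0
    · rw [h, zero_smul, norm_zero]
      exact hz
    · exact hD.smul_mem (r := 1) _ (by simp) zero_le_one (by simpa using hy i h)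

theorem mem_span (_ : IsCompletantDisk D) {r : ℝ} {a : V} (ha : a ∈ r • D) :
    a ∈ Submodule.span ℂ D := by
  obtain ⟨d, hd, rfl⟩ := ha
  change r • d ∈ _
  rw [← Complex.coe_smul]
  exact Submodule.smul_mem _ _ (Submodule.subset_span hd)

theorem image (hD : IsCompletantDisk D) (e : V ≃ₗ[ℂ] W) : IsCompletantDisk (e '' D) := by
  have key : ∀ (r : ℝ) (y : W), y ∈ r • (e '' D) ↔ e.symm y ∈ r • D := by
    intro r y
    constructor
    · rintro ⟨_, ⟨d, hd, rfl⟩, rfl⟩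
      refine ⟨d, hd, ?_⟩
      change r • d = e.symm (r • e d)
      rw [← Complex.coe_smul, ← Complex.coe_smul, map_smul, e.symm_apply_apply]
    · rintro ⟨d, hd, h⟩
      refine ⟨e d, ⟨d, hd, rfl⟩, ?_⟩
      change r • e d = y
      replace h : r • d = e.symm y := h
      rw [← Complex.coe_smul, ← map_smul, Complex.coe_smul, h, e.apply_symm_apply]
  have hspan : ∀ y, y ∈ Submodule.span ℂ (e '' D) ↔ e.symm y ∈ Submodule.span ℂ D := by
    intro y
    rw [← Submodule.mem_map_equiv, Submodule.map_span]
    rfl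
  refine ⟨?_, ?_, ?_, ?_⟩
  · rw [balanced_iff_smul_mem]
    rintro a ha _ ⟨d, hd, rfl⟩
    exact ⟨a • d, hD.balanced.smul_mem ha hd, map_smul e a d⟩
  · exact hD.convex.linear_image (e.toLinearMap.restrictScalars ℝ)
  · intro y hy
    have := hD.separated (e.symm y) fun ε hε => (key ε y).1 (hy ε hε)
    simpa using this
  · intro s hs hc
    obtain ⟨y, hy, hlim⟩ := hD.complete (fun n => e.symm (s n)) (fun n => (hspan _).1 (hs n))
      (fun ε hε => by
        obtain ⟨N, hN⟩ := hc ε hε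
        exact ⟨N, fun m hm n hn => by simpa using (key ε _).1 (hN m hm n hn)⟩)
    refine ⟨e y, (hspan _).2 (by simpa using hy), fun ε hε => ?_⟩
    obtain ⟨N, hN⟩ := hlim ε hε
    exact ⟨N, fun n hn => (key ε _).2 (by simpa using hN n hn)⟩

end IsCompletantDisk

section MackeySums

variable {X : Type w} [AddCommGroup X] [Module ℂ X] {ι : Type x}

/-- `a` is the sum of the family `f`, as an unconditionally convergent series in the Banach space
spanned by a bounded completant disk. -/
def IsMackeySum [Bornology X] (f : ι → X) (a : X) : Prop :=
  ∃ D : Set X, IsBounded D ∧ IsCompletantDisk D ∧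
    ∀ ε : ℝ, 0 < ε → ∃ s : Finset ι, ∀ t : Finset ι, s ⊆ t → a - ∑ i ∈ t, f i ∈ ε • D

theorem IsCompletantDisk.exists_sum {D : Set X} (hD : IsCompletantDisk D) (hne : D.Nonempty)
    (c : ι → ℂ) (hc : Summable fun i => ‖c i‖) (y : ι → X) (hy : ∀ i, c i ≠ 0 → y i ∈ D) :
    ∃ a, ∀ ε : ℝ, 0 < ε → ∃ s : Finset ι, ∀ t : Finset ι, s ⊆ t →
      a - ∑ i ∈ t, c i • y i ∈ ε • D := by
  classical
  have hv : ∀ k : ℕ, ∃ s : Finset ι, ∀ t : Finset ι, Disjoint t s →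
      ∑ i ∈ t, ‖c i‖ < (1 / 2 : ℝ) ^ k := by
    intro k
    obtain ⟨s, hs⟩ := summable_iff_vanishing_norm.1 hc ((1 / 2 : ℝ) ^ k) (by positivity)
    exact ⟨s, fun t ht => (Real.le_norm_self _).trans_lt (hs t ht)⟩
  choose s hs using hv
  have hdiff : ∀ (k : ℕ) (t t' : Finset ι), s k ⊆ t → s k ⊆ t' → ∀ r : ℝ,
      2 * (1 / 2 : ℝ) ^ k ≤ r → ∑ i ∈ t, c i • y i - ∑ i ∈ t', c i • y i ∈ r • D := by
    intro k t t' ht ht' r hr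
    have e : ∑ i ∈ t, c i • y i - ∑ i ∈ t', c i • y i
        = ∑ i ∈ t \ t', c i • y i - ∑ i ∈ t' \ t, c i • y i := by
      rw [← Finset.sum_sdiff_sub_sum_sdiff]
    rw [e]
    have h1 : ∀ {p q : Finset ι}, s k ⊆ q → ∑ i ∈ p \ q, c i • y i ∈ ((1 / 2 : ℝ) ^ k) • D := by
      intro p q hq
      refine hD.mono (Finset.sum_nonneg fun _ _ => norm_nonneg _) ?_
        (hD.sum_mem hne (p \ q) c y hy)
      exact (hs k _ (Finset.sdiff_disjoint.mono_right hq)).le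
    refine hD.mono (by positivity) ?_ (hD.sub_mem (by positivity) (by positivity) (h1 ht') (h1 ht))
    linarith
  have hsmall : ∀ ε : ℝ, 0 < ε → ∃ N : ℕ, ∀ n ≥ N, 2 * (1 / 2 : ℝ) ^ n ≤ ε := by
    intro ε hε
    obtain ⟨N, hN⟩ := exists_pow_lt_of_lt_one (half_pos hε) (by norm_num : (1 / 2 : ℝ) < 1)
    refine ⟨N, fun n hn => ?_⟩
    have := pow_le_pow_of_le_one (by norm_num : (0 : ℝ) ≤ 1 / 2) (by norm_num) hn
    linarith
  let S : ℕ → Finset ι := fun n => (Finset.range (n + 1)).biUnion s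
  have hS : ∀ k n, k ≤ n → s k ⊆ S n := fun k n hkn =>
    Finset.subset_biUnion_of_mem s (Finset.mem_range.2 (by omega))
  obtain ⟨a, -, ha⟩ := hD.complete (fun n => ∑ i ∈ S n, c i • y i)
    (fun n => hD.mem_span (hD.sum_mem hne (S n) c y hy))
    (fun ε hε => by
      obtain ⟨N, hN⟩ := hsmall ε hε
      exact ⟨N, fun m hm n hn => hdiff N _ _ (hS N m hm) (hS N n hn) _ (hN N le_rfl)⟩)
  refine ⟨a, fun ε hε => ?_⟩
  obtain ⟨N, hN⟩ := ha (ε / 2) (half_pos hε)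
  obtain ⟨N', hN'⟩ := hsmall (ε / 2) (half_pos hε)
  refine ⟨s N', fun t ht => ?_⟩
  have e : a - ∑ i ∈ t, c i • y i = (∑ i ∈ S (max N N'), c i • y i - ∑ i ∈ t, c i • y i)
      - (∑ i ∈ S (max N N'), c i • y i - a) := by abel
  have := hD.sub_mem (half_pos hε).le (half_pos hε).le
    (hdiff N' (S (max N N')) t (hS _ _ (le_max_right _ _)) ht _ (hN' N' le_rfl))
    (hN (max N N') (le_max_left _ _))
  rw [e]
  simpa using this

variable [Bornology X]

theorem IsMackeySum.smul {f : ι → X} {a : X} (c : ℂ) (ha : IsMackeySum f a) :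
    IsMackeySum (fun i => c • f i) (c • a) := by
  obtain ⟨D, hb, hD, h⟩ := ha
  refine ⟨D, hb, hD, fun ε hε => ?_⟩
  obtain ⟨s, hs⟩ := h (ε / (‖c‖ + 1)) (by positivity)
  refine ⟨s, fun t ht => ?_⟩
  have e : c • a - ∑ i ∈ t, c • f i = c • (a - ∑ i ∈ t, f i) := by
    rw [smul_sub, Finset.smul_sum]
  rw [e]
  refine hD.smul_mem c ?_ (by positivity) (hs t ht)
  rw [← mul_div_assoc, div_le_iff₀ (by positivity)]
  nlinarith [norm_nonneg c]

variable [CompleteBornSpace X]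

theorem exists_disk_union {s t : Set X} (hs : IsBounded s) (ht : IsBounded t) :
    ∃ D, D.Nonempty ∧ s ⊆ D ∧ t ⊆ D ∧ IsBounded D ∧ IsCompletantDisk D := by
  obtain ⟨D, h1, h2, h3⟩ := CompleteBornSpace.exists_disk
    ((hs.union ht).union (isBounded_singleton (x := (0 : X))))
  exact ⟨D, ⟨0, h1 (by simp)⟩, fun x hx => h1 (by simp [hx]), fun x hx => h1 (by simp [hx]), h2, h3⟩

theorem IsMackeySum.unique {f : ι → X} {a b : X} (ha : IsMackeySum f a) (hb : IsMackeySum f b) :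
    a = b := by
  classical
  obtain ⟨D₁, b₁, -, h₁⟩ := ha
  obtain ⟨D₂, b₂, -, h₂⟩ := hb
  obtain ⟨D, -, i₁, i₂, -, hD⟩ := exists_disk_union b₁ b₂
  refine sub_eq_zero.1 (hD.separated _ fun ε hε => ?_)
  obtain ⟨s₁, hs₁⟩ := h₁ (ε / 2) (half_pos hε)
  obtain ⟨s₂, hs₂⟩ := h₂ (ε / 2) (half_pos hε)
  have e : a - b = (a - ∑ i ∈ s₁ ∪ s₂, f i) - (b - ∑ i ∈ s₁ ∪ s₂, f i) := by abel
  have := hD.sub_mem (half_pos hε).le (half_pos hε).le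
    (smul_set_mono i₁ (hs₁ (s₁ ∪ s₂) Finset.subset_union_left))
    (smul_set_mono i₂ (hs₂ (s₁ ∪ s₂) Finset.subset_union_right))
  rwa [add_halves, ← e] at this

theorem IsMackeySum.add {f g : ι → X} {a b : X} (ha : IsMackeySum f a) (hb : IsMackeySum g b) :
    IsMackeySum (fun i => f i + g i) (a + b) := by
  classical
  obtain ⟨D₁, b₁, -, h₁⟩ := ha
  obtain ⟨D₂, b₂, -, h₂⟩ := hb
  obtain ⟨D, -, i₁, i₂, hb, hD⟩ := exists_disk_union b₁ b₂
  refine ⟨D, hb, hD, fun ε hε => ?_⟩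
  obtain ⟨s₁, hs₁⟩ := h₁ (ε / 2) (half_pos hε)
  obtain ⟨s₂, hs₂⟩ := h₂ (ε / 2) (half_pos hε)
  refine ⟨s₁ ∪ s₂, fun t ht => ?_⟩
  have e : a + b - ∑ i ∈ t, (f i + g i) = (a - ∑ i ∈ t, f i) + (b - ∑ i ∈ t, g i) := by
    rw [Finset.sum_add_distrib]; abel
  rw [e]
  simpa using hD.add_mem (half_pos hε).le (half_pos hε).le
    (smul_set_mono i₁ (hs₁ _ (Finset.subset_union_left.trans ht)))
    (smul_set_mono i₂ (hs₂ _ (Finset.subset_union_right.trans ht)))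

theorem isMackeySum_single (f : ι → X) (i : ι) (hf : ∀ j, j ≠ i → f j = 0) :
    IsMackeySum f (f i) := by
  classical
  obtain ⟨D, ⟨d, hd⟩, -, -, hb, hD⟩ := exists_disk_union (X := X) isBounded_empty isBounded_empty
  refine ⟨D, hb, hD, fun ε hε => ⟨{i}, fun t ht => ?_⟩⟩
  rw [Finset.sum_eq_single i (fun j _ hj => hf j hj) (fun h => absurd (ht (by simp)) h), sub_self]
  refine hD.mono le_rfl hε.le ⟨d, hd, zero_smul ℝ d⟩

end MackeySums

set_option linter.unusedSectionVars false

section CompletedTensorProduct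

variable {V : Type u} {W : Type v} {X : Type w}
variable [AddCommGroup V] [Module ℂ V] [Bornology V]
variable [AddCommGroup W] [Module ℂ W] [Bornology W]
variable [AddCommGroup X] [Module ℂ X] [Bornology X]

variable (V W) in
/-- The formal sums `∑ c (v, w) v ⊗ w` with `∑ |c (v, w)| < ∞` whose terms involve only vectors `v`
and `w` from bounded sets. -/
noncomputable def FormalSum : Submodule ℂ (lp (fun _ : V × W => ℂ) 1) where
  carrier := {c | ∃ A B, IsBounded A ∧ IsBounded B ∧ ∀ p : V × W, c p ≠ 0 → p.1 ∈ A ∧ p.2 ∈ B}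
  zero_mem' := ⟨∅, ∅, isBounded_empty, isBounded_empty, fun p hp => absurd rfl hp⟩
  add_mem' := by
    rintro c d ⟨A, B, hA, hB, h⟩ ⟨A', B', hA', hB', h'⟩
    refine ⟨A ∪ A', B ∪ B', hA.union hA', hB.union hB', fun p hp => ?_⟩
    by_cases h0 : c p = 0
    · have := h' p (fun h1 => hp (by simp [h0, h1]))
      exact ⟨Or.inr this.1, Or.inr this.2⟩
    · exact ⟨Or.inl (h p h0).1, Or.inl (h p h0).2⟩
  smul_mem' := by
    rintro z c ⟨A, B, hA, hB, h⟩
    exact ⟨A, B, hA, hB, fun p hp => h p fun h0 => hp (by simp [h0])⟩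

namespace FormalSum

/-- The formal sums of norm at most `r` with terms from `A × B`. -/
def ball (A : Set V) (B : Set W) (r : ℝ) : Set (FormalSum V W) :=
  {c | (∀ p : V × W, c.1 p ≠ 0 → p.1 ∈ A ∧ p.2 ∈ B) ∧ ‖c.1‖ ≤ r}

/-- The formal sum `v ⊗ w`. -/
noncomputable def single (v : V) (w : W) : FormalSum V W := by
  classical
  exact ⟨lp.single 1 (v, w) 1, {v}, {w}, isBounded_singleton, isBounded_singleton, fun p hp => by
    by_cases h : p = (v, w)
    · subst h; simp
    · exact absurd (Pi.single_eq_of_ne (M := fun _ : V × W => ℂ) h 1) hp⟩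

/-- Submodules closed under bornological limits. -/
def IsMackeyClosed (P : Submodule ℂ (FormalSum V W)) : Prop :=
  ∀ c, (∃ A B, IsBounded A ∧ IsBounded B ∧ ∀ ε : ℝ, 0 < ε → ∃ n ∈ P, c - n ∈ ball A B ε) → c ∈ P

variable (V W) in
/-- The bilinearity relations. -/
noncomputable def relators : Set (FormalSum V W) :=
  {c | (∃ v v' w, c = single (v + v') w - single v w - single v' w) ∨
    (∃ v w w', c = single v (w + w') - single v w - single v w') ∨
    (∃ (z : ℂ) (v : V) (w : W), c = single (z • v) w - z • single v w) ∨
    ∃ (z : ℂ) (v : V) (w : W), c = single v (z • w) - z • single v w}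

variable (V W) in
/-- The closed subspace generated by the bilinearity relations. -/
noncomputable def kernel : Submodule ℂ (FormalSum V W) :=
  sInf {P | IsMackeyClosed P ∧ relators V W ⊆ P}

theorem kernel_closed : IsMackeyClosed (kernel V W) := by
  rintro c ⟨A, B, hA, hB, h⟩
  refine Submodule.mem_sInf.2 fun P hP => hP.1 c ⟨A, B, hA, hB, fun ε hε => ?_⟩
  obtain ⟨n, hn, hc⟩ := h ε hε
  exact ⟨n, Submodule.mem_sInf.1 hn P hP, hc⟩

theorem relators_subset : relators V W ⊆ kernel V W := fun _ hc =>
  Submodule.mem_sInf.2 fun _ hP => hP.2 hc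

theorem single_mem_ball (v : V) (w : W) : single v w ∈ ball {v} {w} 1 := by
  classical
  refine ⟨fun p hp => ?_, ?_⟩
  · by_cases h : p = (v, w)
    · subst h; simp
    · exact absurd (Pi.single_eq_of_ne (M := fun _ : V × W => ℂ) h 1) hp
  · exact ((lp.norm_single (E := fun _ : V × W => ℂ) one_pos (v, w) 1).trans norm_one).le

theorem ball_mono {A A' : Set V} {B B' : Set W} {r r' : ℝ} (hA : A ⊆ A') (hB : B ⊆ B')
    (hr : r ≤ r') : ball A B r ⊆ ball A' B' r' :=
  fun _ hc => ⟨fun p hp => ⟨hA (hc.1 p hp).1, hB (hc.1 p hp).2⟩, hc.2.trans hr⟩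

theorem exists_ball (c : FormalSum V W) :
    ∃ A B, IsBounded A ∧ IsBounded B ∧ c ∈ ball A B ‖c.1‖ := by
  obtain ⟨A, B, hA, hB, h⟩ := c.2
  exact ⟨A, B, hA, hB, h, le_rfl⟩

theorem ball_add {A : Set V} {B : Set W} {r r' : ℝ} {c d : FormalSum V W} (hc : c ∈ ball A B r)
    (hd : d ∈ ball A B r') : c + d ∈ ball A B (r + r') := by
  refine ⟨fun p hp => ?_, (norm_add_le _ _).trans (add_le_add hc.2 hd.2)⟩
  by_cases h0 : c.1 p = 0
  · refine hd.1 p fun h1 => hp ?_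
    change c.1 p + d.1 p = 0
    rw [h0, h1, add_zero]
  · exact hc.1 p h0

theorem ball_smul {A : Set V} {B : Set W} {r : ℝ} (z : ℂ) {c : FormalSum V W}
    (hc : c ∈ ball A B r) : z • c ∈ ball A B (‖z‖ * r) := by
  refine ⟨fun p hp => hc.1 p fun h0 => hp ?_, ?_⟩
  · change z * c.1 p = 0
    rw [h0, mul_zero]
  · change ‖z • c.1‖ ≤ _
    rw [norm_smul]
    exact mul_le_mul_of_nonneg_left hc.2 (norm_nonneg z)

theorem ball_sub {A : Set V} {B : Set W} {r r' : ℝ} {c d : FormalSum V W} (hc : c ∈ ball A B r)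
    (hd : d ∈ ball A B r') : c - d ∈ ball A B (r + r') := by
  have := ball_add hc (ball_smul (-1 : ℂ) hd)
  simpa [sub_eq_add_neg] using this

theorem summable_norm (c : FormalSum V W) : Summable fun p => ‖c.1 p‖ := by
  simpa using (lp.memℓp c.1).summable (by simp)

theorem tsum_norm (c : FormalSum V W) : ∑' p, ‖c.1 p‖ = ‖c.1‖ := by
  have := lp.norm_eq_tsum_rpow (p := 1) (by simp) c.1
  simpa using this.symm

end FormalSum

open FormalSum

variable (V W) in
/-- The completed projective bornological tensor product `V ⊗̂ W`: the formal sums modulo the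
closed subspace generated by the bilinearity relations. -/
noncomputable def CTensor : Type (max u v) := FormalSum V W ⧸ kernel V W

noncomputable instance : AddCommGroup (CTensor V W) :=
  inferInstanceAs (AddCommGroup (FormalSum V W ⧸ kernel V W))

noncomputable instance : Module ℂ (CTensor V W) :=
  inferInstanceAs (Module ℂ (FormalSum V W ⧸ kernel V W))

namespace CTensor

variable (V W) in
/-- The quotient map. -/
noncomputable def mk : FormalSum V W →ₗ[ℂ] CTensor V W := (kernel V W).mkQ

/-- The elementary tensor `v ⊗ w`. -/
noncomputable def tmul (v : V) (w : W) : CTensor V W := mk V W (single v w)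

theorem mk_surjective : Function.Surjective (mk V W) := Submodule.mkQ_surjective _

theorem mk_eq_zero {c : FormalSum V W} : mk V W c = 0 ↔ c ∈ kernel V W :=
  Submodule.Quotient.mk_eq_zero _

/-- The bounded subsets of `V ⊗̂ W` are the sets of classes of formal sums with bounded norm and
with terms from fixed bounded subsets of `V` and `W`. -/
instance : Bornology (CTensor V W) :=
  Bornology.ofBounded
    {s | ∃ A B r, IsBounded A ∧ IsBounded B ∧ s ⊆ mk V W '' ball A B r}
    ⟨∅, ∅, 0, isBounded_empty, isBounded_empty, empty_subset _⟩
    (by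
      rintro s ⟨A, B, r, hA, hB, h⟩ t hts
      exact ⟨A, B, r, hA, hB, hts.trans h⟩)
    (by
      rintro s ⟨A, B, r, hA, hB, h⟩ t ⟨A', B', r', hA', hB', h'⟩
      refine ⟨A ∪ A', B ∪ B', max r r', hA.union hA', hB.union hB', union_subset ?_ ?_⟩
      · exact h.trans (image_mono (ball_mono subset_union_left subset_union_left
          (le_max_left _ _)))
      · exact h'.trans (image_mono (ball_mono subset_union_right subset_union_right
          (le_max_right _ _))))
    (by
      intro t
      obtain ⟨c, rfl⟩ := mk_surjective t
      obtain ⟨A, B, hA, hB, h⟩ := exists_ball c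
      exact ⟨A, B, ‖c.1‖, hA, hB, singleton_subset_iff.2 ⟨c, h, rfl⟩⟩)

theorem isBounded_iff {s : Set (CTensor V W)} :
    IsBounded s ↔ ∃ A B r, IsBounded A ∧ IsBounded B ∧ s ⊆ mk V W '' ball A B r :=
  Bornology.isBounded_ofBounded_iff _

theorem isBounded_ball {A : Set V} {B : Set W} (hA : IsBounded A) (hB : IsBounded B) (r : ℝ) :
    IsBounded (mk V W '' ball A B r) :=
  isBounded_iff.2 ⟨A, B, r, hA, hB, Subset.rfl⟩

theorem isBddBilin_tmul : IsBddBilin (RingHom.id ℂ) (tmul : V → W → CTensor V W) where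
  add_left a a' b := by
    have : mk V W (single (a + a') b - single a b - single a' b) = 0 :=
      mk_eq_zero.2 (relators_subset (Or.inl ⟨a, a', b, rfl⟩))
    rw [map_sub, map_sub, sub_sub, sub_eq_zero] at this
    exact this
  add_right a b b' := by
    have : mk V W (single a (b + b') - single a b - single a b') = 0 :=
      mk_eq_zero.2 (relators_subset (Or.inr (Or.inl ⟨a, b, b', rfl⟩)))
    rw [map_sub, map_sub, sub_sub, sub_eq_zero] at this
    exact this
  smul_left z a b := by
    have : mk V W (single (z • a) b - z • single a b) = 0 :=
      mk_eq_zero.2 (relators_subset (Or.inr (Or.inr (Or.inl ⟨z, a, b, rfl⟩))))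
    rw [map_sub, map_smul, sub_eq_zero] at this
    exact this
  smul_right z a b := by
    have : mk V W (single a (z • b) - z • single a b) = 0 :=
      mk_eq_zero.2 (relators_subset (Or.inr (Or.inr (Or.inr ⟨z, a, b, rfl⟩))))
    rw [map_sub, map_smul, sub_eq_zero] at this
    exact this
  bdd s t hs ht := by
    refine isBounded_iff.2 ⟨s, t, 1, hs, ht, ?_⟩
    rintro _ ⟨a, ha, b, hb, rfl⟩
    exact ⟨single a b, ball_mono (singleton_subset_iff.2 ha) (singleton_subset_iff.2 hb) le_rfl
      (single_mem_ball a b), rfl⟩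

theorem smul_image_ball {A : Set V} {B : Set W} {r ε : ℝ} (hε : 0 < ε) {t : CTensor V W} :
    t ∈ ε • (mk V W '' ball A B r) ↔ t ∈ mk V W '' ball A B (ε * r) := by
  have h0 : (ε : ℂ) ≠ 0 := by exact_mod_cast hε.ne'
  constructor
  · rintro ⟨_, ⟨c, hc, rfl⟩, rfl⟩
    refine ⟨(ε : ℂ) • c, ?_, ?_⟩
    · simpa [abs_of_pos hε] using ball_smul (ε : ℂ) hc
    · rw [map_smul]; exact Complex.coe_smul _ _
  · rintro ⟨c, hc, rfl⟩
    refine ⟨_, ⟨(ε : ℂ)⁻¹ • c, ?_, rfl⟩, ?_⟩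
    · have := ball_smul (ε : ℂ)⁻¹ hc
      rwa [norm_inv, Complex.norm_real, Real.norm_of_nonneg hε.le, inv_mul_cancel_left₀ hε.ne']
        at this
    · change ε • mk V W ((ε : ℂ)⁻¹ • c) = mk V W c
      rw [← Complex.coe_smul, ← map_smul, smul_inv_smul₀ h0]

theorem exists_sum_ball {A : Set V} {B : Set W} (hA : IsBounded A) (hB : IsBounded B)
    (d : ℕ → FormalSum V W) (r : ℝ) (hd : ∀ n, d n ∈ ball A B (r * (1 / 2) ^ n)) :
    ∃ c : FormalSum V W, ∀ n, c - ∑ i ∈ Finset.range n, d i ∈ ball A B (2 * r * (1 / 2) ^ n) := by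
  have hg : Summable fun n => r * (1 / 2 : ℝ) ^ n := summable_geometric_two.mul_left r
  have hs : Summable fun n => (d n).1 := Summable.of_norm_bounded hg fun n => (hd n).2
  have hev : ∀ (p : V × W) (n : ℕ), (p.1 ∉ A ∨ p.2 ∉ B) → (d n).1 p = 0 := by
    intro p n hp
    by_contra h
    have := (hd n).1 p h
    tauto
  have hsum : ∀ p : V × W, (p.1 ∉ A ∨ p.2 ∉ B) → (∑' n, (d n).1) p = 0 := by
    intro p hp
    have h1 := (lp.evalCLM ℂ (fun _ : V × W => ℂ) 1 p).map_tsum hs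
    have h2 : ∀ n, lp.evalCLM ℂ (fun _ : V × W => ℂ) 1 p (d n).1 = 0 := fun n => hev p n hp
    rw [tsum_congr h2, tsum_zero] at h1
    exact h1
  have hmem : (∑' n, (d n).1) ∈ FormalSum V W := ⟨A, B, hA, hB, fun p hp => by
    by_contra h
    exact hp (hsum p (by tauto))⟩
  refine ⟨⟨_, hmem⟩, fun n => ⟨fun p hp => ?_, ?_⟩⟩
  · by_contra h
    have hp' : p.1 ∉ A ∨ p.2 ∉ B := by tauto
    have h2 : (∑ i ∈ Finset.range n, d i).1 p = 0 := by
      rw [AddSubmonoidClass.coe_finsetSum, lp.coeFn_sum, Finset.sum_apply]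
      exact Finset.sum_eq_zero fun i _ => hev p i hp'
    refine hp ?_
    change (∑' n, (d n).1) p - (∑ i ∈ Finset.range n, d i).1 p = 0
    rw [hsum p hp', h2, sub_zero]
  · have h1 : (∑' n, (d n).1) - ∑ i ∈ Finset.range n, (d i).1 = ∑' i, (d (i + n)).1 := by
      rw [← hs.sum_add_tsum_nat_add n, add_sub_cancel_left]
    change ‖(∑' n, (d n).1) - ((∑ i ∈ Finset.range n, d i : FormalSum V W) : lp _ 1)‖ ≤ _
    rw [AddSubmonoidClass.coe_finsetSum, h1]
    have h2 : HasSum (fun i => r * (1 / 2 : ℝ) ^ (i + n)) (2 * r * (1 / 2) ^ n) := by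
      have e : (fun i => r * (1 / 2 : ℝ) ^ (i + n)) = fun i => r * (1 / 2 : ℝ) ^ n * (1 / 2) ^ i := by
        ext i; ring
      rw [e, show 2 * r * (1 / 2 : ℝ) ^ n = r * (1 / 2 : ℝ) ^ n * 2 by ring]
      exact hasSum_geometric_two.mul_left (r * (1 / 2 : ℝ) ^ n)
    exact tsum_of_norm_bounded h2 fun i => (hd (i + n)).2

theorem isCompletantDisk_ball {A : Set V} {B : Set W} (hA : IsBounded A) (hB : IsBounded B)
    {r : ℝ} (hr : 0 < r) : IsCompletantDisk (mk V W '' ball A B r) where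
  balanced := by
    rw [balanced_iff_smul_mem]
    rintro z hz _ ⟨c, hc, rfl⟩
    refine ⟨z • c, ball_mono Subset.rfl Subset.rfl ?_ (ball_smul z hc), map_smul _ _ _⟩
    nlinarith
  convex := by
    rw [convex_iff_forall_pos]
    rintro _ ⟨c, hc, rfl⟩ _ ⟨d, hd, rfl⟩ a b ha hb hab
    refine ⟨(a : ℂ) • c + (b : ℂ) • d, ?_, ?_⟩
    · refine ball_mono Subset.rfl Subset.rfl ?_ (ball_add (ball_smul (a : ℂ) hc)
        (ball_smul (b : ℂ) hd))
      rw [Complex.norm_real, Complex.norm_real, Real.norm_of_nonneg ha.le,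
        Real.norm_of_nonneg hb.le, ← add_mul, hab, one_mul]
    · rw [map_add, map_smul, map_smul]
      exact congrArg₂ _ (Complex.coe_smul _ _) (Complex.coe_smul _ _)
  separated := by
    intro t ht
    obtain ⟨c, rfl⟩ := mk_surjective t
    refine mk_eq_zero.2 (kernel_closed c ⟨A, B, hA, hB, fun ε hε => ?_⟩)
    obtain ⟨d, hd, hdc⟩ := (smul_image_ball (div_pos hε hr)).1 (ht (ε / r) (div_pos hε hr))
    rw [div_mul_cancel₀ _ hr.ne'] at hd
    refine ⟨c - d, mk_eq_zero.1 (by rw [map_sub, hdc, sub_self]), by simpa using hd⟩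
  complete := by
    intro s hs hc
    have hN : ∀ k : ℕ, ∃ N, ∀ m ≥ N, ∀ n ≥ N,
        s m - s n ∈ ((1 / 2 : ℝ) ^ k) • (mk V W '' ball A B r) := fun k => hc _ (by positivity)
    choose N hN using hN
    let M : ℕ → ℕ := fun k => (Finset.range (k + 1)).sup N
    have hM : ∀ j k, j ≤ k → N j ≤ M k := fun j k h =>
      Finset.le_sup (f := N) (Finset.mem_range.2 (by omega))
    have hstep : ∀ k, ∃ d ∈ ball A B (r * (1 / 2) ^ k), mk V W d = s (M (k + 1)) - s (M k) := by
      intro k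
      obtain ⟨d, hd, h⟩ := (smul_image_ball (by positivity)).1
        (hN k (M (k + 1)) (hM _ _ (by omega)) (M k) (hM _ _ le_rfl))
      exact ⟨d, by rwa [mul_comm], h⟩
    choose d hd hds using hstep
    obtain ⟨c, hcs⟩ := exists_sum_ball hA hB d r hd
    have htel : ∀ n, mk V W (∑ i ∈ Finset.range n, d i) = s (M n) - s (M 0) := by
      intro n
      rw [map_sum, Finset.sum_congr rfl fun i _ => hds i, Finset.sum_range_sub (fun k => s (M k))]
    have hspan : ∀ {ε : ℝ} {c : FormalSum V W}, 0 < ε → c ∈ ball A B (ε * r) →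
        mk V W c ∈ Submodule.span ℂ (mk V W '' ball A B r) := by
      intro ε c hε h
      obtain ⟨x, hx, he⟩ := (smul_image_ball hε).2 ⟨c, h, rfl⟩
      rw [← he]
      change ε • x ∈ _
      rw [← Complex.coe_smul]
      exact Submodule.smul_mem _ _ (Submodule.subset_span hx)
    refine ⟨s (M 0) + mk V W c, Submodule.add_mem _ (hs _) (hspan two_pos (by simpa using hcs 0)),
      fun ε hε => ?_⟩
    obtain ⟨k, hk⟩ := exists_pow_lt_of_lt_one (by positivity : 0 < ε / 3)
      (by norm_num : (1 / 2 : ℝ) < 1)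
    refine ⟨N k, fun n hn => (smul_image_ball hε).2 ?_⟩
    obtain ⟨x, hx, hxs⟩ := (smul_image_ball (by positivity)).1
      (hN k n hn (M k) (hM _ _ le_rfl))
    refine ⟨x - (c - ∑ i ∈ Finset.range k, d i), ball_mono Subset.rfl Subset.rfl ?_
      (ball_sub hx (hcs k)), ?_⟩
    · nlinarith
    · rw [map_sub, map_sub, htel, hxs]; abel

end CTensor

theorem CompleteBornSpace.of_add_smul_disk
    (h₁ : ∀ {s t : Set V}, IsBounded s → IsBounded t → IsBounded (s + t))
    (h₂ : ∀ (c : ℂ) {s : Set V}, IsBounded s → IsBounded (c • s))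
    (h₃ : ∀ {s : Set V}, IsBounded s → ∃ D, s ⊆ D ∧ IsBounded D ∧ IsCompletantDisk D) :
    CompleteBornSpace V where
  bounded_add := h₁
  bounded_smul := h₂
  bounded_hull {s} hs := by
    obtain ⟨D, hsD, hb, hD⟩ := h₃ hs
    exact hb.subset (convexHull_min (hD.balanced.balancedHull_subset_of_subset hsD) hD.convex)
  exists_disk := h₃

instance : CompleteBornSpace (CTensor V W) :=
  CompleteBornSpace.of_add_smul_disk
    (by
      intro s t hs ht
      obtain ⟨A, B, r, hA, hB, h⟩ := CTensor.isBounded_iff.1 hs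
      obtain ⟨A', B', r', hA', hB', h'⟩ := CTensor.isBounded_iff.1 ht
      refine CTensor.isBounded_iff.2 ⟨A ∪ A', B ∪ B', r + r', hA.union hA', hB.union hB', ?_⟩
      rintro _ ⟨x, hx, y, hy, rfl⟩
      obtain ⟨c, hc, rfl⟩ := h hx
      obtain ⟨d, hd, rfl⟩ := h' hy
      exact ⟨c + d, ball_add (ball_mono subset_union_left subset_union_left le_rfl hc)
        (ball_mono subset_union_right subset_union_right le_rfl hd), map_add _ _ _⟩)
    (by
      intro z s hs
      obtain ⟨A, B, r, hA, hB, h⟩ := CTensor.isBounded_iff.1 hs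
      refine CTensor.isBounded_iff.2 ⟨A, B, ‖z‖ * r, hA, hB, ?_⟩
      rintro _ ⟨x, hx, rfl⟩
      obtain ⟨c, hc, rfl⟩ := h hx
      exact ⟨z • c, ball_smul z hc, map_smul _ _ _⟩)
    (by
      intro s hs
      obtain ⟨A, B, r, hA, hB, h⟩ := CTensor.isBounded_iff.1 hs
      exact ⟨_, h.trans (image_mono (ball_mono Subset.rfl Subset.rfl (le_max_left r 1))),
        CTensor.isBounded_ball hA hB _,
        CTensor.isCompletantDisk_ball hA hB (lt_max_of_lt_right one_pos)⟩)



namespace CTensor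

variable {σ : ℂ →+* ℂ} [RingHomIsometric σ] [CompleteBornSpace X]

theorem exists_value {β : V → W → X} (hβ : IsBddBilin σ β) (c : FormalSum V W) :
    ∃ a, IsMackeySum (fun p => σ (c.1 p) • β p.1 p.2) a := by
  obtain ⟨A, B, hA, hB, hc⟩ := exists_ball c
  obtain ⟨D, hne, hD, -, hb, hcd⟩ := exists_disk_union (hβ.bdd A B hA hB) isBounded_empty
  obtain ⟨a, ha⟩ := hcd.exists_sum hne (fun p => σ (c.1 p))
    (by simpa only [RingHomIsometric.norm_map] using summable_norm c) (fun p => β p.1 p.2)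
    (fun p hp => hD (mem_image2_of_mem (hc.1 p fun h => hp (by simp [h])).1
      (hc.1 p fun h => hp (by simp [h])).2))
  exact ⟨a, D, hb, hcd, ha⟩

/-- The value `∑ σ (c (v, w)) • β v w` of `β` on a formal sum `c`. -/
noncomputable def value {β : V → W → X} (hβ : IsBddBilin σ β) (c : FormalSum V W) : X :=
  (exists_value hβ c).choose

theorem value_spec {β : V → W → X} (hβ : IsBddBilin σ β) (c : FormalSum V W) :
    IsMackeySum (fun p => σ (c.1 p) • β p.1 p.2) (value hβ c) :=
  (exists_value hβ c).choose_spec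

theorem value_mem {β : V → W → X} (hβ : IsBddBilin σ β) {A : Set V} {B : Set W} {D : Set X}
    (hD : IsBounded D) (hcd : IsCompletantDisk D) (hβD : ∀ a ∈ A, ∀ b ∈ B, β a b ∈ D)
    (hne : D.Nonempty) {r s : ℝ} (hrs : r < s) {c : FormalSum V W} (hc : c ∈ ball A B r) :
    value hβ c ∈ s • D := by
  have hy : ∀ p : V × W, σ (c.1 p) ≠ 0 → β p.1 p.2 ∈ D := fun p hp =>
    hβD _ (hc.1 p fun h => hp (by simp [h])).1 _ (hc.1 p fun h => hp (by simp [h])).2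
  have hs : Summable fun p => ‖σ (c.1 p)‖ := by
    simpa only [RingHomIsometric.norm_map] using summable_norm c
  obtain ⟨a, ha⟩ := hcd.exists_sum hne (fun p => σ (c.1 p)) hs (fun p => β p.1 p.2) hy
  have hv : value hβ c = a := (value_spec hβ c).unique ⟨D, hD, hcd, ha⟩
  obtain ⟨t, ht⟩ := ha (s - r) (by linarith)
  have hle : ∑ p ∈ t, ‖σ (c.1 p)‖ ≤ r := by
    refine (hs.sum_le_tsum t fun _ _ => norm_nonneg _).trans ?_
    simp only [RingHomIsometric.norm_map]
    rw [tsum_norm]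
    exact hc.2
  have hr : 0 ≤ r := (norm_nonneg _).trans hc.2
  have := hcd.add_mem (by linarith) hr (ht t Finset.Subset.rfl)
    (hcd.mono (Finset.sum_nonneg fun _ _ => norm_nonneg _) hle
      (hcd.sum_mem hne t (fun p => σ (c.1 p)) (fun p => β p.1 p.2) hy))
  rw [hv]
  simpa using this

/-- The values of `β` on formal sums, as a semilinear map. -/
noncomputable def valueMap {β : V → W → X} (hβ : IsBddBilin σ β) : FormalSum V W →ₛₗ[σ] X where
  toFun := value hβ
  map_add' c d := by
    refine (value_spec hβ (c + d)).unique ?_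
    convert (value_spec hβ c).add (value_spec hβ d) using 2 with p
    change σ (c.1 p + d.1 p) • _ = _
    rw [map_add, add_smul]
  map_smul' z c := by
    refine (value_spec hβ (z • c)).unique ?_
    convert (value_spec hβ c).smul (σ z) using 2 with p
    change σ (z * c.1 p) • _ = _
    rw [map_mul, mul_smul]

theorem value_single {β : V → W → X} (hβ : IsBddBilin σ β) (v : V) (w : W) :
    value hβ (single v w) = β v w := by
  classical
  refine (value_spec hβ (single v w)).unique ?_
  have h1 : (single v w : FormalSum V W).1 (v, w) = 1 :=
    Pi.single_eq_same (M := fun _ : V × W => ℂ) (v, w) 1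
  have := isMackeySum_single (fun p => σ ((single v w : FormalSum V W).1 p) • β p.1 p.2) (v, w)
    (fun p hp => by
      have h0 : (single v w : FormalSum V W).1 p = 0 :=
        Pi.single_eq_of_ne (M := fun _ : V × W => ℂ) hp 1
      rw [h0, map_zero, zero_smul])
  simpa [h1] using this

theorem kernel_le_ker {β : V → W → X} (hβ : IsBddBilin σ β) :
    kernel V W ≤ LinearMap.ker (valueMap hβ) := by
  refine sInf_le ⟨?_, ?_⟩
  · rintro c ⟨A, B, hA, hB, h⟩
    obtain ⟨D, hne, hD, -, hb, hcd⟩ := exists_disk_union (hβ.bdd A B hA hB) isBounded_empty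
    refine LinearMap.mem_ker.2 (hcd.separated _ fun ε hε => ?_)
    obtain ⟨n, hn, hcn⟩ := h (ε / 2) (half_pos hε)
    have e : valueMap hβ c = valueMap hβ (c - n) := by
      rw [map_sub, LinearMap.mem_ker.1 hn, sub_zero]
    rw [e]
    exact value_mem hβ hb hcd (fun a ha b hb => hD (mem_image2_of_mem ha hb)) hne
      (half_lt_self hε) hcn
  · have hs : ∀ v w, valueMap hβ (single v w) = β v w := value_single hβ
    rintro _ (⟨v, v', w, rfl⟩ | ⟨v, w, w', rfl⟩ | ⟨z, v, w, rfl⟩ | ⟨z, v, w, rfl⟩)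
    · change valueMap hβ _ = 0
      rw [map_sub, map_sub, hs, hs, hs, hβ.add_left]; abel
    · change valueMap hβ _ = 0
      rw [map_sub, map_sub, hs, hs, hs, hβ.add_right]; abel
    · change valueMap hβ _ = 0
      rw [map_sub, LinearMap.map_smulₛₗ, hs, hs, hβ.smul_left, sub_self]
    · change valueMap hβ _ = 0
      rw [map_sub, LinearMap.map_smulₛₗ, hs, hs, hβ.smul_right, sub_self]

/-- The universal property of `V ⊗̂ W`: the map `v ⊗ w ↦ β v w`. -/
noncomputable def lift {β : V → W → X} (hβ : IsBddBilin σ β) : CTensor V W →ₛₗ[σ] X :=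
  (kernel V W).liftQ (valueMap hβ) (kernel_le_ker hβ)

theorem lift_mk {β : V → W → X} (hβ : IsBddBilin σ β) (c : FormalSum V W) :
    lift hβ (mk V W c) = value hβ c := rfl

@[simp] theorem lift_tmul {β : V → W → X} (hβ : IsBddBilin σ β) (v : V) (w : W) :
    lift hβ (tmul v w) = β v w := value_single hβ v w

theorem lift_add {β β₁ β₂ : V → W → X} (hβ : IsBddBilin σ β) (h₁ : IsBddBilin σ β₁)
    (h₂ : IsBddBilin σ β₂) (h : ∀ v w, β v w = β₁ v w + β₂ v w) (t : CTensor V W) :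
    lift hβ t = lift h₁ t + lift h₂ t := by
  obtain ⟨c, rfl⟩ := mk_surjective t
  simp only [lift_mk]
  refine (value_spec hβ c).unique ?_
  convert (value_spec h₁ c).add (value_spec h₂ c) using 2 with p
  rw [h, smul_add]

theorem lift_smul {β β₁ : V → W → X} (z : ℂ) (hβ : IsBddBilin σ β) (h₁ : IsBddBilin σ β₁)
    (h : ∀ v w, β v w = z • β₁ v w) (t : CTensor V W) : lift hβ t = z • lift h₁ t := by
  obtain ⟨c, rfl⟩ := mk_surjective t
  simp only [lift_mk]
  refine (value_spec hβ c).unique ?_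
  convert (value_spec h₁ c).smul z using 2 with p
  rw [h, smul_comm]

theorem lift_bdd_uniform (σ : ℂ →+* ℂ) [RingHomIsometric σ] (A : Set V) (B : Set W) (r : ℝ)
    {E : Set X} (hE : IsBounded E) :
    ∃ D, IsBounded D ∧ ∀ (β : V → W → X) (hβ : IsBddBilin σ β),
      (∀ a ∈ A, ∀ b ∈ B, β a b ∈ E) → ∀ t ∈ mk V W '' ball A B r, lift hβ t ∈ D := by
  obtain ⟨D, hne, hD, -, hb, hcd⟩ := exists_disk_union hE isBounded_empty
  refine ⟨((r + 1 : ℝ) : ℂ) • D, CompleteBornSpace.bounded_smul _ hb, ?_⟩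
  rintro β hβ h _ ⟨c, hc, rfl⟩
  obtain ⟨d, hd, he⟩ := value_mem hβ hb hcd (fun a ha b hb => hD (h a ha b hb)) hne (lt_add_one r) hc
  exact ⟨d, hd, (Complex.coe_smul (r + 1) d).trans he⟩

theorem lift_bdd {β : V → W → X} (hβ : IsBddBilin σ β) : IsBdd (lift hβ) := by
  intro s hs
  obtain ⟨A, B, r, hA, hB, h⟩ := isBounded_iff.1 hs
  obtain ⟨D, hD, h'⟩ := lift_bdd_uniform σ A B r (hβ.bdd A B hA hB)
  refine hD.subset ?_
  rintro _ ⟨t, ht, rfl⟩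
  exact h' β hβ (fun a ha b hb => mem_image2_of_mem ha hb) t (h ht)

end CTensor

end CompletedTensorProduct

instance : CompleteBornSpace ℂ :=
  CompleteBornSpace.of_add_smul_disk (fun hs ht => hs.add ht)
    (fun c _ hs => hs.smul₀ c)
    (by
      intro s hs
      obtain ⟨R, hR0, hR⟩ := hs.exists_pos_norm_le
      have key : ∀ ε : ℝ, 0 < ε → ∀ z : ℂ, z ∈ ε • Metric.closedBall (0 : ℂ) R ↔ ‖z‖ ≤ ε * R := by
        intro ε hε z
        rw [smul_closedBall _ _ hR0.le, smul_zero, mem_closedBall_zero_iff, Real.norm_of_nonneg hε.le]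
      refine ⟨Metric.closedBall 0 R, fun x hx => mem_closedBall_zero_iff.2 (hR x hx),
        Metric.isBounded_closedBall, balanced_closedBall_zero, convex_closedBall 0 R, ?_, ?_⟩
      · intro x hx
        rw [← norm_le_zero_iff]
        refine le_of_forall_pos_le_add fun ε hε => ?_
        have := (key (ε / R) (by positivity) x).1 (hx _ (by positivity))
        rw [div_mul_cancel₀ _ hR0.ne'] at this
        linarith
      · intro u _ hu
        have hc : CauchySeq u := by
          refine Metric.cauchySeq_iff.2 fun ε hε => ?_
          obtain ⟨N, hN⟩ := hu (ε / R / 2) (by positivity)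
          refine ⟨N, fun m hm n hn => ?_⟩
          have := (key _ (by positivity) _).1 (hN m hm n hn)
          rw [dist_eq_norm]
          have e : ε / R / 2 * R = ε / 2 := by field_simp
          rw [e] at this
          linarith
        obtain ⟨y, hy⟩ := cauchySeq_tendsto_of_complete hc
        have hsp : ∀ z : ℂ, z ∈ Submodule.span ℂ (Metric.closedBall (0 : ℂ) R) := fun z => by
          have h1 : (R : ℂ) ∈ Submodule.span ℂ (Metric.closedBall (0 : ℂ) R) :=
            Submodule.subset_span (mem_closedBall_zero_iff.2 (by simp [abs_of_pos hR0]))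
          have h2 := Submodule.smul_mem _ (z / R) h1
          have : (R : ℂ) ≠ 0 := by exact_mod_cast hR0.ne'
          rwa [smul_eq_mul, div_mul_cancel₀ _ this] at h2
        refine ⟨y, hsp y, fun ε hε => ?_⟩
        obtain ⟨N, hN⟩ := Metric.tendsto_atTop.1 hy (ε * R) (by positivity)
        exact ⟨N, fun n hn => (key ε hε _).2 (by rw [← dist_eq_norm]; exact (hN n hn).le)⟩)

section TensorOperations

variable {V : Type u} {W : Type v} {X : Type w} {Y : Type x}
variable [AddCommGroup V] [Module ℂ V] [Bornology V]
variable [AddCommGroup W] [Module ℂ W] [Bornology W]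
variable [AddCommGroup X] [Module ℂ X] [Bornology X]
variable [AddCommGroup Y] [Module ℂ Y] [Bornology Y]

namespace IsBddBilin

theorem swap {σ : ℂ →+* ℂ} {β : V → W → X} (h : IsBddBilin σ β) :
    IsBddBilin σ fun w v => β v w where
  add_left a a' b := h.add_right b a a'
  add_right a b b' := h.add_left b b' a
  smul_left c a b := h.smul_right c b a
  smul_right c a b := h.smul_left c b a
  bdd s t hs ht := (h.bdd t s ht hs).subset (by
    rintro _ ⟨a, ha, b, hb, rfl⟩
    exact ⟨b, hb, a, ha, rfl⟩)

theorem isBdd_right {σ : ℂ →+* ℂ} {β : V → W → X} (h : IsBddBilin σ β) (v : V) : IsBdd (β v) :=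
  fun s hs => (h.bdd {v} s isBounded_singleton hs).subset (by
    rintro _ ⟨a, ha, rfl⟩
    exact ⟨v, rfl, a, ha, rfl⟩)

/-- Precomposition with bounded maps that are semilinear along `τ`. -/
theorem comp {V' : Type*} {W' : Type*} [AddCommGroup V'] [Module ℂ V'] [Bornology V']
    [AddCommGroup W'] [Module ℂ W'] [Bornology W'] {τ : ℂ →+* ℂ}
    {β : V → W → X} (h : IsBddBilin (RingHom.id ℂ) β)
    {f : V' → V} {g : W' → W} (hf : IsBdd f) (hg : IsBdd g)
    (fa : ∀ a a', f (a + a') = f a + f a') (fs : ∀ (c : ℂ) a, f (c • a) = τ c • f a)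
    (ga : ∀ a a', g (a + a') = g a + g a') (gs : ∀ (c : ℂ) a, g (c • a) = τ c • g a) :
    IsBddBilin τ fun a b => β (f a) (g b) where
  add_left a a' b := by rw [fa, h.add_left]
  add_right a b b' := by rw [ga, h.add_right]
  smul_left c a b := by rw [fs, h.smul_left, RingHom.id_apply]
  smul_right c a b := by rw [gs, h.smul_right, RingHom.id_apply]
  bdd s t hs ht := (h.bdd _ _ (hf s hs) (hg t ht)).subset (by
    rintro _ ⟨a, ha, b, hb, rfl⟩
    exact ⟨f a, ⟨a, ha, rfl⟩, g b, ⟨b, hb, rfl⟩, rfl⟩)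

theorem compLinear {V' : Type*} {W' : Type*} [AddCommGroup V'] [Module ℂ V'] [Bornology V']
    [AddCommGroup W'] [Module ℂ W'] [Bornology W']
    {β : V → W → X} (h : IsBddBilin (RingHom.id ℂ) β)
    {f : V' →ₗ[ℂ] V} {g : W' →ₗ[ℂ] W} (hf : IsBdd f) (hg : IsBdd g) :
    IsBddBilin (RingHom.id ℂ) fun a b => β (f a) (g b) :=
  h.comp hf hg (map_add f) (map_smul f) (map_add g) (map_smul g)

end IsBddBilin

theorem IsBdd.id : IsBdd (fun v : V => v) := fun s hs => by simpa using hs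

theorem isBddBilin_smul [CompleteBornSpace V] :
    IsBddBilin (RingHom.id ℂ) (fun (z : ℂ) (v : V) => z • v) where
  add_left a a' b := add_smul _ _ _
  add_right a b b' := smul_add _ _ _
  smul_left c a b := by simp [mul_smul]
  smul_right c a b := smul_comm _ _ _
  bdd s t hs ht := by
    obtain ⟨R, hR0, hR⟩ := hs.exists_pos_norm_le
    obtain ⟨D, htD, hb, hD⟩ := CompleteBornSpace.exists_disk ht
    refine (CompleteBornSpace.bounded_smul (R : ℂ) hb).subset ?_
    rintro _ ⟨z, hz, v, hv, rfl⟩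
    obtain ⟨d, hd, h⟩ := hD.smul_mem (r := 1) z (by simpa using hR z hz) zero_le_one
      (by simpa using htD hv)
    exact ⟨d, hd, (Complex.coe_smul R d).trans h⟩

namespace CTensor

/-- The tensor product `(v ⊗ w) (x ⊗ y) = ρ₁ v x ⊗ ρ₂ w y` of two bounded bilinear maps. -/
theorem isBddBilin_act_inner {V' V'' W' W'' : Type*}
    [AddCommGroup V'] [Module ℂ V'] [Bornology V'] [AddCommGroup V''] [Module ℂ V''] [Bornology V'']
    [AddCommGroup W'] [Module ℂ W'] [Bornology W'] [AddCommGroup W''] [Module ℂ W''] [Bornology W'']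
    {ρ₁ : V → V' → V''} {ρ₂ : W → W' → W''} (h₁ : IsBddBilin (RingHom.id ℂ) ρ₁)
    (h₂ : IsBddBilin (RingHom.id ℂ) ρ₂) (a : V) (b : W) :
    IsBddBilin (RingHom.id ℂ) fun v w => tmul (ρ₁ a v) (ρ₂ b w) :=
  isBddBilin_tmul.comp (h₁.isBdd_right a) (h₂.isBdd_right b) (h₁.add_right a)
    (fun c v => h₁.smul_right c a v) (h₂.add_right b) (fun c v => h₂.smul_right c b v)

section Act

variable {V' V'' W' W'' : Type*}
    [AddCommGroup V'] [Module ℂ V'] [Bornology V'] [AddCommGroup V''] [Module ℂ V''] [Bornology V'']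
    [AddCommGroup W'] [Module ℂ W'] [Bornology W'] [AddCommGroup W''] [Module ℂ W''] [Bornology W'']
    {ρ₁ : V → V' → V''} {ρ₂ : W → W' → W''} (h₁ : IsBddBilin (RingHom.id ℂ) ρ₁)
    (h₂ : IsBddBilin (RingHom.id ℂ) ρ₂)

theorem lift_act_bdd {A : Set V} {B : Set W} (hA : IsBounded A) (hB : IsBounded B)
    {T : Set (CTensor V' W')} (hT : IsBounded T) :
    ∃ D, IsBounded D ∧ ∀ a ∈ A, ∀ b ∈ B, ∀ t ∈ T, lift (isBddBilin_act_inner h₁ h₂ a b) t ∈ D := by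
  obtain ⟨A', B', r, hA', hB', h⟩ := isBounded_iff.1 hT
  obtain ⟨D, hD, h'⟩ := lift_bdd_uniform (RingHom.id ℂ) A' B' r
    (isBddBilin_tmul.bdd _ _ (h₁.bdd A A' hA hA') (h₂.bdd B B' hB hB'))
  exact ⟨D, hD, fun a ha b hb t ht => h' _ (isBddBilin_act_inner h₁ h₂ a b)
    (fun v hv w hw => mem_image2_of_mem (mem_image2_of_mem ha hv) (mem_image2_of_mem hb hw)) t
    (h ht)⟩

theorem isBddBilin_act_outer (t : CTensor V' W') :
    IsBddBilin (RingHom.id ℂ) fun a b => lift (isBddBilin_act_inner h₁ h₂ a b) t where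
  add_left a a' b := lift_add _ _ _ (fun v w => by rw [h₁.add_left, isBddBilin_tmul.add_left]) t
  add_right a b b' := lift_add _ _ _ (fun v w => by rw [h₂.add_left, isBddBilin_tmul.add_right]) t
  smul_left c a b := lift_smul c _ _ (fun v w => by
    rw [h₁.smul_left, isBddBilin_tmul.smul_left]; rfl) t
  smul_right c a b := lift_smul c _ _ (fun v w => by
    rw [h₂.smul_left, isBddBilin_tmul.smul_right]; rfl) t
  bdd s s' hs hs' := by
    obtain ⟨D, hD, h⟩ := lift_act_bdd h₁ h₂ hs hs' (isBounded_singleton (x := t))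
    refine hD.subset ?_
    rintro _ ⟨a, ha, b, hb, rfl⟩
    exact h a ha b hb t rfl

/-- The tensor product `(v ⊗ w) (x ⊗ y) = ρ₁ v x ⊗ ρ₂ w y` of two bounded bilinear maps. -/
noncomputable def act (t : CTensor V W) (t' : CTensor V' W') : CTensor V'' W'' :=
  lift (isBddBilin_act_outer h₁ h₂ t') t

theorem act_tmul (v : V) (w : W) (v' : V') (w' : W') :
    act h₁ h₂ (tmul v w) (tmul v' w') = tmul (ρ₁ v v') (ρ₂ w w') := by
  rw [act, lift_tmul, lift_tmul]

theorem isBddBilin_act : IsBddBilin (RingHom.id ℂ) (act h₁ h₂) where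
  add_left a a' b := map_add _ _ _
  add_right a b b' := lift_add _ _ _ (fun v w => map_add _ _ _) a
  smul_left c a b := map_smul _ _ _
  smul_right c a b := lift_smul c _ _ (fun v w => map_smul _ _ _) a
  bdd s t hs ht := by
    obtain ⟨A, B, r, hA, hB, h⟩ := isBounded_iff.1 hs
    obtain ⟨D, hD, h'⟩ := lift_act_bdd h₁ h₂ hA hB ht
    obtain ⟨D', hD', h''⟩ := lift_bdd_uniform (RingHom.id ℂ) A B r hD
    refine hD'.subset ?_
    rintro _ ⟨x, hx, y, hy, rfl⟩
    exact h'' _ (isBddBilin_act_outer h₁ h₂ y) (fun a ha b hb => h' a ha b hb y hy) x (h hx)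

end Act

/-- The tensor product `f ⊗ g` of bounded linear maps. -/
noncomputable def map {f : V →ₗ[ℂ] X} {g : W →ₗ[ℂ] Y} (hf : IsBdd f) (hg : IsBdd g) :
    CTensor V W →ₗ[ℂ] CTensor X Y :=
  lift (isBddBilin_tmul.compLinear hf hg)

theorem isBddBilin_assoc_inner (x : X) :
    IsBddBilin (RingHom.id ℂ) fun (v : V) (w : W) => tmul v (tmul w x) :=
  isBddBilin_tmul.comp IsBdd.id (isBddBilin_tmul.swap.isBdd_right x) (fun _ _ => rfl)
    (fun _ _ => rfl) (fun a a' => isBddBilin_tmul.add_left a a' x)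
    (fun c a => isBddBilin_tmul.smul_left c a x)

theorem isBddBilin_assoc : IsBddBilin (RingHom.id ℂ)
    fun (t : CTensor V W) (x : X) => lift (isBddBilin_assoc_inner x) t where
  add_left a a' b := map_add _ _ _
  add_right a b b' := lift_add _ _ _ (fun v w => by
    rw [isBddBilin_tmul.add_right, isBddBilin_tmul.add_right]) a
  smul_left c a b := map_smul _ _ _
  smul_right c a b := lift_smul c _ _ (fun v w => by
    rw [isBddBilin_tmul.smul_right, isBddBilin_tmul.smul_right]; rfl) a
  bdd s t hs ht := by
    obtain ⟨A, B, r, hA, hB, h⟩ := isBounded_iff.1 hs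
    obtain ⟨D, hD, h'⟩ := lift_bdd_uniform (RingHom.id ℂ) A B r
      (isBddBilin_tmul.bdd A _ hA (isBddBilin_tmul.bdd B t hB ht))
    refine hD.subset ?_
    rintro _ ⟨x, hx, y, hy, rfl⟩
    exact h' _ (isBddBilin_assoc_inner y)
      (fun a ha b hb => mem_image2_of_mem ha (mem_image2_of_mem hb hy)) x (h hx)

variable (V W X) in
/-- The associativity map `(v ⊗ w) ⊗ x ↦ v ⊗ (w ⊗ x)`. -/
noncomputable def assoc : CTensor (CTensor V W) X →ₗ[ℂ] CTensor V (CTensor W X) :=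
  lift isBddBilin_assoc

theorem isBddBilin_slice₁ [CompleteBornSpace W] {ω : V →ₗ[ℂ] ℂ} (hω : IsBdd ω) :
    IsBddBilin (RingHom.id ℂ) fun (v : V) (w : W) => ω v • w :=
  isBddBilin_smul.compLinear (g := LinearMap.id) hω IsBdd.id

/-- The slice map `ω ⊗ ι : v ⊗ w ↦ ω v • w`. -/
noncomputable def slice₁ [CompleteBornSpace W] {ω : V →ₗ[ℂ] ℂ} (hω : IsBdd ω) :
    CTensor V W →ₗ[ℂ] W :=
  lift (isBddBilin_slice₁ hω)

theorem isBddBilin_slice₂ [CompleteBornSpace V] {ω : W →ₗ[ℂ] ℂ} (hω : IsBdd ω) :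
    IsBddBilin (RingHom.id ℂ) fun (v : V) (w : W) => ω w • v :=
  (isBddBilin_smul.compLinear (g := LinearMap.id) hω IsBdd.id).swap

/-- The slice map `ι ⊗ ω : v ⊗ w ↦ ω w • v`. -/
noncomputable def slice₂ [CompleteBornSpace V] {ω : W →ₗ[ℂ] ℂ} (hω : IsBdd ω) :
    CTensor V W →ₗ[ℂ] V :=
  lift (isBddBilin_slice₂ hω)

end CTensor

end TensorOperations

section Algebras

variable {V : Type u} {W : Type v}
variable [AddCommGroup V] [Module ℂ V] [Bornology V]
variable [AddCommGroup W] [Module ℂ W] [Bornology W]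

/-- A bounded bilinear action `ρ` is essential if every bounded set is the image of a bounded set
of the completed tensor product. -/
def IsEssentialAction [CompleteBornSpace W] {ρ : V → W → W} (hρ : IsBddBilin (RingHom.id ℂ) ρ) :
    Prop :=
  ∀ T : Set W, IsBounded T → ∃ S : Set (CTensor V W), IsBounded S ∧ CTensor.lift hρ '' S = T

theorem IsBdd.add [CompleteBornSpace W] {f g : V → W} (hf : IsBdd f) (hg : IsBdd g) :
    IsBdd fun v => f v + g v := fun s hs =>
  (CompleteBornSpace.bounded_add (hf s hs) (hg s hs)).subset (by
    rintro _ ⟨a, ha, rfl⟩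
    exact Set.add_mem_add ⟨a, ha, rfl⟩ ⟨a, ha, rfl⟩)

theorem IsBdd.smul [CompleteBornSpace W] {f : V → W} (c : ℂ) (hf : IsBdd f) :
    IsBdd fun v => c • f v := fun s hs =>
  (CompleteBornSpace.bounded_smul c (hf s hs)).subset (by
    rintro _ ⟨a, ha, rfl⟩
    exact Set.smul_mem_smul_set ⟨a, ha, rfl⟩)

/-- The multipliers `c = (c ·, · c)` of an algebra with product `mul`: `c.1` is the left
multiplication `a ↦ c a` and `c.2` is the right multiplication `a ↦ a c`. -/
def multipliers [CompleteBornSpace V] {mul : V → V → V} (h : IsBddBilin (RingHom.id ℂ) mul) :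
    Submodule ℂ ((V →ₗ[ℂ] V) × (V →ₗ[ℂ] V)) where
  carrier := {c | IsBdd c.1 ∧ IsBdd c.2 ∧ (∀ a b, c.1 (mul a b) = mul (c.1 a) b) ∧
    (∀ a b, c.2 (mul a b) = mul a (c.2 b)) ∧ ∀ a b, mul (c.2 a) b = mul a (c.1 b)}
  zero_mem' := by
    have h0 : IsBdd (fun _ : V => (0 : V)) := fun s _ =>
      (isBounded_singleton (x := (0 : V))).subset (by rintro _ ⟨_, _, rfl⟩; rfl)
    have hl : ∀ b, mul 0 b = 0 := fun b => by simpa using h.smul_left 0 0 b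
    have hr : ∀ a, mul a 0 = 0 := fun a => by simpa using h.smul_right 0 a 0
    exact ⟨h0, h0, fun a b => (hl b).symm, fun a b => (hr a).symm, fun a b => by simp [hl, hr]⟩
  add_mem' := by
    rintro c d ⟨c1, c2, c3, c4, c5⟩ ⟨d1, d2, d3, d4, d5⟩
    refine ⟨c1.add d1, c2.add d2, fun a b => ?_, fun a b => ?_, fun a b => ?_⟩
    · simp [c3, d3, h.add_left]
    · simp [c4, d4, h.add_right]
    · simp [c5, d5, h.add_left, h.add_right]
  smul_mem' := by
    rintro z c ⟨c1, c2, c3, c4, c5⟩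
    refine ⟨c1.smul z, c2.smul z, fun a b => ?_, fun a b => ?_, fun a b => ?_⟩
    · simp [c3, h.smul_left]
    · simp [c4, h.smul_right]
    · simp [c5, h.smul_left, h.smul_right]

/-- Bounded essential homomorphisms from an algebra into the multipliers of another one. -/
structure IsEssentialHom [CompleteBornSpace W] (mulV : V → V → V) {mulW : W → W → W}
    {hW : IsBddBilin (RingHom.id ℂ) mulW} (f : V →ₗ[ℂ] multipliers hW) : Prop where
  map_mul_left : ∀ a b t, (f (mulV a b)).1.1 t = (f a).1.1 ((f b).1.1 t)
  map_mul_right : ∀ a b t, (f (mulV a b)).1.2 t = (f b).1.2 ((f a).1.2 t)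
  bdd_left : IsBddBilin (RingHom.id ℂ) fun a t => (f a).1.1 t
  bdd_right : IsBddBilin (RingHom.id ℂ) fun a t => (f a).1.2 t
  essential_left : IsEssentialAction bdd_left
  essential_right : IsEssentialAction bdd_right

/-- Essential bornological `*`-algebras. -/
structure BornStarAlgebra (V : Type u) [AddCommGroup V] [Module ℂ V] [Bornology V]
    [CompleteBornSpace V] where
  mul : V → V → V
  bdd_mul : IsBddBilin (RingHom.id ℂ) mul
  mul_assoc : ∀ a b c, mul (mul a b) c = mul a (mul b c)
  essential : IsEssentialAction bdd_mul
  star : V → V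
  star_add : ∀ a b, star (a + b) = star a + star b
  star_smul : ∀ (z : ℂ) a, star (z • a) = (starRingEnd ℂ) z • star a
  star_star : ∀ a, star (star a) = a
  star_mul : ∀ a b, star (mul a b) = mul (star b) (star a)
  star_bdd : IsBdd star

namespace BornStarAlgebra

variable [CompleteBornSpace V] (𝒜 : BornStarAlgebra V)

/-- Left multiplication `b ↦ a b`. -/
def mulLeft (a : V) : V →ₗ[ℂ] V where
  toFun := 𝒜.mul a
  map_add' := 𝒜.bdd_mul.add_right a
  map_smul' c b := 𝒜.bdd_mul.smul_right c a b

/-- Right multiplication `b ↦ b a`. -/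
def mulRight (a : V) : V →ₗ[ℂ] V where
  toFun b := 𝒜.mul b a
  map_add' b b' := 𝒜.bdd_mul.add_left b b' a
  map_smul' c b := 𝒜.bdd_mul.smul_left c b a

theorem bdd_mulLeft (a : V) : IsBdd (𝒜.mulLeft a) := 𝒜.bdd_mul.isBdd_right a

theorem bdd_mulRight (a : V) : IsBdd (𝒜.mulRight a) := 𝒜.bdd_mul.swap.isBdd_right a

/-- The product `(a ⊗ b) (c ⊗ d) = a c ⊗ b d` of `A ⊗̂ A`. -/
noncomputable def mulT : CTensor V V → CTensor V V → CTensor V V :=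
  CTensor.act 𝒜.bdd_mul 𝒜.bdd_mul

theorem bdd_mulT : IsBddBilin (RingHom.id ℂ) 𝒜.mulT := CTensor.isBddBilin_act _ _

/-- The product `(a ⊗ t) (c ⊗ u) = a c ⊗ t u` of `A ⊗̂ (A ⊗̂ A)`. -/
noncomputable def mulT₃ :
    CTensor V (CTensor V V) → CTensor V (CTensor V V) → CTensor V (CTensor V V) :=
  CTensor.act 𝒜.bdd_mul 𝒜.bdd_mulT

theorem bdd_mulT₃ : IsBddBilin (RingHom.id ℂ) 𝒜.mulT₃ := CTensor.isBddBilin_act _ _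

theorem bdd_starTensor : IsBddBilin (starRingEnd ℂ)
    fun a b => (CTensor.tmul (𝒜.star a) (𝒜.star b) : CTensor V V) :=
  CTensor.isBddBilin_tmul.comp 𝒜.star_bdd 𝒜.star_bdd 𝒜.star_add 𝒜.star_smul 𝒜.star_add 𝒜.star_smul

/-- The involution `a ⊗ b ↦ a̅ ⊗ b̅` of `A ⊗̂ A`. -/
noncomputable def starT : CTensor V V →ₛₗ[starRingEnd ℂ] CTensor V V :=
  CTensor.lift 𝒜.bdd_starTensor

/-- The antilinear map `a ⊗ b ↦ b̅ ⊗ a̅` of `A ⊗̂ A`. -/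
noncomputable def flipStarT : CTensor V V →ₛₗ[starRingEnd ℂ] CTensor V V :=
  CTensor.lift 𝒜.bdd_starTensor.swap

/-- Left multiplication by `a ⊗ 1` on `A ⊗̂ A`. -/
noncomputable def left₁ (a : V) : CTensor V V →ₗ[ℂ] CTensor V V :=
  CTensor.map (g := LinearMap.id) (𝒜.bdd_mulLeft a) IsBdd.id

/-- Left multiplication by `1 ⊗ a` on `A ⊗̂ A`. -/
noncomputable def left₂ (a : V) : CTensor V V →ₗ[ℂ] CTensor V V :=
  CTensor.map (f := LinearMap.id) IsBdd.id (𝒜.bdd_mulLeft a)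

/-- Right multiplication by `a ⊗ 1` on `A ⊗̂ A`. -/
noncomputable def right₁ (a : V) : CTensor V V →ₗ[ℂ] CTensor V V :=
  CTensor.map (g := LinearMap.id) (𝒜.bdd_mulRight a) IsBdd.id

/-- Right multiplication by `1 ⊗ a` on `A ⊗̂ A`. -/
noncomputable def right₂ (a : V) : CTensor V V →ₗ[ℂ] CTensor V V :=
  CTensor.map (f := LinearMap.id) IsBdd.id (𝒜.bdd_mulRight a)

end BornStarAlgebra

/-- Coproducts `Δ : A → M(A ⊗̂ A)`: coassociative essential bounded `*`-homomorphisms whose Galois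
maps take values in `A ⊗̂ A`. -/
structure Coproduct [CompleteBornSpace V] (𝒜 : BornStarAlgebra V) where
  Δ : V →ₗ[ℂ] multipliers 𝒜.bdd_mulT
  hom : IsEssentialHom 𝒜.mul Δ
  star_left : ∀ a t, (Δ (𝒜.star a)).1.1 t = 𝒜.starT ((Δ a).1.2 (𝒜.starT t))
  star_right : ∀ a t, (Δ (𝒜.star a)).1.2 t = 𝒜.starT ((Δ a).1.1 (𝒜.starT t))
  /-- For each `a` there is a multiplier `m` of `A ⊗̂ A ⊗̂ A` that is both the value at `Δ a` of the
  extension of `ι ⊗ Δ` to multipliers and the value at `Δ a` of the extension of `Δ ⊗ ι`.  The value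
  of the extension of an essential homomorphism `f` at a multiplier `c` is the multiplier `m` with
  `m (f(t) z) = f(c t) z` and `(z f(t)) m = z f(t c)`. -/
  coassoc : ∀ a, ∃ m : multipliers 𝒜.bdd_mulT₃,
    (∀ t z, m.1.1 (CTensor.act 𝒜.bdd_mul hom.bdd_left t z) =
      CTensor.act 𝒜.bdd_mul hom.bdd_left ((Δ a).1.1 t) z) ∧
    (∀ t z, m.1.2 (CTensor.act 𝒜.bdd_mul.swap hom.bdd_right t z) =
      CTensor.act 𝒜.bdd_mul.swap hom.bdd_right ((Δ a).1.2 t) z) ∧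
    (∀ t z, m.1.1 (CTensor.assoc V V V (CTensor.act hom.bdd_left 𝒜.bdd_mul t z)) =
      CTensor.assoc V V V (CTensor.act hom.bdd_left 𝒜.bdd_mul ((Δ a).1.1 t) z)) ∧
    (∀ t z, m.1.2 (CTensor.assoc V V V (CTensor.act hom.bdd_right 𝒜.bdd_mul.swap t z)) =
      CTensor.assoc V V V (CTensor.act hom.bdd_right 𝒜.bdd_mul.swap ((Δ a).1.2 t) z))
  /-- The Galois map `a ⊗ b ↦ Δ(a) (b ⊗ 1)`. -/
  γl : CTensor V V →ₗ[ℂ] CTensor V V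
  γl_bdd : IsBdd γl
  γl_left : ∀ a b t, 𝒜.mulT (γl (CTensor.tmul a b)) t = (Δ a).1.1 (𝒜.left₁ b t)
  γl_right : ∀ a b t, 𝒜.mulT t (γl (CTensor.tmul a b)) = 𝒜.right₁ b ((Δ a).1.2 t)
  /-- The Galois map `a ⊗ b ↦ (1 ⊗ a) Δ(b)`. -/
  ρr : CTensor V V →ₗ[ℂ] CTensor V V
  ρr_bdd : IsBdd ρr
  ρr_left : ∀ a b t, 𝒜.mulT (ρr (CTensor.tmul a b)) t = 𝒜.left₂ a ((Δ b).1.1 t)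
  ρr_right : ∀ a b t, 𝒜.mulT t (ρr (CTensor.tmul a b)) = (Δ b).1.2 (𝒜.right₂ a t)

namespace Coproduct

variable [CompleteBornSpace V] {𝒜 : BornStarAlgebra V} (Γ : Coproduct 𝒜)

/-- The Galois map `a ⊗ b ↦ Δ(a) (1 ⊗ b)`, which is the adjoint of `(1 ⊗ b̅) Δ(a̅)`. -/
noncomputable def γr (t : CTensor V V) : CTensor V V := 𝒜.starT (Γ.ρr (𝒜.flipStarT t))

/-- The Galois map `a ⊗ b ↦ (a ⊗ 1) Δ(b)`, which is the adjoint of `Δ(b̅) (a̅ ⊗ 1)`. -/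
noncomputable def ρl (t : CTensor V V) : CTensor V V := 𝒜.starT (Γ.γl (𝒜.flipStarT t))

/-- The multiplier `(ω ⊗ ι)(Δ(a))`, as the pair of the left multiplication
`b ↦ (ω ⊗ ι)(Δ(a) (1 ⊗ b))` and the right multiplication `b ↦ (ω ⊗ ι)((1 ⊗ b) Δ(a))`. -/
noncomputable def sliceMul₁ {ω : V →ₗ[ℂ] ℂ} (hω : IsBdd ω) (a : V) : (V → V) × (V → V) :=
  (fun b => CTensor.slice₁ hω (Γ.γr (CTensor.tmul a b)),
    fun b => CTensor.slice₁ hω (Γ.ρr (CTensor.tmul b a)))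

/-- The multiplier `(ι ⊗ ω)(Δ(a))`, as the pair of the left multiplication
`b ↦ (ι ⊗ ω)(Δ(a) (b ⊗ 1))` and the right multiplication `b ↦ (ι ⊗ ω)((b ⊗ 1) Δ(a))`. -/
noncomputable def sliceMul₂ {ω : V →ₗ[ℂ] ℂ} (hω : IsBdd ω) (a : V) : (V → V) × (V → V) :=
  (fun b => CTensor.slice₂ hω (Γ.γl (CTensor.tmul a b)),
    fun b => CTensor.slice₂ hω (Γ.ρl (CTensor.tmul b a)))

end Coproduct

/-- Bornological quantum groups (with involution): a bornological `*`-algebra with a coproduct, a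
positive faithful left-invariant integral `φ`, a counit `ε` and an antipode `S`. -/
structure BornQuantumGroup (V : Type u) [AddCommGroup V] [Module ℂ V] [Bornology V]
    [CompleteBornSpace V] extends BornStarAlgebra V where
  approximation : HasApproximationProperty V
  Γ : Coproduct toBornStarAlgebra
  /-- The left-invariant integral. -/
  φ : V →ₗ[ℂ] ℂ
  φ_bdd : IsBdd φ
  φ_pos : ∀ a, 0 ≤ (φ (mul (star a) a)).re ∧ (φ (mul (star a) a)).im = 0
  φ_faithful : ∀ a, φ (mul (star a) a) = 0 → a = 0
  φ_invariant : ∀ a, Γ.sliceMul₂ φ_bdd a = (fun b => φ a • b, fun b => φ a • b)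
  /-- The counit. -/
  ε : V →ₗ[ℂ] ℂ
  ε_bdd : IsBdd ε
  ε_mul : ∀ a b, ε (mul a b) = ε a * ε b
  ε_essential : IsEssentialAction
    (isBddBilin_smul.compLinear (V' := V) (g := (LinearMap.id : ℂ →ₗ[ℂ] ℂ)) ε_bdd IsBdd.id)
  counit_left : ∀ a, Γ.sliceMul₁ ε_bdd a = (mul a, fun b => mul b a)
  counit_right : ∀ a, Γ.sliceMul₂ ε_bdd a = (mul a, fun b => mul b a)
  /-- The antipode. -/
  S : V ≃ₗ[ℂ] V
  S_bdd : IsBdd S.toLinearMap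
  S_symm_bdd : IsBdd S.symm.toLinearMap
  S_mul : ∀ a b, S (mul a b) = mul (S b) (S a)
  /-- `Δ (S a)` is the image of `Δ a` under the extension to multipliers of the antiautomorphism
  `a ⊗ b ↦ S b ⊗ S a`. -/
  S_comul_left : ∀ a t,
    (Γ.Δ (S a)).1.1 (CTensor.lift (CTensor.isBddBilin_tmul.compLinear S_bdd S_bdd).swap t) =
      CTensor.lift (CTensor.isBddBilin_tmul.compLinear S_bdd S_bdd).swap ((Γ.Δ a).1.2 t)
  S_comul_right : ∀ a t,
    (Γ.Δ (S a)).1.2 (CTensor.lift (CTensor.isBddBilin_tmul.compLinear S_bdd S_bdd).swap t) =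
      CTensor.lift (CTensor.isBddBilin_tmul.compLinear S_bdd S_bdd).swap ((Γ.Δ a).1.1 t)
  /-- `m (S ⊗ ι)(Δ(a) (1 ⊗ b)) = ε(a) b`. -/
  antipode_left : ∀ a b,
    CTensor.lift (bdd_mul.compLinear (g := LinearMap.id) S_bdd IsBdd.id)
      (Γ.γr (CTensor.tmul a b)) = ε a • b
  /-- `m (ι ⊗ S)((a ⊗ 1) Δ(b)) = ε(b) a`. -/
  antipode_right : ∀ a b,
    CTensor.lift (bdd_mul.compLinear (f := LinearMap.id) IsBdd.id S_bdd)
      (Γ.ρl (CTensor.tmul a b)) = ε b • a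

namespace BornQuantumGroup

variable [CompleteBornSpace V] (𝔾 : BornQuantumGroup V)

/-- The functional `b ↦ φ(b a)` attached to `a`. -/
noncomputable def fourierMap : V →ₗ[ℂ] (V →ₗ[ℂ] ℂ) where
  toFun a := 𝔾.φ ∘ₗ 𝔾.mulRight a
  map_add' a a' := LinearMap.ext fun b => by
    change 𝔾.φ (𝔾.mul b (a + a')) = 𝔾.φ (𝔾.mul b a) + 𝔾.φ (𝔾.mul b a')
    rw [𝔾.bdd_mul.add_right, map_add]
  map_smul' c a := LinearMap.ext fun b => by
    change 𝔾.φ (𝔾.mul b (c • a)) = c • 𝔾.φ (𝔾.mul b a)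
    rw [𝔾.bdd_mul.smul_right, map_smul]; rfl

theorem fourierMap_injective : Function.Injective 𝔾.fourierMap := by
  rw [injective_iff_map_eq_zero]
  intro a ha
  exact 𝔾.φ_faithful a (LinearMap.congr_fun ha (𝔾.star a))

/-- The Pontryagin dual `Â = {b ↦ φ(b a) | a ∈ A}`, a space of linear functionals on `A`. -/
def Dual : Type u := LinearMap.range 𝔾.fourierMap

noncomputable instance : AddCommGroup 𝔾.Dual :=
  inferInstanceAs (AddCommGroup (LinearMap.range 𝔾.fourierMap))

noncomputable instance : Module ℂ 𝔾.Dual :=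
  inferInstanceAs (Module ℂ (LinearMap.range 𝔾.fourierMap))

/-- The value of an element of the dual, as a functional. -/
noncomputable def ev (x : 𝔾.Dual) (a : V) : ℂ := x.1 a

/-- The Fourier map `𝔉 : A ≃ Â`, `𝔉(a) = (b ↦ φ(b a))`. -/
noncomputable def fourier : V ≃ₗ[ℂ] 𝔾.Dual :=
  LinearEquiv.ofInjective 𝔾.fourierMap 𝔾.fourierMap_injective

theorem ev_fourier (a b : V) : 𝔾.ev (𝔾.fourier a) b = 𝔾.φ (𝔾.mul b a) := rfl

/-- The bornology carried over by the bijection `𝔉`. -/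
noncomputable instance : Bornology 𝔾.Dual := Bornology.induced 𝔾.fourier.symm

theorem isBounded_dual {s : Set 𝔾.Dual} : IsBounded s ↔ IsBounded (𝔾.fourier.symm '' s) :=
  (Bornology.isBounded_induced (f := 𝔾.fourier.symm) (s := s))

instance : CompleteBornSpace 𝔾.Dual :=
  CompleteBornSpace.of_add_smul_disk
    (by
      intro s t hs ht
      rw [isBounded_dual] at *
      rw [Set.image_add]
      exact CompleteBornSpace.bounded_add hs ht)
    (by
      intro c s hs
      rw [isBounded_dual] at *
      rw [Set.image_smul_comm _ _ _ (map_smul _ c)]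
      exact CompleteBornSpace.bounded_smul c hs)
    (by
      intro s hs
      obtain ⟨D, h, hb, hD⟩ := CompleteBornSpace.exists_disk (𝔾.isBounded_dual.1 hs)
      refine ⟨𝔾.fourier '' D, fun x hx => ⟨_, h ⟨x, hx, rfl⟩, by simp⟩, ?_, hD.image _⟩
      rw [isBounded_dual, ← Set.image_comp]
      simpa [Function.comp_def] using hb)

theorem bdd_ev (a b : V) : IsBddBilin (RingHom.id ℂ) fun x y => 𝔾.ev x a * 𝔾.ev y b where
  add_left x x' y := add_mul _ _ _
  add_right x y y' := mul_add _ _ _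
  smul_left c x y := mul_assoc _ _ _
  smul_right c x y := mul_left_comm _ _ _
  bdd s t hs ht := by
    have h : ∀ (a : V) {s : Set 𝔾.Dual}, IsBounded s → IsBounded ((fun x => 𝔾.ev x a) '' s) := by
      intro a s hs
      refine (𝔾.φ_bdd _ (𝔾.bdd_mulLeft a _ (𝔾.isBounded_dual.1 hs))).subset ?_
      rintro _ ⟨x, hx, rfl⟩
      refine ⟨_, ⟨_, ⟨x, hx, rfl⟩, rfl⟩, ?_⟩
      change 𝔾.φ (𝔾.mul a (𝔾.fourier.symm x)) = _
      rw [← ev_fourier, LinearEquiv.apply_symm_apply]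
    refine ((isBddBilin_smul (V := ℂ)).bdd _ _ (h a hs) (h b ht)).subset ?_
    rintro _ ⟨x, hx, y, hy, rfl⟩
    exact ⟨_, ⟨x, hx, rfl⟩, _, ⟨y, hy, rfl⟩, rfl⟩

/-- The pairing of `Â ⊗̂ Â` with `a ⊗ b`. -/
noncomputable def evT (a b : V) : CTensor 𝔾.Dual 𝔾.Dual →ₗ[ℂ] ℂ := CTensor.lift (𝔾.bdd_ev a b)

theorem bdd_φφ : IsBddBilin (RingHom.id ℂ) fun a b => 𝔾.φ a * 𝔾.φ b :=
  isBddBilin_smul.compLinear 𝔾.φ_bdd 𝔾.φ_bdd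

/-- The pairing `(x ⊗ y, m)` for `x, y ∈ Â` and a multiplier `m` of `A ⊗̂ A`: if `x = 𝔉(f)` and
`y = 𝔉(g)`, then `x ⊗ y` is the functional `t ↦ (φ ⊗ φ)(t (f ⊗ g))`. -/
noncomputable def pairMultiplier (x y : 𝔾.Dual) (m : multipliers 𝔾.bdd_mulT) : ℂ :=
  CTensor.lift 𝔾.bdd_φφ (m.1.1 (CTensor.tmul (𝔾.fourier.symm x) (𝔾.fourier.symm y)))

/-- `(ι ⊗ x)(Δ(a)) ∈ A`: if `x = 𝔉(f)`, this is `(ι ⊗ φ)(Δ(a) (1 ⊗ f))`. -/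
noncomputable def dualLeft (x : 𝔾.Dual) (a : V) : V :=
  CTensor.slice₂ 𝔾.φ_bdd (𝔾.Γ.γr (CTensor.tmul a (𝔾.fourier.symm x)))

/-- `(x ⊗ ι)(Δ(a)) ∈ A`: if `x = 𝔉(f)`, this is `(φ ⊗ ι)(Δ(a) (f ⊗ 1))`. -/
noncomputable def dualRight (x : 𝔾.Dual) (a : V) : V :=
  CTensor.slice₁ 𝔾.φ_bdd (𝔾.Γ.γl (CTensor.tmul a (𝔾.fourier.symm x)))

/-- The pairing `(M, a ⊗ b) = B a b` for a multiplier `M` of `Â ⊗̂ Â`.  Since the product of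
`Â ⊗̂ Â` is dual to the coproduct of `A ⊗̂ A`, this means that
`(M (z ⊗ w), a ⊗ b) = B ((ι ⊗ z)Δ(a)) ((ι ⊗ w)Δ(b))` and
`((z ⊗ w) M, a ⊗ b) = B ((z ⊗ ι)Δ(a)) ((w ⊗ ι)Δ(b))` for all `z` and `w` in `Â`. -/
def PairsAs (M : (CTensor 𝔾.Dual 𝔾.Dual →ₗ[ℂ] CTensor 𝔾.Dual 𝔾.Dual) ×
    (CTensor 𝔾.Dual 𝔾.Dual →ₗ[ℂ] CTensor 𝔾.Dual 𝔾.Dual)) (B : V → V → ℂ) : Prop :=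
  ∀ z w a b,
    𝔾.evT a b (M.1 (CTensor.tmul z w)) = B (𝔾.dualLeft z a) (𝔾.dualLeft w b) ∧
    𝔾.evT a b (M.2 (CTensor.tmul z w)) = B (𝔾.dualRight z a) (𝔾.dualRight w b)

/-- The modular element: the multiplier `δ` with `(φ ⊗ ι)(Δ(a)) = φ(a) δ`. -/
def IsModularElement (δ : multipliers 𝔾.bdd_mul) : Prop :=
  ∀ a, 𝔾.Γ.sliceMul₁ 𝔾.φ_bdd a = (fun b => 𝔾.φ a • δ.1.1 b, fun b => 𝔾.φ a • δ.1.2 b)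

/-- The convolution product `f * g = (ι ⊗ φ)((1 ⊗ S⁻¹(g)) Δ(f))`. -/
noncomputable def conv (f g : V) : V :=
  CTensor.slice₂ 𝔾.φ_bdd (𝔾.Γ.ρr (CTensor.tmul (𝔾.S.symm g) f))

/-- The convolution adjoint: `f` is sent to the complex conjugate of `S(f)`, multiplied by `δ` from
the right. -/
def convStar (δ : multipliers 𝔾.bdd_mul) (f : V) : V := δ.1.2 (𝔾.star (𝔾.S f))

end BornQuantumGroup

end Algebras

/-! Everything is governed by the Galois map γ(a ⊗ b) = Δ(a)(b ⊗ 1). The antipode axioms make it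
invertible (`γl_γlInv`, `γlInv_γl`), with inverse a ⊗ b ↦ b₂ ⊗ S⁻¹(b₁)a, and 𝔉 ⊗ 𝔉 carries this
inverse to the Galois map x ⊗ z ↦ Δ̂(x)(z ⊗ 1) of the dual. Much of the dual structure is thus read
off from γ⁻¹: the product is (ι ⊗ φ)γ⁻¹, it has a bounded section built from γ and an element u with
φ(u) = 1, and left invariance of ε ∘ 𝔉⁻¹ is the identity (ε ⊗ ι)γ = ι ⊗ ε.

That the transposed operations stay inside the space of functionals φ(· a) rests on strong left
invariance (`slice₂_φ_ρr`), a consequence of left invariance and surjectivity of γ. It gives the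
convolution formula for the product. Together with right invariance of φ ∘ S it shows that (φ ⊗
ι)Δ(a) depends on a only through φ(a), hence the modular element δ, and then φ(aδ) = φ(S(a)) places
the involution in the dual. Used on both sides, it yields the operator `transS` that transposes S
with respect to φ, hence the dual antipode.

Two principles replace calculations with units and Sweedler sums. Bounded real-linear maps on a
completed tensor product are determined by elementary tensors (`ext_tmul`), and by the approximation
property its elements are determined by slices (`eq_zero_of_slice₂`). So elements of Â ⊗̂ Â may be
compared through their pairings with a ⊗ b. Under this pairing the axioms are transposed:
associativity of the dual is coassociativity of A, in the form that left and right slices commute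
(`dualRight_dualLeft`); coassociativity of the dual is associativity of A; multiplicativity of Δ̂ is
that of Δ (`dualLeftProd_dualγ`). Positivity of the dual integral is the Plancherel formula
`ε_conv_convStar`. -/

section

/-! ### Bounded real-linear maps -/

section RealBounded

variable {V : Type u} {W : Type v} {X : Type w}
variable [AddCommGroup V] [Module ℂ V] [Bornology V]
variable [AddCommGroup W] [Module ℂ W] [Bornology W]
variable [AddCommGroup X] [Module ℂ X] [Bornology X]

/-- Bounded real-linear maps.  This covers both linear and antilinear bounded maps. -/
@[fun_prop]
structure IsRealBdd (f : V → W) : Prop where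
  map_add : ∀ a b, f (a + b) = f a + f b
  map_real : ∀ (r : ℝ) a, f ((r : ℂ) • a) = (r : ℂ) • f a
  bdd : IsBdd f

theorem IsBdd.comp {f : W → X} {g : V → W} (hf : IsBdd f) (hg : IsBdd g) :
    IsBdd fun v => f (g v) := fun s hs => by
  have := hf _ (hg s hs)
  rwa [← image_comp] at this

namespace IsRealBdd

@[fun_prop]
theorem id' : IsRealBdd fun v : V => v := ⟨fun _ _ => rfl, fun _ _ => rfl, IsBdd.id⟩

@[fun_prop]
theorem comp {f : W → X} {g : V → W} (hf : IsRealBdd f) (hg : IsRealBdd g) :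
    IsRealBdd fun v => f (g v) :=
  ⟨fun a b => by rw [hg.map_add, hf.map_add], fun r a => by rw [hg.map_real, hf.map_real],
    hf.bdd.comp hg.bdd⟩

theorem of_linear (f : V →ₗ[ℂ] W) (hf : IsBdd f) : IsRealBdd fun v => f v :=
  ⟨f.map_add, fun r => f.map_smul r, hf⟩

theorem of_antilinear (f : V →ₛₗ[starRingEnd ℂ] W) (hf : IsBdd f) : IsRealBdd fun v => f v :=
  ⟨f.map_add, fun r a => by rw [LinearMap.map_smulₛₗ, Complex.conj_ofReal], hf⟩

@[fun_prop]
theorem smul [CompleteBornSpace W] (c : ℂ) {f : V → W} (hf : IsRealBdd f) :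
    IsRealBdd fun v => c • f v :=
  ⟨fun a b => by rw [hf.map_add, smul_add], fun r a => by rw [hf.map_real, smul_comm],
    hf.bdd.smul c⟩

theorem sub [CompleteBornSpace W] {f g : V → W} (hf : IsRealBdd f) (hg : IsRealBdd g) :
    IsRealBdd fun v => f v - g v :=
  ⟨fun a b => by rw [hf.map_add, hg.map_add]; abel,
    fun r a => by rw [hf.map_real, hg.map_real, smul_sub],
    by simpa [sub_eq_add_neg] using hf.bdd.add (hg.bdd.smul (-1))⟩

theorem map_zero {f : V → W} (hf : IsRealBdd f) : f 0 = 0 := by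
  simpa using hf.map_real 0 0

theorem map_sub {f : V → W} (hf : IsRealBdd f) (a b : V) : f (a - b) = f a - f b := by
  have := hf.map_real (-1) b
  simp only [Complex.ofReal_neg, Complex.ofReal_one, neg_smul, one_smul] at this
  rw [sub_eq_add_neg, hf.map_add, this, sub_eq_add_neg]

theorem map_sum {f : V → W} (hf : IsRealBdd f) {ι : Type*} (s : Finset ι) (y : ι → V) :
    f (∑ i ∈ s, y i) = ∑ i ∈ s, f (y i) := by
  classical
  induction s using Finset.induction_on with
  | empty => simpa using hf.map_zero
  | insert i s hi ih => rw [Finset.sum_insert hi, Finset.sum_insert hi, hf.map_add, ih]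

@[fun_prop]
theorem conj {f : V → ℂ} (hf : IsRealBdd f) : IsRealBdd fun v => (starRingEnd ℂ) (f v) :=
  ⟨fun a b => by rw [hf.map_add, _root_.map_add],
    fun r a => by rw [hf.map_real, smul_eq_mul, smul_eq_mul, map_mul, Complex.conj_ofReal],
    fun s hs => by
      obtain ⟨R, hR⟩ := (hf.bdd s hs).exists_norm_le
      refine isBounded_iff_forall_norm_le.2 ⟨R, ?_⟩
      rintro _ ⟨v, hv, rfl⟩
      rw [RCLike.norm_conj]
      exact hR _ ⟨v, hv, rfl⟩⟩

@[fun_prop]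
theorem smul_const [CompleteBornSpace W] {f : V → ℂ} (hf : IsRealBdd f) (w : W) :
    IsRealBdd fun v => f v • w :=
  ⟨fun a b => by rw [hf.map_add, add_smul],
    fun r a => by rw [hf.map_real, smul_eq_mul, mul_smul],
    (isBddBilin_smul.swap.isBdd_right w).comp hf.bdd⟩

@[fun_prop]
theorem mul_const {f : V → ℂ} (hf : IsRealBdd f) (w : ℂ) : IsRealBdd fun v => f v * w :=
  hf.smul_const w

end IsRealBdd

theorem IsBddBilin.realBdd_right {β : V → W → X} (h : IsBddBilin (RingHom.id ℂ) β) (v : V) :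
    IsRealBdd fun w => β v w :=
  ⟨h.add_right v, fun r a => h.smul_right r v a, h.isBdd_right v⟩

theorem IsBddBilin.realBdd_left {β : V → W → X} (h : IsBddBilin (RingHom.id ℂ) β) (w : W) :
    IsRealBdd fun v => β v w :=
  h.swap.realBdd_right w

theorem IsBddBilin.postcomp {Y : Type*} [AddCommGroup Y] [Module ℂ Y] [Bornology Y]
    {σ : ℂ →+* ℂ} {β : V → W → X} (h : IsBddBilin σ β)
    {f : X →ₗ[ℂ] Y} (hf : IsBdd f) : IsBddBilin σ fun v w => f (β v w) where
  add_left a a' b := by rw [h.add_left, map_add]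
  add_right a b b' := by rw [h.add_right, map_add]
  smul_left c a b := by rw [h.smul_left, map_smul]
  smul_right c a b := by rw [h.smul_right, map_smul]
  bdd s t hs ht := (hf _ (h.bdd s t hs ht)).subset (by
    rintro _ ⟨a, ha, b, hb, rfl⟩
    exact ⟨_, ⟨a, ha, b, hb, rfl⟩, rfl⟩)

end RealBounded

/-! ### Density of elementary tensors -/

namespace FormalSum

variable {V : Type u} {W : Type v}
variable [AddCommGroup V] [Module ℂ V] [Bornology V]
variable [AddCommGroup W] [Module ℂ W] [Bornology W]

/-- The restriction of a formal sum to finitely many terms approximates it. -/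
theorem exists_finset_sub_mem_ball {A : Set V} {B : Set W} {r : ℝ} {c : FormalSum V W}
    (hc : c ∈ ball A B r) {ε : ℝ} (hε : 0 < ε) :
    ∃ s : Finset (V × W), c - ∑ p ∈ s, c.1 p • single p.1 p.2 ∈ ball A B ε := by
  classical
  have h := lp.hasSum_single (p := 1) (by simp) c.1
  obtain ⟨s, hs⟩ := (Metric.tendsto_atTop.1 h) ε hε
  have hval : ∀ p : V × W, c.1 p • (single p.1 p.2 : FormalSum V W).1 = lp.single 1 p (c.1 p) := by
    intro p
    have : (single p.1 p.2 : FormalSum V W).1 = lp.single 1 p (1 : ℂ) := rfl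
    rw [this, ← lp.single_smul]
    simp
  have hsum : ((∑ p ∈ s, c.1 p • single p.1 p.2 : FormalSum V W) : lp (fun _ : V × W => ℂ) 1) =
      ∑ p ∈ s, lp.single 1 p (c.1 p) := by
    rw [AddSubmonoidClass.coe_finsetSum]
    exact Finset.sum_congr rfl fun p _ => hval p
  refine ⟨s, fun p hp => hc.1 p fun h0 => hp ?_, ?_⟩
  · change c.1 p - (∑ p ∈ s, c.1 p • single p.1 p.2 : FormalSum V W).1 p = 0
    rw [hsum, h0, lp.coeFn_sum, Finset.sum_apply, zero_sub, neg_eq_zero]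
    refine Finset.sum_eq_zero fun q _ => ?_
    by_cases hq : p = q
    · subst hq
      rw [h0]; simp
    · exact Pi.single_eq_of_ne (M := fun _ : V × W => ℂ) hq _
  · change ‖c.1 - ((∑ p ∈ s, c.1 p • single p.1 p.2 : FormalSum V W) : lp _ 1)‖ ≤ ε
    rw [hsum, ← dist_eq_norm, dist_comm]
    exact (hs s le_rfl).le

end FormalSum

namespace CTensor

open FormalSum

variable {V : Type u} {W : Type v} {X : Type w} {Y : Type x}
variable [AddCommGroup V] [Module ℂ V] [Bornology V]
variable [AddCommGroup W] [Module ℂ W] [Bornology W]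
variable [AddCommGroup X] [Module ℂ X] [Bornology X]
variable [AddCommGroup Y] [Module ℂ Y] [Bornology Y]

/-- A formal sum differs from a finite part by an element of an arbitrarily small multiple of one
fixed ball. The map vanishes on the finite part and sends that ball into a completant disk `D`, so
the value lies in every `ε • D`. Only real scalars are moved through `f`, so linear and antilinear
maps are covered alike. -/
theorem eq_zero_of_tmul [CompleteBornSpace X] {f : CTensor V W → X} (hf : IsRealBdd f)
    (h : ∀ v w, f (tmul v w) = 0) (t : CTensor V W) : f t = 0 := by
  obtain ⟨c, rfl⟩ := mk_surjective t
  obtain ⟨A, B, hA, hB, hc⟩ := exists_ball c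
  obtain ⟨D, hD, hDb, hcd⟩ := CompleteBornSpace.exists_disk (hf.bdd _ (isBounded_ball hA hB 1))
  refine hcd.separated _ fun ε hε => ?_
  obtain ⟨s, hs⟩ := exists_finset_sub_mem_ball hc hε
  have h1 : f (mk V W (∑ p ∈ s, c.1 p • single p.1 p.2)) = 0 := by
    rw [map_sum, hf.map_sum]
    refine Finset.sum_eq_zero fun p _ => ?_
    rw [map_smul]
    change f (c.1 p • tmul p.1 p.2) = 0
    have := (isBddBilin_tmul (V := V) (W := W)).smul_left (c.1 p) p.1 p.2
    rw [RingHom.id_apply] at this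
    rw [← this, h]
  have h2 : mk V W (c - ∑ p ∈ s, c.1 p • single p.1 p.2) ∈ ε • (mk V W '' ball A B 1) :=
    (smul_image_ball hε).2 ⟨_, by simpa using hs, rfl⟩
  obtain ⟨y, hy, he⟩ := h2
  refine ⟨f y, hD ⟨y, hy, rfl⟩, ?_⟩
  change ε • f y = _
  rw [← Complex.coe_smul, ← hf.map_real, Complex.coe_smul]
  change ε • y = _ at he
  rw [he, map_sub, hf.map_sub, h1, sub_zero]

/-- Bounded real-linear maps on a completed tensor product are determined by their values on
elementary tensors. -/
theorem ext_tmul [CompleteBornSpace X] {f g : CTensor V W → X} (hf : IsRealBdd f)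
    (hg : IsRealBdd g) (h : ∀ v w, f (tmul v w) = g (tmul v w)) (t : CTensor V W) : f t = g t :=
  sub_eq_zero.1 (eq_zero_of_tmul (hf.sub hg) (fun v w => by rw [h, sub_self]) t)

@[fun_prop]
theorem realBdd_tmul_right (v : V) : IsRealBdd fun w : W => tmul v w :=
  isBddBilin_tmul.realBdd_right v

@[fun_prop]
theorem realBdd_tmul_left (w : W) : IsRealBdd fun v : V => tmul v w :=
  isBddBilin_tmul.realBdd_left w

@[fun_prop]
theorem realBdd_lift [CompleteBornSpace X] {β : V → W → X} (hβ : IsBddBilin (RingHom.id ℂ) β) :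
    IsRealBdd fun t => lift hβ t :=
  .of_linear _ (lift_bdd hβ)

@[fun_prop]
theorem realBdd_lift_conj [CompleteBornSpace X] {β : V → W → X}
    (hβ : IsBddBilin (starRingEnd ℂ) β) : IsRealBdd fun t => lift hβ t :=
  .of_antilinear _ (lift_bdd hβ)

@[simp] theorem map_tmul {f : V →ₗ[ℂ] X} {g : W →ₗ[ℂ] Y} (hf : IsBdd f) (hg : IsBdd g)
    (v : V) (w : W) : map hf hg (tmul v w) = tmul (f v) (g w) := lift_tmul _ v w

theorem map_bdd {f : V →ₗ[ℂ] X} {g : W →ₗ[ℂ] Y} (hf : IsBdd f) (hg : IsBdd g) :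
    IsBdd (map hf hg) := lift_bdd _

@[fun_prop]
theorem realBdd_map {f : V →ₗ[ℂ] X} {g : W →ₗ[ℂ] Y} (hf : IsBdd f) (hg : IsBdd g) :
    IsRealBdd fun t => map hf hg t := .of_linear _ (map_bdd hf hg)

@[simp] theorem slice₁_tmul [CompleteBornSpace W] {ω : V →ₗ[ℂ] ℂ} (hω : IsBdd ω) (v : V) (w : W) :
    slice₁ hω (tmul v w) = ω v • w := lift_tmul _ v w

@[simp] theorem slice₂_tmul [CompleteBornSpace V] {ω : W →ₗ[ℂ] ℂ} (hω : IsBdd ω) (v : V) (w : W) :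
    slice₂ hω (tmul v w) = ω w • v := lift_tmul _ v w

@[fun_prop]
theorem realBdd_slice₁ [CompleteBornSpace W] {ω : V →ₗ[ℂ] ℂ} (hω : IsBdd ω) :
    IsRealBdd fun t : CTensor V W => slice₁ hω t := .of_linear _ (lift_bdd _)

@[fun_prop]
theorem realBdd_slice₂ [CompleteBornSpace V] {ω : W →ₗ[ℂ] ℂ} (hω : IsBdd ω) :
    IsRealBdd fun t : CTensor V W => slice₂ hω t := .of_linear _ (lift_bdd _)

/-- Both sides are ω ⊗ η applied to `t`. This Fubini rule is what allows a property of a slice in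
one leg to be used for a slice in the other. -/
theorem slice_comm [CompleteBornSpace V] [CompleteBornSpace W] {ω : V →ₗ[ℂ] ℂ} (hω : IsBdd ω)
    {η : W →ₗ[ℂ] ℂ} (hη : IsBdd η) (t : CTensor V W) : η (slice₁ hω t) = ω (slice₂ hη t) := by
  have h1 := IsRealBdd.of_linear ω hω
  have h2 := IsRealBdd.of_linear η hη
  exact ext_tmul (f := fun t => η (slice₁ hω t)) (g := fun t => ω (slice₂ hη t))
    (by fun_prop) (by fun_prop) (fun v w => by simp [mul_comm]) t

variable (V W) in
/-- The flip `v ⊗ w ↦ w ⊗ v`. -/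
noncomputable def flip : CTensor V W →ₗ[ℂ] CTensor W V := lift isBddBilin_tmul.swap

@[simp] theorem flip_tmul (v : V) (w : W) : flip V W (tmul v w) = tmul w v := lift_tmul _ v w

theorem flip_bdd : IsBdd (flip V W) := lift_bdd _

@[fun_prop]
theorem realBdd_flip : IsRealBdd fun t => flip V W t := .of_linear _ flip_bdd

theorem assoc_tmul (t : CTensor V W) (x : X) :
    assoc V W X (tmul t x) = lift (isBddBilin_assoc_inner x) t := lift_tmul _ t x

@[simp] theorem assoc_tmul_tmul (v : V) (w : W) (x : X) :
    assoc V W X (tmul (tmul v w) x) = tmul v (tmul w x) := by rw [assoc_tmul, lift_tmul]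

theorem assoc_bdd : IsBdd (assoc V W X) := lift_bdd _

@[fun_prop]
theorem realBdd_assoc : IsRealBdd fun t => assoc V W X t := .of_linear _ assoc_bdd

section Act

variable {V' V'' W' W'' : Type*}
    [AddCommGroup V'] [Module ℂ V'] [Bornology V'] [AddCommGroup V''] [Module ℂ V''] [Bornology V'']
    [AddCommGroup W'] [Module ℂ W'] [Bornology W'] [AddCommGroup W''] [Module ℂ W''] [Bornology W'']
    {ρ₁ : V → V' → V''} {ρ₂ : W → W' → W''} (h₁ : IsBddBilin (RingHom.id ℂ) ρ₁)
    (h₂ : IsBddBilin (RingHom.id ℂ) ρ₂)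

@[fun_prop]
theorem realBdd_act_left (t : CTensor V' W') : IsRealBdd fun s => act h₁ h₂ s t :=
  (isBddBilin_act h₁ h₂).realBdd_left t

@[fun_prop]
theorem realBdd_act_right (s : CTensor V W) : IsRealBdd fun t => act h₁ h₂ s t :=
  (isBddBilin_act h₁ h₂).realBdd_right s

end Act

theorem isBddBilin_assocInv_inner (v : V) :
    IsBddBilin (RingHom.id ℂ) fun (w : W) (x : X) => tmul (tmul v w) x :=
  isBddBilin_tmul.comp (isBddBilin_tmul.isBdd_right v) IsBdd.id
    (fun a a' => isBddBilin_tmul.add_right v a a') (fun c a => isBddBilin_tmul.smul_right c v a)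
    (fun _ _ => rfl) (fun _ _ => rfl)

theorem isBddBilin_assocInv : IsBddBilin (RingHom.id ℂ)
    fun (v : V) (t : CTensor W X) => lift (isBddBilin_assocInv_inner v) t where
  add_left v v' t := lift_add _ _ _ (fun w x => by
    rw [isBddBilin_tmul.add_left, isBddBilin_tmul.add_left]) t
  add_right v t t' := map_add _ _ _
  smul_left c v t := lift_smul c _ _ (fun w x => by
    rw [isBddBilin_tmul.smul_left, isBddBilin_tmul.smul_left]; rfl) t
  smul_right c v t := map_smul _ _ _
  bdd s t hs ht := by
    obtain ⟨A, B, r, hA, hB, h⟩ := isBounded_iff.1 ht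
    -- A single bounded set must serve all `v ∈ s` at once, so the bound for each separate lift
    -- would not suffice.
    obtain ⟨D, hD, h'⟩ := lift_bdd_uniform (RingHom.id ℂ) A B r
      (isBddBilin_tmul.bdd _ B (isBddBilin_tmul.bdd s A hs hA) hB)
    refine hD.subset ?_
    rintro _ ⟨v, hv, y, hy, rfl⟩
    exact h' _ (isBddBilin_assocInv_inner v)
      (fun a ha b hb => mem_image2_of_mem (mem_image2_of_mem hv ha) hb) y (h hy)

variable (V W X) in
/-- The associativity map `v ⊗ (w ⊗ x) ↦ (v ⊗ w) ⊗ x`. -/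
noncomputable def assocInv : CTensor V (CTensor W X) →ₗ[ℂ] CTensor (CTensor V W) X :=
  lift isBddBilin_assocInv

theorem assocInv_tmul (v : V) (t : CTensor W X) :
    assocInv V W X (tmul v t) = lift (isBddBilin_assocInv_inner v) t := lift_tmul _ v t

@[simp] theorem assocInv_tmul_tmul (v : V) (w : W) (x : X) :
    assocInv V W X (tmul v (tmul w x)) = tmul (tmul v w) x := by rw [assocInv_tmul, lift_tmul]

@[fun_prop]
theorem realBdd_assocInv : IsRealBdd fun t => assocInv V W X t := .of_linear _ (lift_bdd _)

theorem ext_tmul₃ [CompleteBornSpace Y] {f g : CTensor V (CTensor W X) → Y} (hf : IsRealBdd f)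
    (hg : IsRealBdd g) (h : ∀ v w x, f (tmul v (tmul w x)) = g (tmul v (tmul w x)))
    (t : CTensor V (CTensor W X)) : f t = g t :=
  ext_tmul hf hg (fun v s => ext_tmul (f := fun s => f (tmul v s)) (g := fun s => g (tmul v s))
    (by fun_prop) (by fun_prop) (h v) s) t

theorem ext_tmul₃' [CompleteBornSpace Y] {f g : CTensor (CTensor V W) X → Y} (hf : IsRealBdd f)
    (hg : IsRealBdd g) (h : ∀ v w x, f (tmul (tmul v w) x) = g (tmul (tmul v w) x))
    (t : CTensor (CTensor V W) X) : f t = g t :=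
  ext_tmul hf hg (fun s x => ext_tmul (f := fun s => f (tmul s x)) (g := fun s => g (tmul s x))
    (by fun_prop) (by fun_prop) (fun v w => h v w x) s) t

@[simp] theorem assoc_assocInv (t : CTensor V (CTensor W X)) :
    assoc V W X (assocInv V W X t) = t :=
  ext_tmul₃ (f := fun t => assoc V W X (assocInv V W X t)) (g := fun t => t)
    (by fun_prop) (by fun_prop) (fun v w x => by simp only [assoc_tmul_tmul, assocInv_tmul_tmul]) t

@[simp] theorem assocInv_assoc (t : CTensor (CTensor V W) X) :
    assocInv V W X (assoc V W X t) = t := by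
  have key : ∀ v w x, assocInv V W X (assoc V W X (tmul (tmul v w) x)) = tmul (tmul v w) x :=
    fun v w x => by rw [assoc_tmul_tmul, assocInv_tmul_tmul]
  exact ext_tmul₃' (f := fun t => assocInv V W X (assoc V W X t)) (g := fun t => t)
    (by fun_prop) (by fun_prop) key t

end CTensor

/-! ### Essential actions, and transport of the approximation property -/

section Essential

variable {V : Type u} {W : Type v} {X : Type w}
variable [AddCommGroup V] [Module ℂ V] [Bornology V]
variable [AddCommGroup W] [Module ℂ W] [Bornology W] [CompleteBornSpace W]
variable [AddCommGroup X] [Module ℂ X] [Bornology X] [CompleteBornSpace X]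

/-- A bounded section maps `T` to a bounded set whose image is exactly `T`. All essentiality axioms
of the dual are obtained in this way. -/
theorem IsEssentialAction.of_section {ρ : V → W → W} {hρ : IsBddBilin (RingHom.id ℂ) ρ}
    (σ : W → CTensor V W) (hσ : IsBdd σ) (h : ∀ w, CTensor.lift hρ (σ w) = w) :
    IsEssentialAction hρ := fun T hT =>
  ⟨σ '' T, hσ T hT, by simp [image_image, h]⟩

theorem IsEssentialAction.exists_lift {ρ : V → W → W} {hρ : IsBddBilin (RingHom.id ℂ) ρ}
    (h : IsEssentialAction hρ) (w : W) : ∃ t, CTensor.lift hρ t = w := by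
  obtain ⟨S, -, hS⟩ := h {w} isBounded_singleton
  obtain ⟨t, -, ht⟩ : w ∈ CTensor.lift hρ '' S := hS ▸ rfl
  exact ⟨t, ht⟩

/-- This replaces the missing unit: in an identity between bounded maps, a vector may be assumed to
be a product. -/
theorem IsEssentialAction.ext {ρ : V → W → W} {hρ : IsBddBilin (RingHom.id ℂ) ρ}
    (h : IsEssentialAction hρ) {f g : W → X} (hf : IsRealBdd f) (hg : IsRealBdd g)
    (hfg : ∀ v w, f (ρ v w) = g (ρ v w)) (w : W) : f w = g w := by
  obtain ⟨t, rfl⟩ := h.exists_lift w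
  exact CTensor.ext_tmul (f := fun t => f (CTensor.lift hρ t))
    (g := fun t => g (CTensor.lift hρ t)) (hf.comp (CTensor.realBdd_lift hρ))
    (hg.comp (CTensor.realBdd_lift hρ)) (fun v w => by simpa using hfg v w) t

end Essential

section Transport

variable {V : Type u} {W : Type v}
variable [AddCommGroup V] [Module ℂ V] [Bornology V]
variable [AddCommGroup W] [Module ℂ W] [Bornology W]

theorem image_real_smul (e : V ≃ₗ[ℂ] W) (r : ℝ) (D : Set V) : e '' (r • D) = r • (e '' D) := by
  refine image_smul_comm _ _ _ fun v => ?_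
  rw [← Complex.coe_smul, ← Complex.coe_smul, map_smul]

/-- The approximation property is invariant under isomorphisms. -/
theorem HasApproximationProperty.of_equiv (h : HasApproximationProperty V) (e : V ≃ₗ[ℂ] W)
    (he : IsBdd e) (he' : IsBdd e.symm) : HasApproximationProperty W := by
  rintro K ⟨D, hD, hcd, hK, hF⟩
  have hsymm : ∀ (r : ℝ) (D : Set W), e.symm '' (r • D) = r • (e.symm '' D) :=
    image_real_smul e.symm
  obtain ⟨E, hE, hT⟩ := h (e.symm '' K) ⟨e.symm '' D, he' D hD, hcd.image e.symm, by
    rintro _ ⟨k, hk, rfl⟩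
    have := Submodule.mem_map_of_mem (f := e.symm.toLinearMap) (hK hk)
    rw [Submodule.map_span] at this
    exact this, fun ε hε => by
    obtain ⟨F, hF, hKF⟩ := hF ε hε
    refine ⟨e.symm '' F, hF.image _, ?_⟩
    rw [← hsymm, ← image_add]
    exact image_mono hKF⟩
  refine ⟨e '' E, he E hE, fun ε hε => ?_⟩
  obtain ⟨T, hTb, hfin, hTK⟩ := hT ε hε
  refine ⟨e.toLinearMap ∘ₗ T ∘ₗ e.symm.toLinearMap, he.comp (hTb.comp he'), ?_, fun x hx => ?_⟩
  · rw [LinearMap.range_comp, LinearMap.range_comp, LinearEquiv.range, Submodule.map_top]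
    infer_instance
  · have := mem_image_of_mem e (hTK _ ⟨x, hx, rfl⟩)
    rw [image_real_smul] at this
    simpa using this

end Transport

end

section

/-! ### Bounded finite rank operators -/

section FiniteRank

/-- Linear functionals on a finite-dimensional space are bounded on absorbent disks that contain
no line. -/
theorem exists_norm_le_of_absorbent {E : Type*} [AddCommGroup E] [Module ℂ E]
    [FiniteDimensional ℂ E] {D : Set E} (hb : Balanced ℂ D) (hc : Convex ℝ D)
    (ha : Absorbent ℝ D) (hs : ∀ x, (∀ ε : ℝ, 0 < ε → x ∈ ε • D) → x = 0) (f : E →ₗ[ℂ] ℂ) :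
    ∃ C : ℝ, ∀ x ∈ D, ‖f x‖ ≤ C := by
  -- The hypotheses on `D` say that its gauge is a norm, for which every functional on `E` is
  -- continuous; `C` is the operator norm.
  let p := gaugeSeminorm hb hc ha
  let _ : Norm E := ⟨p⟩
  have core : NormedSpace.Core ℂ E :=
    { norm_nonneg := fun x => apply_nonneg p x
      norm_smul := fun c x => map_smul_eq_mul p c x
      norm_triangle := fun x y => map_add_le_add p x y
      norm_eq_zero_iff := fun x => by
        refine ⟨fun h => hs x fun ε hε => ?_, fun h => by
          change p x = 0
          rw [h, map_zero]⟩
        obtain ⟨b, hb0, hbε, hx⟩ := exists_lt_of_gauge_lt ha (a := ε) (x := x) (by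
          change gauge D x = 0 at h
          rw [h]; exact hε)
        obtain ⟨d, hd, rfl⟩ := hx
        refine ⟨((b / ε : ℝ) : ℂ) • d, hb.smul_mem ?_ hd, ?_⟩
        · rw [Complex.norm_real, Real.norm_of_nonneg (by positivity)]
          exact (div_le_one hε).2 hbε.le
        · change ε • ((b / ε : ℝ) : ℂ) • d = b • d
          rw [Complex.coe_smul, smul_smul, mul_div_cancel₀ _ hε.ne'] }
  let _ : NormedAddCommGroup E := NormedAddCommGroup.ofCore core
  let _ : NormedSpace ℂ E := NormedSpace.ofCore core
  let g : E →L[ℂ] ℂ := LinearMap.toContinuousLinearMap f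
  refine ⟨‖g‖, fun x hx => ?_⟩
  have h1 : ‖x‖ ≤ 1 := gauge_le_one_of_mem hx
  calc ‖f x‖ = ‖g x‖ := rfl
    _ ≤ ‖g‖ * ‖x‖ := g.le_opNorm x
    _ ≤ ‖g‖ := mul_le_of_le_one_right (norm_nonneg _) h1

variable {V : Type u} [AddCommGroup V] [Module ℂ V] [Bornology V] [CompleteBornSpace V]

/-- The functionals are the coordinates of `T` in a basis of its range. They are bounded because the
trace of a completant disk on the range is absorbent and contains no line, once the disk contains
the basis. -/
theorem exists_finite_rank_decomposition {T : V →ₗ[ℂ] V} (hT : IsBdd T)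
    (hfin : FiniteDimensional ℂ (LinearMap.range T)) :
    ∃ (n : ℕ) (f : Fin n → V →ₗ[ℂ] ℂ) (e : Fin n → V), (∀ i, IsBdd (f i)) ∧
      ∀ v, T v = ∑ i, f i v • e i := by
  let R := LinearMap.range T
  let b := Module.finBasis ℂ R
  refine ⟨_, fun i => b.coord i ∘ₗ T.rangeRestrict, fun i => b i, fun i s hs => ?_, fun v => ?_⟩
  · obtain ⟨D, hne, hsD, heD, hDb, hD⟩ := exists_disk_union (hT s hs)
      (Set.finite_range fun i => (b i : V)).isBounded
    let E : Set R := {x | (x : V) ∈ D}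
    have hE : ∀ (r : ℝ) (x : R), (x : V) ∈ r • D → 0 < r → x ∈ r • E := by
      rintro r x ⟨d, hd, hx⟩ hr
      change r • d = x at hx
      have hd' : d = (r : ℂ)⁻¹ • (x : V) := by
        rw [← hx, ← Complex.coe_smul, inv_smul_smul₀ (by exact_mod_cast hr.ne')]
      refine ⟨(r : ℂ)⁻¹ • x, ?_, ?_⟩
      · change (((r : ℂ)⁻¹ • x : R) : V) ∈ D
        rw [Submodule.coe_smul, ← hd']
        exact hd
      · change r • ((r : ℂ)⁻¹ • x) = x
        rw [← Complex.coe_smul, smul_inv_smul₀ (by exact_mod_cast hr.ne')]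
    have hE' : ∀ (r : ℝ) (x : R), x ∈ r • E → (x : V) ∈ r • D := by
      rintro r _ ⟨d, hd, rfl⟩
      refine ⟨d, hd, ?_⟩
      change r • (d : V) = ((r • d : R) : V)
      rw [← Complex.coe_smul, ← Complex.coe_smul, Submodule.coe_smul]
    obtain ⟨C, hC⟩ := exists_norm_le_of_absorbent (D := E)
      (by
        rw [balanced_iff_smul_mem]
        intro a ha x hx
        exact hD.balanced.smul_mem ha hx)
      (by
        intro x hx y hy p q hp hq hpq
        have := hD.convex hx hy hp hq hpq
        change ((p • x + q • y : R) : V) ∈ D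
        rw [← Complex.coe_smul, ← Complex.coe_smul] at this ⊢
        exact this)
      (by
        intro x
        have hx : (x : V) ∈ (∑ i, ‖b.repr x i‖) • D := by
          have := hD.sum_mem hne Finset.univ (fun i => b.repr x i) (fun i => (b i : V))
            (fun i _ => heD ⟨i, rfl⟩)
          have h2 : ∑ i, b.repr x i • (b i : V) = x := by
            have := congrArg (R.subtype) (b.sum_repr x)
            simp only [map_sum, map_smul] at this
            exact this
          rwa [h2] at this
        have h0 : 0 ≤ ∑ i, ‖b.repr x i‖ := Finset.sum_nonneg fun _ _ => norm_nonneg _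
        -- Real `a` outside a bounded set must satisfy `x ∈ a • E`. The summand 1 in the radius
        -- forces `a ≠ 0`; balancedness reduces negative `a` to `|a|`.
        refine Filter.eventually_of_mem (isBounded_def.1 (Metric.isBounded_closedBall (x := (0 : ℝ))
          (r := (∑ i, ‖b.repr x i‖) + 1))) fun a ha => ?_
        rw [mem_compl_iff, mem_closedBall_zero_iff, not_le] at ha
        rw [singleton_subset_iff]
        have h1 := hE _ x (hD.mono h0 (by linarith : _ ≤ ‖a‖) hx) (by linarith)
        rw [Real.norm_eq_abs] at h1
        rcases abs_choice a with h | h <;> rw [h] at h1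
        · exact h1
        · obtain ⟨d, hd, rfl⟩ := h1
          refine ⟨(-1 : ℂ) • d, hD.balanced.smul_mem (by simp) hd, ?_⟩
          change a • ((-1 : ℂ) • d) = (-a) • d
          simp)
      (fun x hx => Subtype.ext (hD.separated _ fun ε hε => hE' ε x (hx ε hε)))
      (b.coord i)
    refine isBounded_iff_forall_norm_le.2 ⟨C, ?_⟩
    rintro _ ⟨v, hv, rfl⟩
    exact hC _ (hsD ⟨v, hv, rfl⟩)
  · have := congrArg R.subtype (b.sum_repr (T.rangeRestrict v))
    simp only [map_sum, map_smul] at this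
    exact this.symm

end FiniteRank

/-- A summable family stays summable after multiplication by a suitable family that tends to
infinity. -/
theorem exists_summable_div {ι : Type*} {r : ι → ℝ} (hr : ∀ i, 0 ≤ r i) (hs : Summable r) :
    ∃ μ : ι → ℝ, (∀ i, 0 < μ i) ∧ (∀ i, μ i ≤ 1) ∧ Summable (fun i => r i / μ i) ∧
      ∀ ε : ℝ, 0 < ε → {i | r i ≠ 0 ∧ ε < μ i}.Finite := by
  classical
  have hv : ∀ k : ℕ, ∃ s : Finset ι, ∀ t : Finset ι, Disjoint t s →
      ∑ i ∈ t, r i < (1 / 2 : ℝ) ^ k := by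
    intro k
    obtain ⟨s, hs⟩ := summable_iff_vanishing_norm.1 hs ((1 / 2 : ℝ) ^ k) (by positivity)
    exact ⟨s, fun t ht => (Real.le_norm_self _).trans_lt (hs t ht)⟩
  choose F hF using hv
  -- Outside `F k` the family has mass at most 2⁻ᵏ, and `n k` is the indicator of the complement of
  -- `F k`.
  let n : ℕ → ι → ℝ := fun k i => if i ∈ F k then 0 else 1
  have hn : ∀ i, r i ≠ 0 → Summable fun k => n k i := by
    intro i hi
    have hpos : 0 < r i := lt_of_le_of_ne (hr i) (Ne.symm hi)
    obtain ⟨N, hN⟩ := exists_pow_lt_of_lt_one hpos (by norm_num : (1 / 2 : ℝ) < 1)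
    refine summable_of_ne_finset_zero (s := Finset.range N) fun k hk => ?_
    have hk' : N ≤ k := by simpa using hk
    by_contra h
    have hiF : i ∉ F k := fun h' => h (by simp [n, h'])
    have h1 := hF k {i} (by simpa using hiF)
    have h2 := pow_le_pow_of_le_one (by norm_num : (0 : ℝ) ≤ 1 / 2) (by norm_num) hk'
    simp only [Finset.sum_singleton] at h1
    linarith
  have hn0 : ∀ k i, 0 ≤ n k i := fun k i => by
    dsimp only [n]; split_ifs <;> norm_num
  -- Where `r i ≠ 0` this is one plus the number of sets `F k` that miss `i`, a finite number by
  -- `hn`. Where `r i = 0` the series may diverge; the default value 0 of the sum is then harmless.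
  let w : ι → ℝ := fun i => 1 + ∑' k, n k i
  have hw1 : ∀ i, 1 ≤ w i := fun i => le_add_of_nonneg_right (tsum_nonneg fun k => hn0 k i)
  refine ⟨fun i => (w i)⁻¹, fun i => inv_pos.2 (by linarith [hw1 i]),
    fun i => inv_le_one_of_one_le₀ (hw1 i), ?_, fun ε hε => ?_⟩
  · simp only [div_inv_eq_mul]
    -- Row `k` sums to at most 2⁻ᵏ, so the double family is summable; summing over `k` first gives
    -- the summability of `r i * (w i - 1)`.
    have hprod : Summable fun p : ℕ × ι => r p.2 * n p.1 p.2 := by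
      rw [summable_prod_of_nonneg fun p => mul_nonneg (hr _) (hn0 _ _)]
      have hle : ∀ k (t : Finset ι), ∑ i ∈ t, r i * n k i ≤ (1 / 2 : ℝ) ^ k := by
        intro k t
        have h1 : ∑ i ∈ t, r i * n k i = ∑ i ∈ t \ F k, r i := by
          rw [Finset.sdiff_eq_filter, Finset.sum_filter]
          refine Finset.sum_congr rfl fun i _ => ?_
          dsimp only [n]; split_ifs <;> simp_all
        rw [h1]
        exact (hF k _ Finset.sdiff_disjoint).le
      have hk : ∀ k, Summable fun i => r i * n k i := fun k =>
        summable_of_sum_le (fun i => mul_nonneg (hr _) (hn0 _ _)) (hle k)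
      refine ⟨hk, Summable.of_nonneg_of_le (fun k => tsum_nonneg fun i => mul_nonneg (hr _) (hn0 _ _))
        (fun k => (hk k).tsum_le_of_sum_le (hle k)) summable_geometric_two⟩
    have h2 : Summable fun i => ∑' k, r i * n k i := hprod.prod_symm.prod
    refine (hs.add h2).congr fun i => ?_
    rw [tsum_mul_left]
    dsimp only [w]
    ring
  -- An index with `r i ≠ 0` missed by `F 0, …, F (N - 1)` has `w i > N > ε⁻¹`, so only indices in
  -- these finite sets remain.
  · obtain ⟨N, hN⟩ := exists_nat_gt ε⁻¹
    refine ((Finset.range N).biUnion F).finite_toSet.subset ?_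
    rintro i ⟨hi, hiε⟩
    by_contra h
    have hall : ∀ k ∈ Finset.range N, n k i = 1 := by
      intro k hk
      have : i ∉ F k := fun h' => h (by
        simp only [Finset.coe_biUnion, mem_iUnion]
        exact ⟨k, hk, h'⟩)
      simp [n, this]
    have h1 : (N : ℝ) ≤ ∑' k, n k i := by
      have := (hn i hi).sum_le_tsum (Finset.range N) (fun k _ => hn0 k i)
      rw [Finset.sum_congr rfl hall] at this
      simpa using this
    have h2 : w i < ε⁻¹ := by
      rw [lt_inv_comm₀ hε (by linarith [hw1 i])] at hiε
      exact hiε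
    have : (N : ℝ) ≤ w i := by dsimp only [w]; linarith
    linarith

/-! ### Slices separate the points of the completed tensor product -/

namespace CTensor

open FormalSum

variable {V : Type u} {W : Type v}
variable [AddCommGroup V] [Module ℂ V] [Bornology V] [CompleteBornSpace V]
variable [AddCommGroup W] [Module ℂ W] [Bornology W]

/-- If `V` has the approximation property, then each `t ∈ V ⊗̂ W` can be approximated by
`(T ⊗ ι) t` for bounded finite rank operators `T`. -/
theorem exists_finite_rank_sub_mem (hV : HasApproximationProperty V) (t : CTensor V W) :
    ∃ D : Set (CTensor V W), IsCompletantDisk D ∧ ∀ ε : ℝ, 0 < ε →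
      ∃ (T : V →ₗ[ℂ] V) (hT : IsBdd T), FiniteDimensional ℂ (LinearMap.range T) ∧
        map (g := LinearMap.id) hT IsBdd.id t - t ∈ ε • D := by
  obtain ⟨c, rfl⟩ := mk_surjective t
  obtain ⟨A, B, hA, hB, hc⟩ := exists_ball c
  obtain ⟨μ, hμ0, hμ1, hsum, hfin⟩ := exists_summable_div (fun p => norm_nonneg (c.1 p))
    (summable_norm c)
  obtain ⟨D₀, hne₀, hAD, -, hDb, hD₀⟩ := exists_disk_union hA isBounded_empty
  -- The factors `μ p` make the first tensor legs small outside finite sets, so that `K` is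
  -- precompact, while the compensated coefficients `‖c p‖ / μ p` are still summable.
  let K : Set V := {v | ∃ p : V × W, c.1 p ≠ 0 ∧ v = (μ p : ℂ) • p.1}
  have hKε : ∀ p : V × W, c.1 p ≠ 0 → ∀ ε : ℝ, μ p ≤ ε → (μ p : ℂ) • p.1 ∈ ε • D₀ := by
    intro p hp ε hε
    refine hD₀.smul_mem (r := 1) _ ?_ zero_le_one (by simpa using hAD (hc.1 p hp).1)
    rwa [mul_one, Complex.norm_real, Real.norm_of_nonneg (hμ0 p).le]
  have hz : ∀ ε : ℝ, 0 < ε → (0 : V) ∈ ε • D₀ := by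
    intro ε hε
    obtain ⟨d, hd⟩ := hne₀
    exact hD₀.mono le_rfl hε.le ⟨d, hd, zero_smul ℝ d⟩
  have hK : IsBornPrecompact K := by
    refine ⟨D₀, hDb, hD₀, ?_, fun ε hε => ?_⟩
    · rintro _ ⟨p, hp, rfl⟩
      exact hD₀.mem_span (hKε p hp 1 (hμ1 p))
    · refine ⟨insert 0 ((fun p : V × W => (μ p : ℂ) • p.1) '' {p | ‖c.1 p‖ ≠ 0 ∧ ε < μ p}),
        ((hfin ε hε).image _).insert _, ?_⟩
      rintro _ ⟨p, hp, rfl⟩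
      by_cases h : ε < μ p
      · exact ⟨_, Or.inr ⟨p, ⟨norm_ne_zero_iff.2 hp, h⟩, rfl⟩, 0, hz ε hε, add_zero _⟩
      · exact ⟨0, Or.inl rfl, _, hKε p hp ε (not_lt.1 h), zero_add _⟩
  obtain ⟨D, hD, hT⟩ := hV K hK
  obtain ⟨D₁, hne₁, hDD₁, -, hDb₁, hD₁⟩ := exists_disk_union hD isBounded_empty
  -- If `B` is empty then `c = 0` and the zero operator will do. Otherwise the ball used below is
  -- nonempty, as summation in it requires.
  by_cases hBne : B.Nonempty
  swap
  · have hc0 : c = 0 := by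
      refine Subtype.ext (lp.ext (funext fun p => ?_))
      by_contra h
      exact hBne ⟨_, (hc.1 p h).2⟩
    refine ⟨_, isCompletantDisk_ball hA hB one_pos, fun ε hε => ⟨0, ?_, ?_, ?_⟩⟩
    · intro s _
      refine (isBounded_singleton (x := (0 : V))).subset ?_
      rintro _ ⟨_, _, rfl⟩
      rfl
    · rw [LinearMap.range_zero]; infer_instance
    · rw [hc0, _root_.map_zero, _root_.map_zero, sub_zero, smul_image_ball hε]
      exact ⟨0, ⟨fun p hp => absurd rfl hp, by simpa using hε.le⟩, _root_.map_zero _⟩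
  have hcd := isCompletantDisk_ball hDb₁ hB one_pos
  have hcb := isBounded_ball hDb₁ hB 1
  refine ⟨_, hcd, fun ε hε => ?_⟩
  -- With tolerance `ε / M` on `K`, the compensated coefficients contribute at most `(ε / M) * (M -
  -- 1)`; the summand 1 leaves `ε / M` for the tail of the series.
  let M : ℝ := (∑' p, ‖c.1 p‖ / μ p) + 1
  have hM : 0 < M := add_pos_of_nonneg_of_pos
    (tsum_nonneg fun p => div_nonneg (norm_nonneg _) (hμ0 p).le) one_pos
  obtain ⟨T, hTb, hTf, hTK⟩ := hT (ε / M) (by positivity)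
  refine ⟨T, hTb, hTf, ?_⟩
  have hTb' : IsBdd (T - LinearMap.id : V →ₗ[ℂ] V) := by
    have := hTb.add (IsBdd.smul (-1) (IsBdd.id (V := V)))
    simpa [sub_eq_add_neg, IsBdd] using this
  have he : ∀ t : CTensor V W, map (g := LinearMap.id) hTb IsBdd.id t - t =
      map (g := LinearMap.id) hTb' IsBdd.id t := by
    refine fun t => ext_tmul ((realBdd_map _ _).sub .id') (realBdd_map _ _) (fun v w => ?_) t
    rw [map_tmul, map_tmul, LinearMap.sub_apply, sub_eq_add_neg (T v), isBddBilin_tmul.add_left,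
      LinearMap.id_apply, LinearMap.id_apply, ← neg_one_smul ℂ v, isBddBilin_tmul.smul_left]
    simp [sub_eq_add_neg]
  rw [he]
  -- The error (T v - v) ⊗ w is written as a coefficient `z p` times a tensor `y p` in the unit
  -- ball: `T` moves `μ p • v` by at most `ε / M`.
  let y : V × W → CTensor V W := fun p =>
    (((ε / M : ℝ) : ℂ)⁻¹ * (μ p : ℂ)) • tmul (T p.1 - p.1) p.2
  have hεM : 0 < ε / M := by positivity
  have hy : ∀ p, c.1 p ≠ 0 → y p ∈ mk V W '' ball D₁ B 1 := by
    intro p hp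
    obtain ⟨d, hd, hdT⟩ := hTK _ ⟨p, hp, rfl⟩
    change (ε / M) • d = _ at hdT
    have h1 : y p = tmul d p.2 := by
      change (((ε / M : ℝ) : ℂ)⁻¹ * (μ p : ℂ)) • tmul (T p.1 - p.1) p.2 = _
      rw [mul_smul]
      have h2 := (isBddBilin_tmul (V := V) (W := W)).smul_left (μ p : ℂ) (T p.1 - p.1) p.2
      rw [RingHom.id_apply] at h2
      rw [← h2, smul_sub, ← map_smul, ← hdT, ← Complex.coe_smul]
      have h3 := (isBddBilin_tmul (V := V) (W := W)).smul_left ((ε / M : ℝ) : ℂ) d p.2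
      rw [RingHom.id_apply] at h3
      rw [h3, inv_smul_smul₀ (by exact_mod_cast hεM.ne')]
    rw [h1]
    exact ⟨single d p.2, ball_mono (singleton_subset_iff.2 (hDD₁ hd))
      (singleton_subset_iff.2 (hc.1 p hp).2) le_rfl (single_mem_ball _ _), rfl⟩
  have hb : (mk V W '' ball D₁ B 1).Nonempty := by
    obtain ⟨d, hd⟩ := hne₁
    obtain ⟨b, hb⟩ := hBne
    exact ⟨_, single d b, ball_mono (singleton_subset_iff.2 hd)
      (singleton_subset_iff.2 hb) le_rfl (single_mem_ball _ _), rfl⟩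
  let z : V × W → ℂ := fun p => (((ε / M : ℝ) : ℂ) / (μ p : ℂ)) * c.1 p
  have hzn : ∀ p, ‖z p‖ = ε / M * (‖c.1 p‖ / μ p) := by
    intro p
    simp only [z, norm_mul, norm_div, Complex.norm_real, Real.norm_of_nonneg hεM.le,
      Real.norm_of_nonneg (hμ0 p).le]
    ring
  have hzs : Summable fun p => ‖z p‖ := by
    simp only [hzn]
    exact hsum.mul_left _
  have hzy : ∀ p, z p • y p = c.1 p • tmul (T p.1 - p.1) p.2 := by
    intro p
    simp only [z, y, smul_smul]
    congr 1
    have h1 : (μ p : ℂ) ≠ 0 := by exact_mod_cast (hμ0 p).ne'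
    have h2 : ((ε / M : ℝ) : ℂ) ≠ 0 := by exact_mod_cast hεM.ne'
    field_simp
  obtain ⟨a, ha⟩ := hcd.exists_sum hb z hzs y (fun p hp => hy p fun h => hp (by simp [z, h]))
  simp only [hzy] at ha
  have hval : map (g := LinearMap.id) hTb' IsBdd.id (mk V W c) = a :=
    (value_spec (isBddBilin_tmul.compLinear hTb' (IsBdd.id (V := W))) c).unique
      ⟨_, hcb, hcd, ha⟩
  rw [hval]
  -- The sum over `s` and the remainder add up to at most `(ε / M) * (M - 1) + ε / M = ε`.
  obtain ⟨s, hs⟩ := ha (ε / M) hεM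
  have h1 := hs s Finset.Subset.rfl
  have h2 := hcd.sum_mem hb s z y (fun p hp => hy p fun h => hp (by simp [z, h]))
  simp only [hzy] at h2
  have h3 := hcd.add_mem hεM.le (Finset.sum_nonneg fun _ _ => norm_nonneg _) h1 h2
  rw [sub_add_cancel] at h3
  refine hcd.mono (add_nonneg hεM.le (Finset.sum_nonneg fun _ _ => norm_nonneg _)) ?_ h3
  have h4 : ∑ p ∈ s, ‖z p‖ ≤ ε / M * (M - 1) := by
    refine (hzs.sum_le_tsum s fun _ _ => norm_nonneg _).trans ?_
    simp only [hzn]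
    rw [tsum_mul_left]
    simp [M]
  have h5 : ε / M * M = ε := div_mul_cancel₀ _ hM.ne'
  nlinarith

/-- Slices by a separating family of functionals separate the points of `V ⊗̂ W` if `V` has the
approximation property. -/
theorem eq_zero_of_slice₂ [CompleteBornSpace W] (hV : HasApproximationProperty V) {ι : Type*}
    (ω : ι → W →ₗ[ℂ] ℂ) (hω : ∀ i, IsBdd (ω i)) (hsep : ∀ w, (∀ i, ω i w = 0) → w = 0)
    (t : CTensor V W) (ht : ∀ i, slice₂ (hω i) t = 0) : t = 0 := by
  obtain ⟨D, hD, h⟩ := exists_finite_rank_sub_mem hV t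
  rw [← neg_eq_zero]
  refine hD.separated _ fun ε hε => ?_
  obtain ⟨T, hT, hfin, hmem⟩ := h ε hε
  -- If `T ⊗ ι` annihilates `t`, then the approximation error is `-t`, which therefore lies in `ε •
  -- D`.
  suffices h0 : map (g := LinearMap.id) hT IsBdd.id t = 0 by
    rwa [h0, zero_sub] at hmem
  obtain ⟨n, f, e, hf, hTe⟩ := exists_finite_rank_decomposition hT hfin
  -- The vanishing slices are in the second leg, those in the expansion of `T ⊗ ι` are in the first;
  -- Fubini and the separating family pass from one to the other.
  have hs : ∀ i, slice₁ (hf i) t = 0 := fun i => hsep _ fun j => by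
    rw [slice_comm (hf i) (hω j), ht, _root_.map_zero]
  have key : IsRealBdd fun t : CTensor V W => ∑ i, tmul (e i) (slice₁ (hf i) t) := by
    have : ∀ s : Finset (Fin n), IsRealBdd fun t : CTensor V W =>
        ∑ i ∈ s, tmul (e i) (slice₁ (hf i) t) := by
      classical
      intro s
      induction s using Finset.induction_on with
      | empty =>
        refine ⟨by simp, by simp, fun s _ => (isBounded_singleton (x := 0)).subset ?_⟩
        rintro _ ⟨_, _, rfl⟩
        simp
      | insert i s hi ih =>
        simp only [Finset.sum_insert hi]
        have h1 : IsRealBdd fun t : CTensor V W => tmul (e i) (slice₁ (hf i) t) := by fun_prop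
        exact ⟨fun a b => by rw [h1.map_add, ih.map_add]; abel,
          fun r a => by rw [h1.map_real, ih.map_real, smul_add], h1.bdd.add ih.bdd⟩
    exact this Finset.univ
  rw [ext_tmul (f := fun t => map (g := LinearMap.id) hT IsBdd.id t) (realBdd_map _ _) key
    (fun v w => ?_) t]
  · simp only [hs]
    refine Finset.sum_eq_zero fun i _ => ?_
    exact (realBdd_tmul_right (W := W) (e i)).map_zero
  · simp only [map_tmul, slice₁_tmul, LinearMap.id_apply]
    rw [hTe, (realBdd_tmul_left w).map_sum]
    refine Finset.sum_congr rfl fun i _ => ?_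
    rw [isBddBilin_tmul.smul_left, isBddBilin_tmul.smul_right]

end CTensor

end

section

variable {V : Type u} [AddCommGroup V] [Module ℂ V] [Bornology V]

/-! ### Multiplication and involution on A ⊗̂ A -/

namespace BornStarAlgebra

open CTensor

variable [CompleteBornSpace V] (𝒜 : BornStarAlgebra V)

@[fun_prop]
theorem realBdd_mul_left (b : V) : IsRealBdd fun a => 𝒜.mul a b := 𝒜.bdd_mul.realBdd_left b

@[fun_prop]
theorem realBdd_mul_right (a : V) : IsRealBdd fun b => 𝒜.mul a b := 𝒜.bdd_mul.realBdd_right a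

@[fun_prop]
theorem realBdd_mulT_left (t : CTensor V V) : IsRealBdd fun s => 𝒜.mulT s t :=
  𝒜.bdd_mulT.realBdd_left t

@[fun_prop]
theorem realBdd_mulT_right (s : CTensor V V) : IsRealBdd fun t => 𝒜.mulT s t :=
  𝒜.bdd_mulT.realBdd_right s

@[fun_prop]
theorem realBdd_mulT₃_left (t : CTensor V (CTensor V V)) : IsRealBdd fun s => 𝒜.mulT₃ s t :=
  𝒜.bdd_mulT₃.realBdd_left t

@[fun_prop]
theorem realBdd_mulT₃_right (s : CTensor V (CTensor V V)) : IsRealBdd fun t => 𝒜.mulT₃ s t :=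
  𝒜.bdd_mulT₃.realBdd_right s

@[fun_prop]
theorem realBdd_star : IsRealBdd fun a => 𝒜.star a :=
  ⟨𝒜.star_add, fun r a => by rw [𝒜.star_smul, Complex.conj_ofReal], 𝒜.star_bdd⟩

@[fun_prop]
theorem realBdd_starT : IsRealBdd fun t => 𝒜.starT t := .of_antilinear _ (lift_bdd _)

@[fun_prop]
theorem realBdd_flipStarT : IsRealBdd fun t => 𝒜.flipStarT t := .of_antilinear _ (lift_bdd _)

@[fun_prop]
theorem realBdd_left₁ (a : V) : IsRealBdd fun t => 𝒜.left₁ a t := .of_linear _ (map_bdd _ _)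

@[fun_prop]
theorem realBdd_left₂ (a : V) : IsRealBdd fun t => 𝒜.left₂ a t := .of_linear _ (map_bdd _ _)

@[fun_prop]
theorem realBdd_right₁ (a : V) : IsRealBdd fun t => 𝒜.right₁ a t := .of_linear _ (map_bdd _ _)

@[fun_prop]
theorem realBdd_right₂ (a : V) : IsRealBdd fun t => 𝒜.right₂ a t := .of_linear _ (map_bdd _ _)

@[simp] theorem mulT_tmul (a b c d : V) :
    𝒜.mulT (tmul a b) (tmul c d) = tmul (𝒜.mul a c) (𝒜.mul b d) := act_tmul _ _ _ _ _ _

@[simp] theorem mulT₃_tmul (a c : V) (s t : CTensor V V) :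
    𝒜.mulT₃ (tmul a s) (tmul c t) = tmul (𝒜.mul a c) (𝒜.mulT s t) := act_tmul _ _ _ _ _ _

@[simp] theorem starT_tmul (a b : V) : 𝒜.starT (tmul a b) = tmul (𝒜.star a) (𝒜.star b) :=
  lift_tmul _ _ _

@[simp] theorem flipStarT_tmul (a b : V) : 𝒜.flipStarT (tmul a b) = tmul (𝒜.star b) (𝒜.star a) :=
  lift_tmul _ _ _

@[simp] theorem left₁_tmul (c a b : V) : 𝒜.left₁ c (tmul a b) = tmul (𝒜.mul c a) b :=
  map_tmul _ _ _ _

@[simp] theorem left₂_tmul (c a b : V) : 𝒜.left₂ c (tmul a b) = tmul a (𝒜.mul c b) :=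
  map_tmul _ _ _ _

@[simp] theorem right₁_tmul (c a b : V) : 𝒜.right₁ c (tmul a b) = tmul (𝒜.mul a c) b :=
  map_tmul _ _ _ _

@[simp] theorem right₂_tmul (c a b : V) : 𝒜.right₂ c (tmul a b) = tmul a (𝒜.mul b c) :=
  map_tmul _ _ _ _

attribute [simp] BornStarAlgebra.star_star BornStarAlgebra.star_mul

@[simp] theorem starT_starT (t : CTensor V V) : 𝒜.starT (𝒜.starT t) = t :=
  ext_tmul (f := fun t => 𝒜.starT (𝒜.starT t)) (g := fun t => t) (by fun_prop) (by fun_prop)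
    (fun v w => by simp) t

@[simp] theorem flipStarT_flipStarT (t : CTensor V V) : 𝒜.flipStarT (𝒜.flipStarT t) = t :=
  ext_tmul (f := fun t => 𝒜.flipStarT (𝒜.flipStarT t)) (g := fun t => t) (by fun_prop)
    (by fun_prop) (fun v w => by simp) t

/-- Bounded biadditive identities on a completed tensor product can be checked on elementary
tensors. -/
theorem _root_.CTensor.ext_tmul₂ {W X Y Z R : Type*} [AddCommGroup W] [Module ℂ W] [Bornology W]
    [AddCommGroup X] [Module ℂ X] [Bornology X] [AddCommGroup Y] [Module ℂ Y] [Bornology Y]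
    [AddCommGroup Z] [Module ℂ Z] [Bornology Z] [AddCommGroup R] [Module ℂ R] [Bornology R]
    [CompleteBornSpace R] {f g : CTensor W X → CTensor Y Z → R}
    (hf : ∀ t, IsRealBdd fun s => f s t) (hf' : ∀ s, IsRealBdd fun t => f s t)
    (hg : ∀ t, IsRealBdd fun s => g s t) (hg' : ∀ s, IsRealBdd fun t => g s t)
    (h : ∀ a b c d, f (tmul a b) (tmul c d) = g (tmul a b) (tmul c d)) (s : CTensor W X)
    (t : CTensor Y Z) : f s t = g s t :=
  ext_tmul (hf t) (hg t) (fun a b => ext_tmul (hf' _) (hg' _) (h a b) t) s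

theorem starT_mulT (s t : CTensor V V) :
    𝒜.starT (𝒜.mulT s t) = 𝒜.mulT (𝒜.starT t) (𝒜.starT s) :=
  ext_tmul₂ (f := fun s t => 𝒜.starT (𝒜.mulT s t))
    (g := fun s t => 𝒜.mulT (𝒜.starT t) (𝒜.starT s)) (by intro; fun_prop) (by intro; fun_prop)
    (by intro; fun_prop) (by intro; fun_prop) (fun a b c d => by simp) s t

theorem mulT_left₁ (c : V) (s t : CTensor V V) :
    𝒜.mulT (𝒜.left₁ c s) t = 𝒜.left₁ c (𝒜.mulT s t) :=
  ext_tmul₂ (f := fun s t => 𝒜.mulT (𝒜.left₁ c s) t) (g := fun s t => 𝒜.left₁ c (𝒜.mulT s t))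
    (by intro; fun_prop) (by intro; fun_prop) (by intro; fun_prop) (by intro; fun_prop)
    (fun _ _ _ _ => by simp [𝒜.mul_assoc]) s t

theorem mulT_left₂ (c : V) (s t : CTensor V V) :
    𝒜.mulT (𝒜.left₂ c s) t = 𝒜.left₂ c (𝒜.mulT s t) :=
  ext_tmul₂ (f := fun s t => 𝒜.mulT (𝒜.left₂ c s) t) (g := fun s t => 𝒜.left₂ c (𝒜.mulT s t))
    (by intro; fun_prop) (by intro; fun_prop) (by intro; fun_prop) (by intro; fun_prop)
    (fun _ _ _ _ => by simp [𝒜.mul_assoc]) s t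

theorem mulT_right₁ (c : V) (s t : CTensor V V) :
    𝒜.mulT (𝒜.right₁ c s) t = 𝒜.mulT s (𝒜.left₁ c t) :=
  ext_tmul₂ (f := fun s t => 𝒜.mulT (𝒜.right₁ c s) t) (g := fun s t => 𝒜.mulT s (𝒜.left₁ c t))
    (by intro; fun_prop) (by intro; fun_prop) (by intro; fun_prop) (by intro; fun_prop)
    (fun _ _ _ _ => by simp [𝒜.mul_assoc]) s t

theorem mulT_right₂ (c : V) (s t : CTensor V V) :
    𝒜.mulT (𝒜.right₂ c s) t = 𝒜.mulT s (𝒜.left₂ c t) :=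
  ext_tmul₂ (f := fun s t => 𝒜.mulT (𝒜.right₂ c s) t) (g := fun s t => 𝒜.mulT s (𝒜.left₂ c t))
    (by intro; fun_prop) (by intro; fun_prop) (by intro; fun_prop) (by intro; fun_prop)
    (fun _ _ _ _ => by simp [𝒜.mul_assoc]) s t

theorem mulT_tmul_right (s : CTensor V V) (a b : V) :
    𝒜.mulT s (tmul a b) = 𝒜.right₁ a (𝒜.right₂ b s) :=
  ext_tmul (f := fun s => 𝒜.mulT s (tmul a b)) (g := fun s => 𝒜.right₁ a (𝒜.right₂ b s))
    (by fun_prop) (by fun_prop) (fun _ _ => by simp) s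

theorem mulT_tmul_left (s : CTensor V V) (a b : V) :
    𝒜.mulT (tmul a b) s = 𝒜.left₁ a (𝒜.left₂ b s) :=
  ext_tmul (f := fun s => 𝒜.mulT (tmul a b) s) (g := fun s => 𝒜.left₁ a (𝒜.left₂ b s))
    (by fun_prop) (by fun_prop) (fun _ _ => by simp) s

theorem right₁_right₂ (a b : V) (s : CTensor V V) :
    𝒜.right₁ a (𝒜.right₂ b s) = 𝒜.right₂ b (𝒜.right₁ a s) :=
  ext_tmul (f := fun s => 𝒜.right₁ a (𝒜.right₂ b s)) (g := fun s => 𝒜.right₂ b (𝒜.right₁ a s))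
    (by fun_prop) (by fun_prop) (fun _ _ => by simp) s

theorem starT_left₁ (c : V) (t : CTensor V V) :
    𝒜.starT (𝒜.left₁ c t) = 𝒜.right₁ (𝒜.star c) (𝒜.starT t) :=
  ext_tmul (f := fun s => 𝒜.starT (𝒜.left₁ c s)) (g := fun s => 𝒜.right₁ (𝒜.star c) (𝒜.starT s))
    (by fun_prop) (by fun_prop) (fun _ _ => by simp) t

theorem starT_left₂ (c : V) (t : CTensor V V) :
    𝒜.starT (𝒜.left₂ c t) = 𝒜.right₂ (𝒜.star c) (𝒜.starT t) :=
  ext_tmul (f := fun s => 𝒜.starT (𝒜.left₂ c s)) (g := fun s => 𝒜.right₂ (𝒜.star c) (𝒜.starT s))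
    (by fun_prop) (by fun_prop) (fun _ _ => by simp) t

theorem starT_right₁ (c : V) (t : CTensor V V) :
    𝒜.starT (𝒜.right₁ c t) = 𝒜.left₁ (𝒜.star c) (𝒜.starT t) :=
  ext_tmul (f := fun s => 𝒜.starT (𝒜.right₁ c s)) (g := fun s => 𝒜.left₁ (𝒜.star c) (𝒜.starT s))
    (by fun_prop) (by fun_prop) (fun _ _ => by simp) t

theorem starT_right₂ (c : V) (t : CTensor V V) :
    𝒜.starT (𝒜.right₂ c t) = 𝒜.left₂ (𝒜.star c) (𝒜.starT t) :=
  ext_tmul (f := fun s => 𝒜.starT (𝒜.right₂ c s)) (g := fun s => 𝒜.left₂ (𝒜.star c) (𝒜.starT s))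
    (by fun_prop) (by fun_prop) (fun _ _ => by simp) t

/-- Positive bounded functionals on a bornological `*`-algebra are hermitian. -/
theorem map_star_of_nonneg {φ : V →ₗ[ℂ] ℂ} (hφ : IsBdd φ)
    (hpos : ∀ a, 0 ≤ (φ (𝒜.mul (𝒜.star a) a)).re ∧ (φ (𝒜.mul (𝒜.star a) a)).im = 0) (a : V) :
    φ (𝒜.star a) = (starRingEnd ℂ) (φ a) := by
  have hr := IsRealBdd.of_linear φ hφ
  refine 𝒜.essential.ext (f := fun a => φ (𝒜.star a)) (g := fun a => (starRingEnd ℂ) (φ a))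
    (hr.comp 𝒜.realBdd_star) hr.conj (fun b c => ?_) a
  have key : ∀ b c : V, φ (𝒜.mul (𝒜.star c) b) = (starRingEnd ℂ) (φ (𝒜.mul (𝒜.star b) c)) := by
    intro b c
    have h0 : ∀ d, (φ (𝒜.mul (𝒜.star d) d)).im = 0 := fun d => (hpos d).2
    -- Polarization: the value at `b + c` compares the imaginary parts of the two cross terms, the
    -- value at `b + i c` their real parts.
    have e1 := h0 (b + c)
    have e2 := h0 (b + Complex.I • c)
    simp only [𝒜.star_add, 𝒜.star_smul, 𝒜.bdd_mul.add_left, 𝒜.bdd_mul.add_right,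
      𝒜.bdd_mul.smul_left, 𝒜.bdd_mul.smul_right, map_add, map_smul, RingHom.id_apply,
      smul_eq_mul, Complex.add_im, Complex.mul_im, Complex.mul_re, Complex.conj_I, Complex.I_re,
      Complex.I_im, Complex.neg_re, Complex.neg_im, h0] at e1 e2
    apply Complex.ext
    · rw [Complex.conj_re]; linarith
    · rw [Complex.conj_im]; linarith
  change φ (𝒜.star (𝒜.mul b c)) = (starRingEnd ℂ) (φ (𝒜.mul b c))
  rw [𝒜.star_mul, key, 𝒜.star_star]

end BornStarAlgebra

end

section

variable {V : Type u} [AddCommGroup V] [Module ℂ V] [Bornology V]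

/-! ### Slices and multiplication in one leg -/

namespace BornStarAlgebra

open CTensor

variable [CompleteBornSpace V] (𝒜 : BornStarAlgebra V) {ω : V →ₗ[ℂ] ℂ} (hω : IsBdd ω)

theorem slice₂_left₁ (c : V) (t : CTensor V V) :
    slice₂ hω (𝒜.left₁ c t) = 𝒜.mul c (slice₂ hω t) :=
  ext_tmul (f := fun t => slice₂ hω (𝒜.left₁ c t)) (g := fun t => 𝒜.mul c (slice₂ hω t))
    (by fun_prop) (by fun_prop) (fun v w => by simp [𝒜.bdd_mul.smul_right]) t

theorem slice₂_right₁ (c : V) (t : CTensor V V) :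
    slice₂ hω (𝒜.right₁ c t) = 𝒜.mul (slice₂ hω t) c :=
  ext_tmul (f := fun t => slice₂ hω (𝒜.right₁ c t)) (g := fun t => 𝒜.mul (slice₂ hω t) c)
    (by fun_prop) (by fun_prop) (fun v w => by simp [𝒜.bdd_mul.smul_left]) t

theorem slice₁_left₂ (c : V) (t : CTensor V V) :
    slice₁ hω (𝒜.left₂ c t) = 𝒜.mul c (slice₁ hω t) :=
  ext_tmul (f := fun t => slice₁ hω (𝒜.left₂ c t)) (g := fun t => 𝒜.mul c (slice₁ hω t))
    (by fun_prop) (by fun_prop) (fun v w => by simp [𝒜.bdd_mul.smul_right]) t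

theorem slice₁_right₂ (c : V) (t : CTensor V V) :
    slice₁ hω (𝒜.right₂ c t) = 𝒜.mul (slice₁ hω t) c :=
  ext_tmul (f := fun t => slice₁ hω (𝒜.right₂ c t)) (g := fun t => 𝒜.mul (slice₁ hω t) c)
    (by fun_prop) (by fun_prop) (fun v w => by simp [𝒜.bdd_mul.smul_left]) t

theorem slice₁_starT {η : V →ₗ[ℂ] ℂ} (hη : IsBdd η)
    (h : ∀ a, η (𝒜.star a) = (starRingEnd ℂ) (ω a)) (t : CTensor V V) :
    slice₁ hη (𝒜.starT t) = 𝒜.star (slice₁ hω t) :=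
  ext_tmul (f := fun t => slice₁ hη (𝒜.starT t)) (g := fun t => 𝒜.star (slice₁ hω t))
    (by fun_prop) (by fun_prop) (fun v w => by simp [𝒜.star_smul, h]) t

theorem slice₂_starT {η : V →ₗ[ℂ] ℂ} (hη : IsBdd η)
    (h : ∀ a, η (𝒜.star a) = (starRingEnd ℂ) (ω a)) (t : CTensor V V) :
    slice₂ hη (𝒜.starT t) = 𝒜.star (slice₂ hω t) :=
  ext_tmul (f := fun t => slice₂ hη (𝒜.starT t)) (g := fun t => 𝒜.star (slice₂ hω t))
    (by fun_prop) (by fun_prop) (fun v w => by simp [𝒜.star_smul, h]) t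

end BornStarAlgebra

/-! ### The four Galois maps -/

namespace Coproduct

open CTensor

variable [CompleteBornSpace V] {𝒜 : BornStarAlgebra V} (Γ : Coproduct 𝒜)

@[fun_prop]
theorem realBdd_γl : IsRealBdd fun t => Γ.γl t := .of_linear _ Γ.γl_bdd

@[fun_prop]
theorem realBdd_ρr : IsRealBdd fun t => Γ.ρr t := .of_linear _ Γ.ρr_bdd

@[fun_prop]
theorem realBdd_γr : IsRealBdd fun t => Γ.γr t := by unfold γr; fun_prop

@[fun_prop]
theorem realBdd_ρl : IsRealBdd fun t => Γ.ρl t := by unfold ρl; fun_prop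

@[fun_prop]
theorem realBdd_Δ_left (t : CTensor V V) : IsRealBdd fun a => (Γ.Δ a).1.1 t :=
  Γ.hom.bdd_left.realBdd_left t

@[fun_prop]
theorem realBdd_Δ_left' (a : V) : IsRealBdd fun t => (Γ.Δ a).1.1 t :=
  Γ.hom.bdd_left.realBdd_right a

theorem γr_smul (c : ℂ) (t : CTensor V V) : Γ.γr (c • t) = c • Γ.γr t := by
  simp [γr]

theorem ρl_smul (c : ℂ) (t : CTensor V V) : Γ.ρl (c • t) = c • Γ.ρl t := by
  simp [ρl]

theorem γr_tmul (a b : V) :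
    Γ.γr (tmul a b) = 𝒜.starT (Γ.ρr (tmul (𝒜.star b) (𝒜.star a))) := by
  rw [γr, 𝒜.flipStarT_tmul]

theorem ρl_tmul (a b : V) :
    Γ.ρl (tmul a b) = 𝒜.starT (Γ.γl (tmul (𝒜.star b) (𝒜.star a))) := by
  rw [ρl, 𝒜.flipStarT_tmul]

/-- The maps `γr` and `ρl` are adjoints of `ρr` and `γl`, so their defining relations are the
adjoints of those relations, by compatibility of Δ with the involution. -/
theorem γr_left (a b : V) (t : CTensor V V) :
    𝒜.mulT (Γ.γr (tmul a b)) t = (Γ.Δ a).1.1 (𝒜.left₂ b t) := by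
  rw [γr_tmul, ← 𝒜.starT_starT t, ← 𝒜.starT_mulT, Γ.ρr_right, Γ.star_right, 𝒜.starT_starT,
    𝒜.starT_right₂, 𝒜.starT_starT, 𝒜.star_star]

theorem γr_right (a b : V) (t : CTensor V V) :
    𝒜.mulT t (Γ.γr (tmul a b)) = 𝒜.right₂ b ((Γ.Δ a).1.2 t) := by
  rw [γr_tmul, ← 𝒜.starT_starT t, ← 𝒜.starT_mulT, Γ.ρr_left, 𝒜.starT_left₂, 𝒜.star_star,
    Γ.star_left, 𝒜.starT_starT]

theorem ρl_left (a b : V) (t : CTensor V V) :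
    𝒜.mulT (Γ.ρl (tmul a b)) t = 𝒜.left₁ a ((Γ.Δ b).1.1 t) := by
  rw [ρl_tmul, ← 𝒜.starT_starT t, ← 𝒜.starT_mulT, Γ.γl_right, 𝒜.starT_right₁, 𝒜.star_star,
    Γ.star_right, 𝒜.starT_starT]

theorem ρl_right (a b : V) (t : CTensor V V) :
    𝒜.mulT t (Γ.ρl (tmul a b)) = (Γ.Δ b).1.2 (𝒜.right₁ a t) := by
  rw [ρl_tmul, ← 𝒜.starT_starT t, ← 𝒜.starT_mulT, Γ.γl_left, Γ.star_left, 𝒜.starT_starT,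
    𝒜.starT_left₁, 𝒜.starT_starT, 𝒜.star_star]

theorem Δ_left_mulT (a : V) (s t : CTensor V V) :
    (Γ.Δ a).1.1 (𝒜.mulT s t) = 𝒜.mulT ((Γ.Δ a).1.1 s) t := (Γ.Δ a).2.2.2.1 s t

end Coproduct

/-! ### Nondegeneracy of A and A ⊗̂ A -/

namespace BornQuantumGroup

open CTensor

variable [CompleteBornSpace V] (𝔾 : BornQuantumGroup V)

theorem φ_star (a : V) : 𝔾.φ (𝔾.star a) = (starRingEnd ℂ) (𝔾.φ a) :=
  𝔾.map_star_of_nonneg 𝔾.φ_bdd 𝔾.φ_pos a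

@[fun_prop]
theorem realBdd_φ : IsRealBdd fun a => 𝔾.φ a := .of_linear _ 𝔾.φ_bdd

@[fun_prop]
theorem realBdd_ε : IsRealBdd fun a => 𝔾.ε a := .of_linear _ 𝔾.ε_bdd

@[fun_prop]
theorem realBdd_S : IsRealBdd fun a => 𝔾.S a := .of_linear _ 𝔾.S_bdd

@[fun_prop]
theorem realBdd_S_symm : IsRealBdd fun a => 𝔾.S.symm a := .of_linear _ 𝔾.S_symm_bdd

theorem fourier_bdd : IsBdd 𝔾.fourier := fun s hs => by
  rw [isBounded_dual, ← image_comp]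
  simpa using hs

theorem fourier_symm_bdd : IsBdd 𝔾.fourier.symm := fun _ hs => 𝔾.isBounded_dual.1 hs

@[fun_prop]
theorem realBdd_fourier : IsRealBdd fun a => 𝔾.fourier a :=
  .of_linear 𝔾.fourier.toLinearMap 𝔾.fourier_bdd

@[fun_prop]
theorem realBdd_fourier_symm : IsRealBdd fun a => 𝔾.fourier.symm a :=
  .of_linear 𝔾.fourier.symm.toLinearMap 𝔾.fourier_symm_bdd

/-- An element of the dual as a linear functional. -/
noncomputable def evL (x : 𝔾.Dual) : V →ₗ[ℂ] ℂ := x.1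

@[simp] theorem evL_apply (x : 𝔾.Dual) (a : V) : 𝔾.evL x a = 𝔾.ev x a := rfl

theorem ev_eq (x : 𝔾.Dual) (a : V) : 𝔾.ev x a = 𝔾.φ (𝔾.mul a (𝔾.fourier.symm x)) := by
  rw [← ev_fourier, LinearEquiv.apply_symm_apply]

theorem bdd_evL (x : 𝔾.Dual) : IsBdd (𝔾.evL x) := by
  have h : IsRealBdd fun a => 𝔾.φ (𝔾.mul a (𝔾.fourier.symm x)) := by fun_prop
  have e : (fun a => 𝔾.evL x a) = fun a => 𝔾.φ (𝔾.mul a (𝔾.fourier.symm x)) :=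
    funext fun a => 𝔾.ev_eq x a
  have := h.bdd
  rwa [← e] at this

@[fun_prop]
theorem realBdd_ev_right (x : 𝔾.Dual) : IsRealBdd fun a => 𝔾.ev x a :=
  .of_linear (𝔾.evL x) (𝔾.bdd_evL x)

@[fun_prop]
theorem realBdd_ev_left (a : V) : IsRealBdd fun x => 𝔾.ev x a := by
  simp only [ev_eq]
  fun_prop

theorem ev_ext {x y : 𝔾.Dual} (h : ∀ a, 𝔾.ev x a = 𝔾.ev y a) : x = y :=
  Subtype.ext (LinearMap.ext h)

theorem eq_zero_of_φ_mul_left {a : V} (h : ∀ c, 𝔾.φ (𝔾.mul c a) = 0) : a = 0 :=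
  𝔾.φ_faithful a (h _)

theorem eq_zero_of_φ_mul_right {a : V} (h : ∀ c, 𝔾.φ (𝔾.mul a c) = 0) : a = 0 := by
  have := 𝔾.φ_faithful (𝔾.star a) (by rw [𝔾.star_star]; exact h _)
  rw [← 𝔾.star_star a, this]
  exact 𝔾.realBdd_star.map_zero

theorem eq_of_φ_mul_left {a b : V} (h : ∀ c, 𝔾.φ (𝔾.mul c a) = 𝔾.φ (𝔾.mul c b)) : a = b :=
  sub_eq_zero.1 (𝔾.eq_zero_of_φ_mul_left fun c => by
    rw [(𝔾.realBdd_mul_right c).map_sub, map_sub, h, sub_self])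

theorem eq_of_φ_mul_right {a b : V} (h : ∀ c, 𝔾.φ (𝔾.mul a c) = 𝔾.φ (𝔾.mul b c)) : a = b :=
  sub_eq_zero.1 (𝔾.eq_zero_of_φ_mul_right fun c => by
    rw [(𝔾.realBdd_mul_left c).map_sub, map_sub, h, sub_self])

theorem eq_of_mul_left {a b : V} (h : ∀ c, 𝔾.mul c a = 𝔾.mul c b) : a = b :=
  𝔾.eq_of_φ_mul_left fun c => by rw [h]

theorem eq_of_mul_right {a b : V} (h : ∀ c, 𝔾.mul a c = 𝔾.mul b c) : a = b :=
  𝔾.eq_of_φ_mul_right fun c => by rw [h]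

theorem eq_of_ev {a b : V} (h : ∀ x, 𝔾.ev x a = 𝔾.ev x b) : a = b :=
  𝔾.eq_of_φ_mul_right fun c => h (𝔾.fourier c)

theorem slice₂_right₂ (g : V) (t : CTensor V V) :
    slice₂ 𝔾.φ_bdd (𝔾.right₂ g t) = slice₂ (𝔾.bdd_evL (𝔾.fourier g)) t :=
  ext_tmul (f := fun t => slice₂ 𝔾.φ_bdd (𝔾.right₂ g t)) (by fun_prop) (by fun_prop)
    (fun v w => by simp [ev_fourier]) t

theorem slice₁_right₁ (g : V) (t : CTensor V V) :
    slice₁ 𝔾.φ_bdd (𝔾.right₁ g t) = slice₁ (𝔾.bdd_evL (𝔾.fourier g)) t :=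
  ext_tmul (f := fun t => slice₁ 𝔾.φ_bdd (𝔾.right₁ g t)) (by fun_prop) (by fun_prop)
    (fun v w => by simp [ev_fourier]) t

/-- Faithfulness makes the elements of the dual separate the points of A; the approximation property
lifts this to A ⊗̂ A. -/
theorem eq_of_slice₂_ev {s t : CTensor V V}
    (h : ∀ x, slice₂ (𝔾.bdd_evL x) s = slice₂ (𝔾.bdd_evL x) t) : s = t := by
  refine sub_eq_zero.1 (eq_zero_of_slice₂ 𝔾.approximation 𝔾.evL 𝔾.bdd_evL (fun w hw => ?_) _
    fun x => by rw [map_sub, h, sub_self])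
  exact 𝔾.eq_of_ev fun x => (hw x).trans (𝔾.realBdd_ev_right x).map_zero.symm

/-- Slicing with `𝔉 g` is right multiplication by 1 ⊗ g followed by integration, and the slice is in
turn determined by its right multiples. Hence products with elementary tensors see all slices. -/
theorem eq_of_mulT_tmul_right {s t : CTensor V V}
    (h : ∀ a b, 𝔾.mulT s (tmul a b) = 𝔾.mulT t (tmul a b)) : s = t := by
  refine 𝔾.eq_of_slice₂_ev fun x => 𝔾.eq_of_mul_right fun c => ?_
  obtain ⟨g, rfl⟩ := 𝔾.fourier.surjective x
  rw [← 𝔾.slice₂_right₁, ← 𝔾.slice₂_right₁, ← slice₂_right₂, ← slice₂_right₂, ← 𝔾.right₁_right₂,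
    ← 𝔾.right₁_right₂, ← 𝔾.mulT_tmul_right, ← 𝔾.mulT_tmul_right, h]

theorem eq_of_mulT_right {s t : CTensor V V} (h : ∀ r, 𝔾.mulT s r = 𝔾.mulT t r) : s = t :=
  𝔾.eq_of_mulT_tmul_right fun _ _ => h _

theorem eq_of_right₁ {s t : CTensor V V} (h : ∀ c, 𝔾.right₁ c s = 𝔾.right₁ c t) : s = t :=
  𝔾.eq_of_mulT_tmul_right fun a b => by
    rw [𝔾.mulT_tmul_right, 𝔾.mulT_tmul_right, 𝔾.right₁_right₂, 𝔾.right₁_right₂, h]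

/-- Here, as in the analogous rules that follow, associativity in the multiplier algebra becomes an
identity between Galois maps. It is checked after multiplication by an element of A ⊗̂ A, where the
multiplier Δ(a) acts. -/
theorem left₁_γr (c a g : V) :
    𝔾.left₁ c (𝔾.Γ.γr (tmul a g)) = 𝔾.right₂ g (𝔾.Γ.ρl (tmul c a)) :=
  𝔾.eq_of_mulT_right fun r => by
    rw [𝔾.mulT_left₁, 𝔾.Γ.γr_left, 𝔾.mulT_right₂, 𝔾.Γ.ρl_left]

theorem right₂_γl (g a c : V) :
    𝔾.right₂ g (𝔾.Γ.γl (tmul a c)) = 𝔾.right₁ c (𝔾.Γ.γr (tmul a g)) :=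
  𝔾.eq_of_mulT_tmul_right fun r s => by
    rw [𝔾.mulT_right₂, 𝔾.mulT_right₁, 𝔾.Γ.γl_left, 𝔾.Γ.γr_left]; simp

theorem left₁_γl (c a b : V) :
    𝔾.left₁ c (𝔾.Γ.γl (tmul a b)) = 𝔾.right₁ b (𝔾.Γ.ρl (tmul c a)) :=
  𝔾.eq_of_mulT_right fun r => by
    rw [𝔾.mulT_left₁, 𝔾.Γ.γl_left, 𝔾.mulT_right₁, 𝔾.Γ.ρl_left]

theorem left₂_γr (c a b : V) :
    𝔾.left₂ c (𝔾.Γ.γr (tmul a b)) = 𝔾.right₂ b (𝔾.Γ.ρr (tmul c a)) :=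
  𝔾.eq_of_mulT_right fun r => by
    rw [𝔾.mulT_left₂, 𝔾.Γ.γr_left, 𝔾.mulT_right₂, 𝔾.Γ.ρr_left]

theorem left₁_left₂ (a b : V) (s : CTensor V V) :
    𝔾.left₁ a (𝔾.left₂ b s) = 𝔾.left₂ b (𝔾.left₁ a s) :=
  ext_tmul (f := fun s => 𝔾.left₁ a (𝔾.left₂ b s)) (g := fun s => 𝔾.left₂ b (𝔾.left₁ a s))
    (by fun_prop) (by fun_prop) (fun _ _ => by simp) s

theorem left₁_ρr (c b a : V) :
    𝔾.left₁ c (𝔾.Γ.ρr (tmul b a)) = 𝔾.left₂ b (𝔾.Γ.ρl (tmul c a)) :=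
  𝔾.eq_of_mulT_right fun r => by
    rw [𝔾.mulT_left₁, 𝔾.Γ.ρr_left, 𝔾.mulT_left₂, 𝔾.Γ.ρl_left, left₁_left₂]

theorem left₂_γl (c a b : V) :
    𝔾.left₂ c (𝔾.Γ.γl (tmul a b)) = 𝔾.right₁ b (𝔾.Γ.ρr (tmul c a)) :=
  𝔾.eq_of_mulT_right fun r => by
    rw [𝔾.mulT_left₂, 𝔾.Γ.γl_left, 𝔾.mulT_right₁, 𝔾.Γ.ρr_left]

theorem γl_mul (a b c : V) :
    𝔾.Γ.γl (tmul a (𝔾.mul b c)) = 𝔾.right₁ c (𝔾.Γ.γl (tmul a b)) :=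
  𝔾.eq_of_mulT_tmul_right fun r s => by
    rw [𝔾.Γ.γl_left, 𝔾.mulT_right₁, 𝔾.Γ.γl_left]; simp [𝔾.mul_assoc]

theorem γr_mul (a b c : V) :
    𝔾.Γ.γr (tmul a (𝔾.mul b c)) = 𝔾.right₂ c (𝔾.Γ.γr (tmul a b)) :=
  𝔾.eq_of_mulT_tmul_right fun r s => by
    rw [𝔾.Γ.γr_left, 𝔾.mulT_right₂, 𝔾.Γ.γr_left]; simp [𝔾.mul_assoc]

theorem ρr_mul (a b c : V) :
    𝔾.Γ.ρr (tmul (𝔾.mul a b) c) = 𝔾.left₂ a (𝔾.Γ.ρr (tmul b c)) :=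
  𝔾.eq_of_mulT_right fun r => by
    rw [𝔾.Γ.ρr_left, 𝔾.mulT_left₂, 𝔾.Γ.ρr_left]
    exact ext_tmul (f := fun t => 𝔾.left₂ (𝔾.mul a b) t)
      (g := fun t => 𝔾.left₂ a (𝔾.left₂ b t)) (by fun_prop) (by fun_prop)
      (fun _ _ => by simp [𝔾.mul_assoc]) _

theorem Δ_left_tmul (a b c : V) :
    (𝔾.Γ.Δ a).1.1 (tmul b c) = 𝔾.right₂ c (𝔾.Γ.γl (tmul a b)) :=
  𝔾.eq_of_mulT_tmul_right fun r s => by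
    rw [← 𝔾.Γ.Δ_left_mulT, 𝔾.mulT_right₂, 𝔾.Γ.γl_left]; simp

theorem Δ_left_tmul' (a b c : V) :
    (𝔾.Γ.Δ a).1.1 (tmul b c) = 𝔾.right₁ b (𝔾.Γ.γr (tmul a c)) := by
  rw [Δ_left_tmul, right₂_γl]

theorem Δ_left_γl (a b c : V) :
    (𝔾.Γ.Δ a).1.1 (𝔾.Γ.γl (tmul b c)) = 𝔾.Γ.γl (tmul (𝔾.mul a b) c) :=
  𝔾.eq_of_mulT_right fun r => by
    rw [← 𝔾.Γ.Δ_left_mulT, 𝔾.Γ.γl_left, 𝔾.Γ.γl_left, 𝔾.Γ.hom.map_mul_left]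

/-! ### Slices of the coproduct -/

theorem dualLeft_fourier (g a : V) :
    𝔾.dualLeft (𝔾.fourier g) a = slice₂ 𝔾.φ_bdd (𝔾.Γ.γr (tmul a g)) := by
  rw [dualLeft, LinearEquiv.symm_apply_apply]

theorem dualRight_fourier (g a : V) :
    𝔾.dualRight (𝔾.fourier g) a = slice₁ 𝔾.φ_bdd (𝔾.Γ.γl (tmul a g)) := by
  rw [dualRight, LinearEquiv.symm_apply_apply]

@[fun_prop]
theorem realBdd_dualLeft (x : 𝔾.Dual) : IsRealBdd fun a => 𝔾.dualLeft x a := by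
  unfold dualLeft; fun_prop

@[fun_prop]
theorem realBdd_dualLeft' (a : V) : IsRealBdd fun x => 𝔾.dualLeft x a := by
  unfold dualLeft; fun_prop

/-- `a ↦ (ι ⊗ x)(Δ(a))` as a linear map. -/
noncomputable def dualLeftL (x : 𝔾.Dual) : V →ₗ[ℂ] V where
  toFun := 𝔾.dualLeft x
  map_add' := (𝔾.realBdd_dualLeft x).map_add
  map_smul' c a := by
    rw [dualLeft, isBddBilin_tmul.smul_left, RingHom.id_apply, 𝔾.Γ.γr_smul, map_smul]
    rfl

@[simp] theorem dualLeftL_apply (x : 𝔾.Dual) (a : V) : 𝔾.dualLeftL x a = 𝔾.dualLeft x a := rfl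

theorem dualLeftL_bdd (x : 𝔾.Dual) : IsBdd (𝔾.dualLeftL x) := (𝔾.realBdd_dualLeft x).bdd

/-- A factor `c` frees the slice from the representative of `x`: only the functional `x` enters.
Behaviour under the involution and the antipode is derived from this form. -/
theorem mul_dualLeft (c : V) (x : 𝔾.Dual) (a : V) :
    𝔾.mul c (𝔾.dualLeft x a) = slice₂ (𝔾.bdd_evL x) (𝔾.Γ.ρl (tmul c a)) := by
  obtain ⟨g, rfl⟩ := 𝔾.fourier.surjective x
  rw [dualLeft_fourier, ← 𝔾.slice₂_left₁, left₁_γr, slice₂_right₂]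

theorem dualLeft_mul (x : 𝔾.Dual) (a c : V) :
    𝔾.mul (𝔾.dualLeft x a) c = slice₂ (𝔾.bdd_evL x) (𝔾.Γ.γl (tmul a c)) := by
  obtain ⟨g, rfl⟩ := 𝔾.fourier.surjective x
  rw [dualLeft_fourier, ← 𝔾.slice₂_right₁, ← right₂_γl, slice₂_right₂]

theorem mul_dualRight (c : V) (x : 𝔾.Dual) (a : V) :
    𝔾.mul c (𝔾.dualRight x a) = slice₁ (𝔾.bdd_evL x) (𝔾.Γ.ρr (tmul c a)) := by
  obtain ⟨g, rfl⟩ := 𝔾.fourier.surjective x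
  rw [dualRight_fourier, ← 𝔾.slice₁_left₂, left₂_γl, slice₁_right₁]

theorem dualRight_mul (x : 𝔾.Dual) (a c : V) :
    𝔾.mul (𝔾.dualRight x a) c = slice₁ (𝔾.bdd_evL x) (𝔾.Γ.γr (tmul a c)) := by
  obtain ⟨g, rfl⟩ := 𝔾.fourier.surjective x
  rw [dualRight_fourier, ← 𝔾.slice₁_right₂, right₂_γl, slice₁_right₁]

/-- Both sides are (x ⊗ y)(Δ(a)), integrated in the two orders. -/
theorem ev_dualLeft (x y : 𝔾.Dual) (a : V) : 𝔾.ev x (𝔾.dualLeft y a) = 𝔾.ev y (𝔾.dualRight x a) := by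
  obtain ⟨f, rfl⟩ := 𝔾.fourier.surjective x
  obtain ⟨g, rfl⟩ := 𝔾.fourier.surjective y
  rw [ev_fourier, ev_fourier, dualLeft_mul, dualRight_mul, ← slice₂_right₂, ← slice₁_right₁,
    slice_comm 𝔾.φ_bdd 𝔾.φ_bdd, right₂_γl]

end BornQuantumGroup

end

section

variable {V : Type u} [AddCommGroup V] [Module ℂ V] [Bornology V]

namespace BornQuantumGroup

open CTensor

variable [CompleteBornSpace V] (𝔾 : BornQuantumGroup V)

/-! ### Coassociativity -/

/-- The hypothesis says m = (ι ⊗ Δ)(Δ(a)). By essentiality `z` may be taken of the form pr ⊗ Δ(q)s;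
then p and q move into the argument of ι ⊗ Δ, and Δ(a)(f ⊗ 1) times p ⊗ q is Δ(a) applied to an
honest tensor. -/
theorem coassoc_γl {a : V} {m : multipliers 𝔾.bdd_mulT₃}
    (hm : ∀ t z, m.1.1 (act 𝔾.bdd_mul 𝔾.Γ.hom.bdd_left t z) =
      act 𝔾.bdd_mul 𝔾.Γ.hom.bdd_left ((𝔾.Γ.Δ a).1.1 t) z) (f : V)
    (z : CTensor V (CTensor V V)) :
    act 𝔾.bdd_mul 𝔾.Γ.hom.bdd_left (𝔾.Γ.γl (tmul a f)) z =
      m.1.1 (map (g := LinearMap.id) (𝔾.bdd_mulLeft f) IsBdd.id z) := by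
  have hmr : IsRealBdd fun z => m.1.1 z := .of_linear _ m.2.1
  have key : ∀ p q r s, act 𝔾.bdd_mul 𝔾.Γ.hom.bdd_left (𝔾.Γ.γl (tmul a f))
      (tmul (𝔾.mul p r) ((𝔾.Γ.Δ q).1.1 s)) = m.1.1 (map (g := LinearMap.id) (𝔾.bdd_mulLeft f)
        IsBdd.id (tmul (𝔾.mul p r) ((𝔾.Γ.Δ q).1.1 s))) := by
    intro p q r s
    have h1 : ∀ u : CTensor V V, act 𝔾.bdd_mul 𝔾.Γ.hom.bdd_left u
        (tmul (𝔾.mul p r) ((𝔾.Γ.Δ q).1.1 s)) =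
        act 𝔾.bdd_mul 𝔾.Γ.hom.bdd_left (𝔾.right₁ p (𝔾.right₂ q u)) (tmul r s) := fun u =>
      ext_tmul (f := fun u => act 𝔾.bdd_mul 𝔾.Γ.hom.bdd_left u
          (tmul (𝔾.mul p r) ((𝔾.Γ.Δ q).1.1 s)))
        (g := fun u => act 𝔾.bdd_mul 𝔾.Γ.hom.bdd_left (𝔾.right₁ p (𝔾.right₂ q u)) (tmul r s))
        (by fun_prop) (by fun_prop)
        (fun b c => by simp [act_tmul, 𝔾.mul_assoc, 𝔾.Γ.hom.map_mul_left]) u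
    rw [h1, 𝔾.right₁_right₂, ← 𝔾.γl_mul, ← 𝔾.Δ_left_tmul, ← hm, act_tmul, map_tmul]
    change _ = m.1.1 (tmul (𝔾.mul f (𝔾.mul p r)) ((𝔾.Γ.Δ q).1.1 s))
    rw [𝔾.mul_assoc]
  refine ext_tmul (f := fun z => act 𝔾.bdd_mul 𝔾.Γ.hom.bdd_left (𝔾.Γ.γl (tmul a f)) z)
    (g := fun z => m.1.1 (map (g := LinearMap.id) (𝔾.bdd_mulLeft f) IsBdd.id z))
    (by fun_prop) (hmr.comp (realBdd_map _ _)) (fun v s => ?_) z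
  refine 𝔾.essential.ext (f := fun v => act 𝔾.bdd_mul 𝔾.Γ.hom.bdd_left (𝔾.Γ.γl (tmul a f))
      (tmul v s)) (g := fun v => m.1.1 (map (g := LinearMap.id) (𝔾.bdd_mulLeft f) IsBdd.id
      (tmul v s))) (by fun_prop) (hmr.comp (by fun_prop)) (fun p r => ?_) v
  exact 𝔾.Γ.hom.essential_left.ext (f := fun s => act 𝔾.bdd_mul 𝔾.Γ.hom.bdd_left
      (𝔾.Γ.γl (tmul a f)) (tmul (𝔾.mul p r) s)) (g := fun s => m.1.1 (map (g := LinearMap.id)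
      (𝔾.bdd_mulLeft f) IsBdd.id (tmul (𝔾.mul p r) s))) (by fun_prop) (hmr.comp (by fun_prop))
      (fun q s => key p q r s) s

theorem coassoc_γr {a : V} {m : multipliers 𝔾.bdd_mulT₃}
    (hm : ∀ t z, m.1.1 (assoc V V V (act 𝔾.Γ.hom.bdd_left 𝔾.bdd_mul t z)) =
      assoc V V V (act 𝔾.Γ.hom.bdd_left 𝔾.bdd_mul ((𝔾.Γ.Δ a).1.1 t) z)) (g : V)
    (z : CTensor (CTensor V V) V) :
    assoc V V V (act 𝔾.Γ.hom.bdd_left 𝔾.bdd_mul (𝔾.Γ.γr (tmul a g)) z) =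
      m.1.1 (assoc V V V (map (f := LinearMap.id) IsBdd.id (𝔾.bdd_mulLeft g) z)) := by
  have hmr : IsRealBdd fun z => m.1.1 z := .of_linear _ m.2.1
  have key : ∀ p s q r, assoc V V V (act 𝔾.Γ.hom.bdd_left 𝔾.bdd_mul (𝔾.Γ.γr (tmul a g))
      (tmul ((𝔾.Γ.Δ p).1.1 s) (𝔾.mul q r))) = m.1.1 (assoc V V V (map (f := LinearMap.id) IsBdd.id
        (𝔾.bdd_mulLeft g) (tmul ((𝔾.Γ.Δ p).1.1 s) (𝔾.mul q r)))) := by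
    intro p s q r
    have h1 : ∀ u : CTensor V V, act 𝔾.Γ.hom.bdd_left 𝔾.bdd_mul u
        (tmul ((𝔾.Γ.Δ p).1.1 s) (𝔾.mul q r)) =
        act 𝔾.Γ.hom.bdd_left 𝔾.bdd_mul (𝔾.right₁ p (𝔾.right₂ q u)) (tmul s r) := fun u =>
      ext_tmul (f := fun u => act 𝔾.Γ.hom.bdd_left 𝔾.bdd_mul u
          (tmul ((𝔾.Γ.Δ p).1.1 s) (𝔾.mul q r)))
        (g := fun u => act 𝔾.Γ.hom.bdd_left 𝔾.bdd_mul (𝔾.right₁ p (𝔾.right₂ q u)) (tmul s r))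
        (by fun_prop) (by fun_prop)
        (fun b c => by simp [act_tmul, 𝔾.mul_assoc, 𝔾.Γ.hom.map_mul_left]) u
    rw [h1, ← 𝔾.γr_mul, ← 𝔾.Δ_left_tmul', ← hm, act_tmul, map_tmul]
    change _ = m.1.1 (assoc V V V (tmul ((𝔾.Γ.Δ p).1.1 s) (𝔾.mul g (𝔾.mul q r))))
    rw [𝔾.mul_assoc]
  refine ext_tmul (f := fun z => assoc V V V (act 𝔾.Γ.hom.bdd_left 𝔾.bdd_mul
      (𝔾.Γ.γr (tmul a g)) z)) (g := fun z => m.1.1 (assoc V V V (map (f := LinearMap.id) IsBdd.id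
      (𝔾.bdd_mulLeft g) z))) (by fun_prop) (hmr.comp (by fun_prop)) (fun s v => ?_) z
  refine 𝔾.essential.ext (f := fun v => assoc V V V (act 𝔾.Γ.hom.bdd_left 𝔾.bdd_mul
      (𝔾.Γ.γr (tmul a g)) (tmul s v))) (g := fun v => m.1.1 (assoc V V V (map (f := LinearMap.id)
      IsBdd.id (𝔾.bdd_mulLeft g) (tmul s v)))) (by fun_prop) (hmr.comp (by fun_prop))
      (fun q r => ?_) v
  exact 𝔾.Γ.hom.essential_left.ext (f := fun s => assoc V V V (act 𝔾.Γ.hom.bdd_left 𝔾.bdd_mul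
      (𝔾.Γ.γr (tmul a g)) (tmul s (𝔾.mul q r)))) (g := fun s => m.1.1 (assoc V V V
      (map (f := LinearMap.id) IsBdd.id (𝔾.bdd_mulLeft g) (tmul s (𝔾.mul q r)))))
      (by fun_prop) (hmr.comp (by fun_prop)) (fun p s => key p s q r) s

/-- The map `ι ⊗ (ι ⊗ φ)`. -/
noncomputable def sliceLast : CTensor V (CTensor V V) →ₗ[ℂ] CTensor V V :=
  map (f := LinearMap.id) (g := slice₂ 𝔾.φ_bdd) IsBdd.id (lift_bdd _)

@[fun_prop]
theorem realBdd_sliceLast : IsRealBdd fun z => 𝔾.sliceLast z := realBdd_map _ _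

@[simp] theorem sliceLast_tmul (a : V) (s : CTensor V V) :
    𝔾.sliceLast (tmul a s) = tmul a (slice₂ 𝔾.φ_bdd s) := map_tmul _ _ _ _

theorem sliceLast_assoc (s : CTensor V V) (v : V) :
    𝔾.sliceLast (assoc V V V (tmul s v)) = 𝔾.φ v • s :=
  ext_tmul (f := fun s => 𝔾.sliceLast (assoc V V V (tmul s v))) (g := fun s => 𝔾.φ v • s)
    (by fun_prop) (by fun_prop) (fun a b => by
      simp only [assoc_tmul_tmul, sliceLast_tmul, slice₂_tmul, isBddBilin_tmul.smul_right,
        RingHom.id_apply]) s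

/-- Coassociativity: `Δ((ι ⊗ x)(Δ(a))) = (ι ⊗ ι ⊗ x)(ι ⊗ Δ)(Δ(a))`. -/
theorem γl_dualLeft (x : 𝔾.Dual) (a f : V) :
    𝔾.Γ.γl (tmul (𝔾.dualLeft x a) f) =
      map (f := LinearMap.id) IsBdd.id (𝔾.dualLeftL_bdd x) (𝔾.Γ.γl (tmul a f)) := by
  obtain ⟨m, h1, -, h3, -⟩ := 𝔾.Γ.coassoc a
  obtain ⟨c, rfl⟩ := 𝔾.fourier.surjective x
  refine 𝔾.eq_of_mulT_tmul_right fun r s => ?_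
  -- Putting `c` in the third leg and integrating there realizes the slice by 𝔉(c) after ι ⊗ Δ.
  have hl : ∀ u, 𝔾.sliceLast (act 𝔾.bdd_mul 𝔾.Γ.hom.bdd_left u (tmul r (tmul s c))) =
      𝔾.mulT (map (f := LinearMap.id) IsBdd.id (𝔾.dualLeftL_bdd (𝔾.fourier c)) u) (tmul r s) :=
    fun u => ext_tmul
      (f := fun u => 𝔾.sliceLast (act 𝔾.bdd_mul 𝔾.Γ.hom.bdd_left u (tmul r (tmul s c))))
      (g := fun u => 𝔾.mulT (map (f := LinearMap.id) IsBdd.id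
        (𝔾.dualLeftL_bdd (𝔾.fourier c)) u) (tmul r s))
      (by fun_prop) (by fun_prop) (fun p q => by
        rw [act_tmul, sliceLast_tmul, Δ_left_tmul', 𝔾.slice₂_right₁, ← dualLeft_fourier]
        simp) u
  rw [← hl, 𝔾.mulT_tmul_right, 𝔾.right₁_right₂, ← γl_mul, ← Δ_left_tmul]
  -- The third leg is factored as `g v`: the factor `g` turns Δ(a) into an element of A ⊗̂ A, as
  -- `coassoc_γr` needs, and `v` is kept for the integration.
  refine 𝔾.essential.ext
    (f := fun c => (𝔾.Γ.Δ (𝔾.dualLeft (𝔾.fourier c) a)).1.1 (tmul (𝔾.mul f r) s))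
    (g := fun c => 𝔾.sliceLast (act 𝔾.bdd_mul 𝔾.Γ.hom.bdd_left (𝔾.Γ.γl (tmul a f))
      (tmul r (tmul s c)))) ?_ (by fun_prop) (fun g v => ?_) c
  · exact (𝔾.Γ.realBdd_Δ_left _).comp ((𝔾.realBdd_dualLeft' a).comp 𝔾.realBdd_fourier)
  have hr : ∀ w, 𝔾.sliceLast (assoc V V V (act 𝔾.Γ.hom.bdd_left 𝔾.bdd_mul w
      (tmul (tmul (𝔾.mul f r) s) v))) =
      (𝔾.Γ.Δ (slice₂ (𝔾.bdd_evL (𝔾.fourier v)) w)).1.1 (tmul (𝔾.mul f r) s) := fun w =>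
    ext_tmul (f := fun w => 𝔾.sliceLast (assoc V V V (act 𝔾.Γ.hom.bdd_left 𝔾.bdd_mul w
      (tmul (tmul (𝔾.mul f r) s) v))))
      (g := fun w => (𝔾.Γ.Δ (slice₂ (𝔾.bdd_evL (𝔾.fourier v)) w)).1.1 (tmul (𝔾.mul f r) s))
      (by fun_prop) ((𝔾.Γ.realBdd_Δ_left _).comp (realBdd_slice₂ _)) (fun p q => by
        rw [act_tmul, sliceLast_assoc, slice₂_tmul, map_smul]
        rfl) w
  change (𝔾.Γ.Δ (𝔾.dualLeft (𝔾.fourier (𝔾.mul g v)) a)).1.1 (tmul (𝔾.mul f r) s) =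
    𝔾.sliceLast (act 𝔾.bdd_mul 𝔾.Γ.hom.bdd_left (𝔾.Γ.γl (tmul a f))
      (tmul r (tmul s (𝔾.mul g v))))
  rw [coassoc_γl _ h1, map_tmul]
  -- One and the same tensor carries `f` in the first leg and `g` in the third. This is where the
  -- two descriptions of the multiplier `m` meet.
  have e : (tmul (𝔾.mulLeft f r) (LinearMap.id (R := ℂ) (tmul s (𝔾.mul g v))) :
      CTensor V (CTensor V V)) = assoc V V V (map (f := LinearMap.id) IsBdd.id (𝔾.bdd_mulLeft g)
        (tmul (tmul (𝔾.mul f r) s) v)) := by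
    rw [map_tmul, LinearMap.id_apply, LinearMap.id_apply, assoc_tmul_tmul]; rfl
  rw [e, ← coassoc_γr _ h3, hr, ← slice₂_right₂, ← γr_mul, dualLeft_fourier]

theorem ρl_dualLeft (x : 𝔾.Dual) (c a : V) :
    𝔾.Γ.ρl (tmul c (𝔾.dualLeft x a)) =
      map (f := LinearMap.id) IsBdd.id (𝔾.dualLeftL_bdd x) (𝔾.Γ.ρl (tmul c a)) := by
  refine 𝔾.eq_of_right₁ fun d => ?_
  have h₁ : ∀ u, 𝔾.left₁ c (map (f := LinearMap.id) IsBdd.id (𝔾.dualLeftL_bdd x) u) =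
      map (f := LinearMap.id) IsBdd.id (𝔾.dualLeftL_bdd x) (𝔾.left₁ c u) := fun u =>
    ext_tmul (f := fun u => 𝔾.left₁ c (map (f := LinearMap.id) IsBdd.id (𝔾.dualLeftL_bdd x) u))
      (g := fun u => map (f := LinearMap.id) IsBdd.id (𝔾.dualLeftL_bdd x) (𝔾.left₁ c u))
      (by fun_prop) (by fun_prop) (fun p q => by simp) u
  have h₂ : ∀ u, 𝔾.right₁ d (map (f := LinearMap.id) IsBdd.id (𝔾.dualLeftL_bdd x) u) =
      map (f := LinearMap.id) IsBdd.id (𝔾.dualLeftL_bdd x) (𝔾.right₁ d u) := fun u =>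
    ext_tmul (f := fun u => 𝔾.right₁ d (map (f := LinearMap.id) IsBdd.id (𝔾.dualLeftL_bdd x) u))
      (g := fun u => map (f := LinearMap.id) IsBdd.id (𝔾.dualLeftL_bdd x) (𝔾.right₁ d u))
      (by fun_prop) (by fun_prop) (fun p q => by simp) u
  rw [← left₁_γl, γl_dualLeft, h₁, left₁_γl, h₂]

/-- The usable form of coassociativity: both sides are x ⊗ ι ⊗ y applied to the iterated coproduct.
-/
theorem dualRight_dualLeft (x y : 𝔾.Dual) (a : V) :
    𝔾.dualRight x (𝔾.dualLeft y a) = 𝔾.dualLeft y (𝔾.dualRight x a) := by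
  obtain ⟨f, rfl⟩ := 𝔾.fourier.surjective x
  rw [dualRight_fourier, γl_dualLeft, dualRight_fourier]
  exact ext_tmul (f := fun u => slice₁ 𝔾.φ_bdd (map (f := LinearMap.id) IsBdd.id
    (𝔾.dualLeftL_bdd y) u)) (g := fun u => 𝔾.dualLeft y (slice₁ 𝔾.φ_bdd u))
    (by fun_prop) (by fun_prop) (fun p q => by
      simp only [map_tmul, slice₁_tmul, LinearMap.id_apply, ← dualLeftL_apply, map_smul]) _

/-! ### The counit and the antipode -/

theorem ε_dualLeft (x : 𝔾.Dual) (a : V) : 𝔾.ε (𝔾.dualLeft x a) = 𝔾.ev x a := by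
  obtain ⟨g, rfl⟩ := 𝔾.fourier.surjective x
  rw [dualLeft_fourier, ← slice_comm 𝔾.ε_bdd 𝔾.φ_bdd, ev_fourier]
  exact congrArg 𝔾.φ (congrFun (congrArg Prod.fst (𝔾.counit_left a)) g)

/-- The map `a ⊗ b ↦ S(a) b`. -/
noncomputable def mulS₁ : CTensor V V →ₗ[ℂ] V :=
  lift (𝔾.bdd_mul.compLinear (g := LinearMap.id) 𝔾.S_bdd IsBdd.id)

/-- The map `a ⊗ b ↦ a S(b)`. -/
noncomputable def mulS₂ : CTensor V V →ₗ[ℂ] V :=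
  lift (𝔾.bdd_mul.compLinear (f := LinearMap.id) IsBdd.id 𝔾.S_bdd)

@[simp] theorem mulS₁_tmul (a b : V) : 𝔾.mulS₁ (tmul a b) = 𝔾.mul (𝔾.S a) b := lift_tmul _ _ _

@[simp] theorem mulS₂_tmul (a b : V) : 𝔾.mulS₂ (tmul a b) = 𝔾.mul a (𝔾.S b) := lift_tmul _ _ _

@[fun_prop]
theorem realBdd_mulS₁ : IsRealBdd fun t => 𝔾.mulS₁ t := realBdd_lift _

@[fun_prop]
theorem realBdd_mulS₂ : IsRealBdd fun t => 𝔾.mulS₂ t := realBdd_lift _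

theorem mulS₁_γr (a b : V) : 𝔾.mulS₁ (𝔾.Γ.γr (tmul a b)) = 𝔾.ε a • b := 𝔾.antipode_left a b

theorem mulS₂_ρl (a b : V) : 𝔾.mulS₂ (𝔾.Γ.ρl (tmul a b)) = 𝔾.ε b • a := 𝔾.antipode_right a b

/-- As S is antimultiplicative, `b` leaves the first leg as a factor S(b) on the left. A right
factor `c` gives access to the antipode axiom, which is stated for Δ(a)(1 ⊗ c). -/
theorem mulS₁_γl (a b : V) : 𝔾.mulS₁ (𝔾.Γ.γl (tmul a b)) = 𝔾.ε a • 𝔾.S b := by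
  refine 𝔾.eq_of_mul_right fun c => ?_
  have h₁ : ∀ u, 𝔾.mul (𝔾.mulS₁ u) c = 𝔾.mulS₁ (𝔾.right₂ c u) := fun u =>
    ext_tmul (f := fun u => 𝔾.mul (𝔾.mulS₁ u) c) (g := fun u => 𝔾.mulS₁ (𝔾.right₂ c u))
      (by fun_prop) (by fun_prop) (fun p q => by simp [𝔾.mul_assoc]) u
  have h₂ : ∀ u, 𝔾.mulS₁ (𝔾.right₁ b u) = 𝔾.mul (𝔾.S b) (𝔾.mulS₁ u) := fun u =>
    ext_tmul (f := fun u => 𝔾.mulS₁ (𝔾.right₁ b u)) (g := fun u => 𝔾.mul (𝔾.S b) (𝔾.mulS₁ u))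
      (by fun_prop) (by fun_prop) (fun p q => by simp [𝔾.mul_assoc, 𝔾.S_mul]) u
  rw [h₁, right₂_γl, h₂, mulS₁_γr, 𝔾.bdd_mul.smul_right, 𝔾.bdd_mul.smul_left]

/-- The inverse `a ⊗ b ↦ b₂ ⊗ S⁻¹(b₁) a` of the Galois map `a ⊗ b ↦ Δ(a) (b ⊗ 1)`. -/
noncomputable def γlInv : CTensor V V →ₗ[ℂ] CTensor V V where
  toFun t := flip V V (map (g := LinearMap.id) 𝔾.S_symm_bdd IsBdd.id
    (𝔾.Γ.ρl (map (g := LinearMap.id) 𝔾.S_bdd IsBdd.id t)))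
  map_add' s t := by rw [map_add, (𝔾.Γ.realBdd_ρl).map_add, map_add, map_add]
  map_smul' c t := by rw [map_smul, 𝔾.Γ.ρl_smul, map_smul, map_smul, RingHom.id_apply]

theorem γlInv_apply (t : CTensor V V) : 𝔾.γlInv t = flip V V (map (g := LinearMap.id)
    𝔾.S_symm_bdd IsBdd.id (𝔾.Γ.ρl (map (g := LinearMap.id) 𝔾.S_bdd IsBdd.id t))) := rfl

theorem γlInv_tmul (a b : V) : 𝔾.γlInv (tmul a b) = flip V V (map (g := LinearMap.id)
    𝔾.S_symm_bdd IsBdd.id (𝔾.Γ.ρl (tmul (𝔾.S a) b))) := by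
  rw [γlInv_apply, map_tmul]; rfl

@[fun_prop]
theorem realBdd_γlInv : IsRealBdd fun t => 𝔾.γlInv t := by
  simp only [γlInv_apply]; fun_prop

-- Slicing by `x` and applying S turns the left side into S(a) b₁ S((ι ⊗ x)Δ(b₂)). By
-- coassociativity this is the right antipode axiom for (ι ⊗ x)Δ(b), whose counit is x(b).
@[simp] theorem γl_γlInv (t : CTensor V V) : 𝔾.Γ.γl (𝔾.γlInv t) = t := by
  refine ext_tmul (f := fun t => 𝔾.Γ.γl (𝔾.γlInv t)) (g := fun t => t) (by fun_prop) (by fun_prop)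
    (fun a b => 𝔾.eq_of_slice₂_ev fun x => 𝔾.S.injective ?_) t
  have h : ∀ u, 𝔾.S (slice₂ (𝔾.bdd_evL x) (𝔾.Γ.γl (flip V V (map (g := LinearMap.id)
      𝔾.S_symm_bdd IsBdd.id u)))) =
      𝔾.mulS₂ (map (f := LinearMap.id) IsBdd.id (𝔾.dualLeftL_bdd x) u) := fun u =>
    ext_tmul (f := fun u => 𝔾.S (slice₂ (𝔾.bdd_evL x) (𝔾.Γ.γl (flip V V (map (g := LinearMap.id)
      𝔾.S_symm_bdd IsBdd.id u)))))
      (g := fun u => 𝔾.mulS₂ (map (f := LinearMap.id) IsBdd.id (𝔾.dualLeftL_bdd x) u))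
      (by fun_prop) (by fun_prop) (fun p q => by
        simp only [map_tmul, flip_tmul, ← dualLeft_mul, 𝔾.S_mul, mulS₂_tmul, LinearMap.id_apply,
          LinearEquiv.coe_coe, LinearEquiv.apply_symm_apply, dualLeftL_apply]) u
  rw [γlInv_tmul, h, ← ρl_dualLeft, mulS₂_ρl, ε_dualLeft, slice₂_tmul, map_smul, evL_apply]

-- The same argument with the left antipode axiom; the outer maps in `γlInv` undo the antipode and
-- the flip.
@[simp] theorem γlInv_γl (t : CTensor V V) : 𝔾.γlInv (𝔾.Γ.γl t) = t := by
  refine ext_tmul (f := fun t => 𝔾.γlInv (𝔾.Γ.γl t)) (g := fun t => t) (by fun_prop) (by fun_prop)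
    (fun a b => ?_) t
  have h0 : 𝔾.Γ.ρl (map (g := LinearMap.id) 𝔾.S_bdd IsBdd.id (𝔾.Γ.γl (tmul a b))) =
      tmul (𝔾.S b) a := by
    refine 𝔾.eq_of_slice₂_ev fun x => ?_
    have h : ∀ u, slice₂ (𝔾.bdd_evL x) (𝔾.Γ.ρl (map (g := LinearMap.id) 𝔾.S_bdd IsBdd.id u)) =
        𝔾.mulS₁ (map (f := LinearMap.id) IsBdd.id (𝔾.dualLeftL_bdd x) u) := fun u =>
      ext_tmul (f := fun u => slice₂ (𝔾.bdd_evL x) (𝔾.Γ.ρl (map (g := LinearMap.id)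
        𝔾.S_bdd IsBdd.id u)))
        (g := fun u => 𝔾.mulS₁ (map (f := LinearMap.id) IsBdd.id (𝔾.dualLeftL_bdd x) u))
        (by fun_prop) (by fun_prop) (fun p q => by
          simp only [map_tmul, ← mul_dualLeft, mulS₁_tmul, LinearMap.id_apply,
            LinearEquiv.coe_coe, dualLeftL_apply]) u
    rw [h, ← γl_dualLeft, mulS₁_γl, ε_dualLeft, slice₂_tmul, evL_apply]
  change 𝔾.γlInv (𝔾.Γ.γl (tmul a b)) = tmul a b
  rw [γlInv_apply, h0, map_tmul, flip_tmul]
  simp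

/-! ### Invariance -/

theorem slice₂_φ_γl (a b : V) : slice₂ 𝔾.φ_bdd (𝔾.Γ.γl (tmul a b)) = 𝔾.φ a • b :=
  congrFun (congrArg Prod.fst (𝔾.φ_invariant a)) b

theorem slice₂_φ_ρl (b a : V) : slice₂ 𝔾.φ_bdd (𝔾.Γ.ρl (tmul b a)) = 𝔾.φ a • b :=
  congrFun (congrArg Prod.snd (𝔾.φ_invariant a)) b

theorem bdd_φ_mulLeft (b : V) : IsBdd (𝔾.φ ∘ₗ 𝔾.mulLeft b) :=
  𝔾.φ_bdd.comp (𝔾.bdd_mulLeft b)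

/-- Strong left invariance: `(ι ⊗ φ)((1 ⊗ b) Δ(g)) = S((ι ⊗ φ)(Δ(b) (1 ⊗ g)))`. -/
theorem slice₂_φ_ρr (b g : V) :
    slice₂ 𝔾.φ_bdd (𝔾.Γ.ρr (tmul b g)) = 𝔾.S (𝔾.dualLeft (𝔾.fourier g) b) := by
  refine 𝔾.eq_of_mul_left fun c => ?_
  obtain ⟨c, rfl⟩ := 𝔾.S.surjective c
  -- Writing c ⊗ g as γ(s) makes left invariance applicable, since Δ(b)γ(p ⊗ q) = γ(bp ⊗ q).
  -- Surjectivity of γ then gives the formula for every c ⊗ g.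
  have h₁ : ∀ s, slice₂ 𝔾.φ_bdd ((𝔾.Γ.Δ b).1.1 (𝔾.Γ.γl s)) = slice₁ (𝔾.bdd_φ_mulLeft b) s :=
    fun s => ext_tmul (f := fun s => slice₂ 𝔾.φ_bdd ((𝔾.Γ.Δ b).1.1 (𝔾.Γ.γl s)))
      (g := fun s => slice₁ (𝔾.bdd_φ_mulLeft b) s) (by fun_prop) (by fun_prop)
      (fun p q => by
        rw [Δ_left_γl, slice₂_φ_γl, slice₁_tmul]
        rfl) s
  have h₂ : ∀ u, 𝔾.S (slice₁ (𝔾.bdd_φ_mulLeft b) (flip V V (map (g := LinearMap.id)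
      𝔾.S_symm_bdd IsBdd.id u))) = slice₂ 𝔾.φ_bdd (𝔾.left₂ b u) := fun u =>
    ext_tmul (f := fun u => 𝔾.S (slice₁ (𝔾.bdd_φ_mulLeft b) (flip V V (map (g := LinearMap.id)
      𝔾.S_symm_bdd IsBdd.id u)))) (g := fun u => slice₂ 𝔾.φ_bdd (𝔾.left₂ b u))
      (by fun_prop) (by fun_prop) (fun p q => by
        simp only [map_tmul, flip_tmul, slice₁_tmul, 𝔾.left₂_tmul, slice₂_tmul, map_smul,
          LinearEquiv.coe_coe, LinearEquiv.apply_symm_apply, LinearMap.id_apply]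
        rfl) u
  rw [← 𝔾.S_mul, dualLeft_fourier, ← 𝔾.slice₂_right₁, ← Δ_left_tmul', ← 𝔾.γl_γlInv (tmul c g),
    h₁, γlInv_tmul, h₂, ← left₁_ρr, 𝔾.slice₂_left₁]

/-- The antiautomorphism `a ⊗ b ↦ S(b) ⊗ S(a)`. -/
noncomputable def flipS : CTensor V V →ₗ[ℂ] CTensor V V :=
  lift (isBddBilin_tmul.compLinear 𝔾.S_bdd 𝔾.S_bdd).swap

@[simp] theorem flipS_tmul (a b : V) : 𝔾.flipS (tmul a b) = tmul (𝔾.S b) (𝔾.S a) :=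
  lift_tmul _ _ _

@[fun_prop]
theorem realBdd_flipS : IsRealBdd fun t => 𝔾.flipS t := realBdd_lift _

theorem flipS_mulT (s t : CTensor V V) :
    𝔾.flipS (𝔾.mulT s t) = 𝔾.mulT (𝔾.flipS t) (𝔾.flipS s) :=
  ext_tmul₂ (f := fun s t => 𝔾.flipS (𝔾.mulT s t))
    (g := fun s t => 𝔾.mulT (𝔾.flipS t) (𝔾.flipS s)) (by intro; fun_prop) (by intro; fun_prop)
    (by intro; fun_prop) (by intro; fun_prop) (fun a b c d => by simp [𝔾.S_mul]) s t

theorem eq_of_mulT_flipS {s t : CTensor V V}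
    (h : ∀ r, 𝔾.mulT s (𝔾.flipS r) = 𝔾.mulT t (𝔾.flipS r)) : s = t :=
  𝔾.eq_of_mulT_tmul_right fun a b => by
    simpa using h (tmul (𝔾.S.symm b) (𝔾.S.symm a))

theorem flipS_right₁ (c : V) (t : CTensor V V) :
    𝔾.flipS (𝔾.right₁ c t) = 𝔾.left₂ (𝔾.S c) (𝔾.flipS t) :=
  ext_tmul (f := fun t => 𝔾.flipS (𝔾.right₁ c t)) (g := fun t => 𝔾.left₂ (𝔾.S c) (𝔾.flipS t))
    (by fun_prop) (by fun_prop) (fun _ _ => by simp [𝔾.S_mul]) t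

theorem flipS_right₂ (c : V) (t : CTensor V V) :
    𝔾.flipS (𝔾.right₂ c t) = 𝔾.left₁ (𝔾.S c) (𝔾.flipS t) :=
  ext_tmul (f := fun t => 𝔾.flipS (𝔾.right₂ c t)) (g := fun t => 𝔾.left₁ (𝔾.S c) (𝔾.flipS t))
    (by fun_prop) (by fun_prop) (fun _ _ => by simp [𝔾.S_mul]) t

theorem flipS_Δ (a : V) (t : CTensor V V) :
    𝔾.flipS ((𝔾.Γ.Δ a).1.2 t) = (𝔾.Γ.Δ (𝔾.S a)).1.1 (𝔾.flipS t) := (𝔾.S_comul_left a t).symm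

/-- `flipS` reverses products and takes Δ(a) to Δ(S(a)). Hence it interchanges the legs and the two
sides of multiplication, and so permutes the Galois maps. -/
theorem flipS_γr (a b : V) : 𝔾.flipS (𝔾.Γ.γr (tmul a b)) = 𝔾.Γ.ρl (tmul (𝔾.S b) (𝔾.S a)) :=
  𝔾.eq_of_mulT_flipS fun r => by
    rw [← flipS_mulT, 𝔾.Γ.γr_right, flipS_right₂, flipS_Δ, 𝔾.Γ.ρl_left]

theorem flipS_γl (a b : V) : 𝔾.flipS (𝔾.Γ.γl (tmul a b)) = 𝔾.Γ.ρr (tmul (𝔾.S b) (𝔾.S a)) :=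
  𝔾.eq_of_mulT_flipS fun r => by
    rw [← flipS_mulT, 𝔾.Γ.γl_right, flipS_right₁, flipS_Δ, 𝔾.Γ.ρr_left]

theorem flipS_ρl (a b : V) : 𝔾.flipS (𝔾.Γ.ρl (tmul a b)) = 𝔾.Γ.γr (tmul (𝔾.S b) (𝔾.S a)) :=
  𝔾.eq_of_mulT_flipS fun r => by
    rw [← flipS_mulT, 𝔾.Γ.ρl_right, flipS_Δ, flipS_right₁, 𝔾.Γ.γr_left]

theorem flipS_ρr (a b : V) : 𝔾.flipS (𝔾.Γ.ρr (tmul a b)) = 𝔾.Γ.γl (tmul (𝔾.S b) (𝔾.S a)) :=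
  𝔾.eq_of_mulT_flipS fun r => by
    rw [← flipS_mulT, 𝔾.Γ.ρr_right, flipS_Δ, flipS_right₂, 𝔾.Γ.γl_left]

theorem slice₂_flipS {ω : V →ₗ[ℂ] ℂ} (hω : IsBdd ω) {η : V →ₗ[ℂ] ℂ} (hη : IsBdd η)
    (h : ∀ a, ω (𝔾.S a) = η a) (t : CTensor V V) :
    slice₂ hω (𝔾.flipS t) = 𝔾.S (slice₁ hη t) :=
  ext_tmul (f := fun t => slice₂ hω (𝔾.flipS t)) (g := fun t => 𝔾.S (slice₁ hη t))
    (by fun_prop) (by fun_prop) (fun v w => by simp [h]) t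

theorem slice₁_flipS {ω : V →ₗ[ℂ] ℂ} (hω : IsBdd ω) {η : V →ₗ[ℂ] ℂ} (hη : IsBdd η)
    (h : ∀ a, ω (𝔾.S a) = η a) (t : CTensor V V) :
    slice₁ hω (𝔾.flipS t) = 𝔾.S (slice₂ hη t) :=
  ext_tmul (f := fun t => slice₁ hω (𝔾.flipS t)) (g := fun t => 𝔾.S (slice₂ hη t))
    (by fun_prop) (by fun_prop) (fun v w => by simp [h]) t

theorem bdd_φ_S : IsBdd (𝔾.φ ∘ₗ 𝔾.S.toLinearMap) := 𝔾.φ_bdd.comp 𝔾.S_bdd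

/-- The functional `φ ∘ S` is right invariant. -/
theorem slice₁_φS_γr (a b : V) : slice₁ 𝔾.bdd_φ_S (𝔾.Γ.γr (tmul a b)) = 𝔾.φ (𝔾.S a) • b := by
  apply 𝔾.S.injective
  rw [← 𝔾.slice₂_flipS 𝔾.φ_bdd 𝔾.bdd_φ_S (fun _ => rfl), flipS_γr, slice₂_φ_ρl, map_smul]

/-! ### The modular element -/

/-- If φ vanished, faithfulness would give A = 0, and then the counit could not be essential. -/
theorem exists_φ_eq_one : ∃ u, 𝔾.φ u = 1 := by
  by_contra! h
  have h0 : ∀ u, 𝔾.φ u = 0 := by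
    intro u
    by_contra hu
    exact h ((𝔾.φ u)⁻¹ • u) (by simp [hu])
  have hV : ∀ a : V, a = 0 := fun a => 𝔾.φ_faithful a (h0 _)
  obtain ⟨t, ht⟩ := 𝔾.ε_essential.exists_lift 1
  have hr := realBdd_lift (isBddBilin_smul.compLinear (V' := V) (g := (LinearMap.id : ℂ →ₗ[ℂ] ℂ))
    𝔾.ε_bdd IsBdd.id)
  have := eq_zero_of_tmul hr (fun v w => by rw [lift_tmul, hV v]; simp) t
  exact one_ne_zero (ht.symm.trans this)

/-- `φ((φ ⊗ ι)((1 ⊗ a) Δ(b))) = φ(S(a)) φ(b)`. -/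
theorem φ_slice₁_ρr (a b : V) :
    𝔾.φ (slice₁ 𝔾.φ_bdd (𝔾.Γ.ρr (tmul a b))) = 𝔾.φ b * 𝔾.φ (𝔾.S a) := by
  -- Strong left invariance turns the inner integral into S of a slice of Δ(a), to which right
  -- invariance of φ ∘ S applies.
  rw [slice_comm 𝔾.φ_bdd 𝔾.φ_bdd, slice₂_φ_ρr, dualLeft_fourier]
  have := slice_comm 𝔾.bdd_φ_S 𝔾.φ_bdd (𝔾.Γ.γr (tmul a b))
  rw [slice₁_φS_γr, map_smul, smul_eq_mul] at this
  rw [mul_comm, this]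
  rfl

theorem mul_slice₁_γr (a b y : V) : 𝔾.mul a (slice₁ 𝔾.φ_bdd (𝔾.Γ.γr (tmul y b))) =
    𝔾.mul (slice₁ 𝔾.φ_bdd (𝔾.Γ.ρr (tmul a y))) b := by
  rw [← 𝔾.slice₁_left₂, left₂_γr, 𝔾.slice₁_right₂]

/-- The multiplier `(φ ⊗ ι)(Δ(y))`. -/
noncomputable def modularMultiplier (y : V) : multipliers 𝔾.bdd_mul :=
  ⟨({ toFun := fun b => slice₁ 𝔾.φ_bdd (𝔾.Γ.γr (tmul y b))
      map_add' := by
        have h : IsRealBdd fun b => slice₁ 𝔾.φ_bdd (𝔾.Γ.γr (tmul y b)) := by fun_prop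
        exact h.map_add
      map_smul' := fun c b => by
        rw [isBddBilin_tmul.smul_right, RingHom.id_apply, 𝔾.Γ.γr_smul, map_smul] },
    { toFun := fun b => slice₁ 𝔾.φ_bdd (𝔾.Γ.ρr (tmul b y))
      map_add' := fun a b => by rw [isBddBilin_tmul.add_left, map_add, map_add]
      map_smul' := fun c b => by rw [isBddBilin_tmul.smul_left, RingHom.id_apply, map_smul,
        map_smul] }),
    by
      have h : IsRealBdd fun b => slice₁ 𝔾.φ_bdd (𝔾.Γ.γr (tmul y b)) := by fun_prop
      exact h.bdd,
    by
      have h : IsRealBdd fun b => slice₁ 𝔾.φ_bdd (𝔾.Γ.ρr (tmul b y)) := by fun_prop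
      exact h.bdd,
    fun a b => by
      change slice₁ 𝔾.φ_bdd (𝔾.Γ.γr (tmul y (𝔾.mul a b))) = _
      rw [γr_mul, 𝔾.slice₁_right₂]; rfl,
    fun a b => by
      change slice₁ 𝔾.φ_bdd (𝔾.Γ.ρr (tmul (𝔾.mul a b) y)) = _
      rw [ρr_mul, 𝔾.slice₁_left₂]; rfl,
    fun a b => (𝔾.mul_slice₁_γr a b y).symm⟩

/-- Paired with `c`, the left side becomes φ(a)φ(S(cb)), in which `a` enters only through φ(a). -/
theorem slice₁_φ_ρr_unique {y : V} (hy : 𝔾.φ y = 1) (b a : V) :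
    slice₁ 𝔾.φ_bdd (𝔾.Γ.ρr (tmul b a)) = 𝔾.φ a • slice₁ 𝔾.φ_bdd (𝔾.Γ.ρr (tmul b y)) := by
  refine 𝔾.eq_of_φ_mul_left fun c => ?_
  rw [𝔾.bdd_mul.smul_right, map_smul, ← 𝔾.slice₁_left₂, ← 𝔾.slice₁_left₂, ← ρr_mul, ← ρr_mul,
    φ_slice₁_ρr, φ_slice₁_ρr, hy, one_mul]
  rfl

theorem isModularElement_modularMultiplier {y : V} (hy : 𝔾.φ y = 1) :
    𝔾.IsModularElement (𝔾.modularMultiplier y) := by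
  intro a
  refine Prod.ext (funext fun b => 𝔾.eq_of_mul_left fun c => ?_) (funext fun b =>
    𝔾.slice₁_φ_ρr_unique hy b a)
  change 𝔾.mul c (slice₁ 𝔾.φ_bdd (𝔾.Γ.γr (tmul a b))) =
    𝔾.mul c (𝔾.φ a • slice₁ 𝔾.φ_bdd (𝔾.Γ.γr (tmul y b)))
  -- The left multiplication follows from the right one, since c(δb) = (cδ)b.
  rw [𝔾.bdd_mul.smul_right, mul_slice₁_γr, mul_slice₁_γr, 𝔾.slice₁_φ_ρr_unique hy,
    𝔾.bdd_mul.smul_left]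

theorem IsModularElement.unique {δ δ' : multipliers 𝔾.bdd_mul} (h : 𝔾.IsModularElement δ)
    (h' : 𝔾.IsModularElement δ') : δ = δ' := by
  obtain ⟨u, hu⟩ := 𝔾.exists_φ_eq_one
  have := (h u).symm.trans (h' u)
  simp only [hu, one_smul, Prod.mk.injEq] at this
  exact Subtype.ext (Prod.ext (LinearMap.ext fun b => congrFun this.1 b)
    (LinearMap.ext fun b => congrFun this.2 b))

theorem slice₁_φ_ρr {δ : multipliers 𝔾.bdd_mul} (hδ : 𝔾.IsModularElement δ) (b a : V) :
    slice₁ 𝔾.φ_bdd (𝔾.Γ.ρr (tmul b a)) = 𝔾.φ a • δ.1.2 b :=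
  congrFun (congrArg Prod.snd (hδ a)) b

/-- Apply `φ_slice₁_ρr` to an element of integral one. This identity explains the factor δ in the
convolution adjoint. -/
theorem φ_modular {δ : multipliers 𝔾.bdd_mul} (hδ : 𝔾.IsModularElement δ) (a : V) :
    𝔾.φ (δ.1.2 a) = 𝔾.φ (𝔾.S a) := by
  obtain ⟨u, hu⟩ := 𝔾.exists_φ_eq_one
  have := 𝔾.φ_slice₁_ρr a u
  rwa [𝔾.slice₁_φ_ρr hδ, hu, one_smul, one_mul] at this

/-! ### The counit, the antipode and the involution -/

theorem slice₁_ε_γr (a b : V) : slice₁ 𝔾.ε_bdd (𝔾.Γ.γr (tmul a b)) = 𝔾.mul a b :=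
  congrFun (congrArg Prod.fst (𝔾.counit_left a)) b

theorem slice₁_ε_ρr (b a : V) : slice₁ 𝔾.ε_bdd (𝔾.Γ.ρr (tmul b a)) = 𝔾.mul b a :=
  congrFun (congrArg Prod.snd (𝔾.counit_left a)) b

theorem slice₂_ε_γl (a b : V) : slice₂ 𝔾.ε_bdd (𝔾.Γ.γl (tmul a b)) = 𝔾.mul a b :=
  congrFun (congrArg Prod.fst (𝔾.counit_right a)) b

theorem exists_ε_ne_zero : ∃ u, 𝔾.ε u ≠ 0 := by
  by_contra! h0
  obtain ⟨t, ht⟩ := 𝔾.ε_essential.exists_lift 1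
  have hr := realBdd_lift (isBddBilin_smul.compLinear (V' := V) (g := (LinearMap.id : ℂ →ₗ[ℂ] ℂ))
    𝔾.ε_bdd IsBdd.id)
  have := eq_zero_of_tmul hr (fun v w => by rw [lift_tmul, h0 v]; simp) t
  exact one_ne_zero (ht.symm.trans this)

/-- `a ↦ conj (ε (star a))` as a linear functional. -/
noncomputable def conjε : V →ₗ[ℂ] ℂ where
  toFun a := (starRingEnd ℂ) (𝔾.ε (𝔾.star a))
  map_add' a b := by rw [𝔾.star_add, map_add, map_add]
  map_smul' c a := by simp [𝔾.star_smul]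

theorem conjε_bdd : IsBdd 𝔾.conjε := by
  have h : IsRealBdd fun a => (starRingEnd ℂ) (𝔾.ε (𝔾.star a)) := by fun_prop
  exact h.bdd

/-- Uniqueness of the counit: the functional conjugate to ε is a left counit as well. Evaluating the
tensor product of both counits on Δ(a)(1 ⊗ u) in the two orders gives the same value up to the
factor ε(u) ≠ 0. -/
theorem ε_star (a : V) : 𝔾.ε (𝔾.star a) = (starRingEnd ℂ) (𝔾.ε a) := by
  obtain ⟨u, hu⟩ := 𝔾.exists_ε_ne_zero
  have h₁ : slice₁ 𝔾.conjε_bdd (𝔾.Γ.γr (tmul a u)) = 𝔾.mul a u := by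
    rw [𝔾.Γ.γr_tmul, 𝔾.slice₁_starT 𝔾.ε_bdd 𝔾.conjε_bdd (fun b => by simp [conjε]), slice₁_ε_ρr]
    simp
  have h₂ : slice₂ 𝔾.ε_bdd (𝔾.Γ.γr (tmul a u)) = 𝔾.ε u • a := by
    refine 𝔾.eq_of_mul_right fun c => ?_
    have h : ∀ t, slice₂ 𝔾.ε_bdd (𝔾.right₂ u t) = 𝔾.ε u • slice₂ 𝔾.ε_bdd t := fun t =>
      ext_tmul (f := fun t => slice₂ 𝔾.ε_bdd (𝔾.right₂ u t))
        (g := fun t => 𝔾.ε u • slice₂ 𝔾.ε_bdd t) (by fun_prop) (by fun_prop)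
        (fun v w => by simp [𝔾.ε_mul, smul_smul, mul_comm]) t
    rw [← 𝔾.slice₂_right₁, ← right₂_γl, h, slice₂_ε_γl, 𝔾.bdd_mul.smul_left]
    rfl
  have h₃ := slice_comm 𝔾.conjε_bdd 𝔾.ε_bdd (𝔾.Γ.γr (tmul a u))
  rw [h₁, h₂, 𝔾.ε_mul, map_smul, smul_eq_mul, mul_comm] at h₃
  have h₄ : 𝔾.ε a = 𝔾.conjε a := mul_left_cancel₀ hu h₃
  rw [h₄]
  simp [conjε]

theorem γl_surjective (t : CTensor V V) : ∃ s, 𝔾.Γ.γl s = t := ⟨_, 𝔾.γl_γlInv t⟩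

theorem ρl_surjective (t : CTensor V V) : ∃ s, 𝔾.Γ.ρl s = t := by
  obtain ⟨s, hs⟩ := 𝔾.γl_surjective (𝔾.starT t)
  exact ⟨𝔾.flipStarT s, by rw [Coproduct.ρl, 𝔾.flipStarT_flipStarT, hs, 𝔾.starT_starT]⟩

/-- Uniqueness of the antipode: conjugating the left antipode axiom shows that the left side obeys
the right antipode axiom. Two maps obeying it agree because (c ⊗ 1)Δ(a) fills A ⊗̂ A. -/
theorem star_S_symm_star (a : V) : 𝔾.star (𝔾.S.symm (𝔾.star a)) = 𝔾.S a := by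
  let R : V →ₗ[ℂ] V :=
    { toFun := fun a => 𝔾.star (𝔾.S.symm (𝔾.star a))
      map_add' := fun a b => by rw [𝔾.star_add, map_add, 𝔾.star_add]
      map_smul' := fun c a => by simp [𝔾.star_smul] }
  have hRr : IsRealBdd fun a => R a := by
    change IsRealBdd fun a => 𝔾.star (𝔾.S.symm (𝔾.star a))
    fun_prop
  let N : CTensor V V →ₗ[ℂ] V := lift (𝔾.bdd_mul.compLinear (f := LinearMap.id) IsBdd.id hRr.bdd)
  have hN : ∀ a b, N (tmul a b) = 𝔾.mul a (𝔾.star (𝔾.S.symm (𝔾.star b))) := fun a b =>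
    lift_tmul _ _ _
  have hNr : IsRealBdd fun t => N t := realBdd_lift _
  have h₁ : ∀ t, N (𝔾.starT t) = 𝔾.star (𝔾.S.symm (𝔾.mulS₁ t)) := fun t =>
    ext_tmul (f := fun t => N (𝔾.starT t)) (g := fun t => 𝔾.star (𝔾.S.symm (𝔾.mulS₁ t)))
      (hNr.comp 𝔾.realBdd_starT) (by fun_prop) (fun p q => by
        have : 𝔾.S.symm (𝔾.mul (𝔾.S p) q) = 𝔾.mul (𝔾.S.symm q) p := by
          rw [LinearEquiv.symm_apply_eq, 𝔾.S_mul, LinearEquiv.apply_symm_apply]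
        simp [hN, this]) t
  have h₂ : ∀ s, N (𝔾.Γ.ρl s) = 𝔾.mulS₂ (𝔾.Γ.ρl s) := fun s =>
    ext_tmul (f := fun s => N (𝔾.Γ.ρl s)) (g := fun s => 𝔾.mulS₂ (𝔾.Γ.ρl s))
      (hNr.comp 𝔾.Γ.realBdd_ρl) (by fun_prop) (fun p q => by
        rw [mulS₂_ρl, 𝔾.Γ.ρl_tmul, h₁, mulS₁_γl]
        simp [ε_star, 𝔾.star_smul]) s
  refine 𝔾.eq_of_mul_left fun c => ?_
  obtain ⟨s, hs⟩ := 𝔾.ρl_surjective (tmul c a)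
  rw [← hN, ← mulS₂_tmul, ← hs, h₂]

theorem S_star_S_star (a : V) : 𝔾.S (𝔾.star (𝔾.S (𝔾.star a))) = a := by
  rw [← 𝔾.star_S_symm_star (𝔾.star a)]
  simp

theorem S_star_S (a : V) : 𝔾.S (𝔾.star (𝔾.S a)) = 𝔾.star a := by
  simpa using 𝔾.S_star_S_star (𝔾.star a)

theorem S_symm_mul (a b : V) :
    𝔾.S.symm (𝔾.mul a b) = 𝔾.mul (𝔾.S.symm b) (𝔾.S.symm a) := by
  rw [LinearEquiv.symm_apply_eq, 𝔾.S_mul]; simp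

end BornQuantumGroup

end

section

variable {V : Type u} [AddCommGroup V] [Module ℂ V] [Bornology V]

namespace BornQuantumGroup

open CTensor

variable [CompleteBornSpace V] (𝔾 : BornQuantumGroup V)

/-! ### The antipode of the dual -/

theorem bdd_evL_S_symm (x : 𝔾.Dual) : IsBdd (𝔾.evL x ∘ₗ 𝔾.S.symm.toLinearMap) :=
  (𝔾.bdd_evL x).comp 𝔾.S_symm_bdd

/-- At this stage x ∘ S⁻¹ is only known to be a bounded functional, not an element of the dual, so
its slice is used directly. -/
theorem S_dualLeft_mul (x : 𝔾.Dual) (a g : V) :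
    𝔾.mul (𝔾.S (𝔾.dualLeft x a)) g =
      slice₁ (𝔾.bdd_evL_S_symm x) (𝔾.Γ.γr (tmul (𝔾.S a) g)) := by
  obtain ⟨c, rfl⟩ := 𝔾.S.surjective g
  rw [← 𝔾.S_mul, mul_dualLeft, ← flipS_ρl,
    𝔾.slice₁_flipS (𝔾.bdd_evL_S_symm x) (𝔾.bdd_evL x) (fun a => by simp)]

theorem mul_S_dualLeft (x : 𝔾.Dual) (a c : V) :
    𝔾.mul c (𝔾.S (𝔾.dualLeft x a)) =
      slice₁ (𝔾.bdd_evL_S_symm x) (𝔾.Γ.ρr (tmul c (𝔾.S a))) := by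
  obtain ⟨c, rfl⟩ := 𝔾.S.surjective c
  rw [← 𝔾.S_mul, dualLeft_mul, ← flipS_γl,
    𝔾.slice₁_flipS (𝔾.bdd_evL_S_symm x) (𝔾.bdd_evL x) (fun a => by simp)]

/-- Strong left invariance in integrated form: a right slice is moved to the other factor as S of a
left slice. -/
theorem φ_mul_dualRight (a f g : V) :
    𝔾.φ (𝔾.mul a (𝔾.dualRight (𝔾.fourier g) f)) =
      𝔾.φ (𝔾.mul (𝔾.S (𝔾.dualLeft (𝔾.fourier f) a)) g) := by
  rw [mul_dualRight, slice_comm (𝔾.bdd_evL _) 𝔾.φ_bdd, slice₂_φ_ρr]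
  rfl

theorem φ_S_dualLeft_mul (f g a : V) :
    𝔾.φ (𝔾.mul (𝔾.S (𝔾.dualLeft (𝔾.fourier f) a)) g) =
      𝔾.φ (𝔾.mul (𝔾.S.symm (𝔾.dualLeft (𝔾.fourier g) (𝔾.S a))) f) := by
  rw [S_dualLeft_mul, slice_comm (𝔾.bdd_evL_S_symm _) 𝔾.φ_bdd, ← dualLeft_fourier]
  rfl

/-- The map `φ ∘ S⁻²`. -/
noncomputable def φS : V →ₗ[ℂ] ℂ := 𝔾.φ ∘ₗ 𝔾.S.symm.toLinearMap ∘ₗ 𝔾.S.symm.toLinearMap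

theorem φS_apply (a : V) : 𝔾.φS a = 𝔾.φ (𝔾.S.symm (𝔾.S.symm a)) := rfl

theorem φS_bdd : IsBdd 𝔾.φS := 𝔾.φ_bdd.comp (𝔾.S_symm_bdd.comp 𝔾.S_symm_bdd)

theorem SS_bdd : IsBdd (𝔾.S.toLinearMap ∘ₗ 𝔾.S.toLinearMap) := 𝔾.S_bdd.comp 𝔾.S_bdd

theorem SS_symm_bdd : IsBdd (𝔾.S.symm.toLinearMap ∘ₗ 𝔾.S.symm.toLinearMap) :=
  𝔾.S_symm_bdd.comp 𝔾.S_symm_bdd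

/-- The map `f ⊗ g ↦ (φ ⊗ ι)(Δ(f) (g ⊗ 1))`. -/
noncomputable def sliceγl : CTensor V V →ₗ[ℂ] V := slice₁ 𝔾.φ_bdd ∘ₗ 𝔾.Γ.γl

/-- The map `f ⊗ g ↦ (φ S⁻² ⊗ ι)(Δ(g) (S²(f) ⊗ 1))`. -/
noncomputable def sliceγlS : CTensor V V →ₗ[ℂ] V :=
  slice₁ 𝔾.φS_bdd ∘ₗ 𝔾.Γ.γl ∘ₗ flip V V ∘ₗ map (g := LinearMap.id) 𝔾.SS_bdd IsBdd.id

theorem sliceγl_apply (t : CTensor V V) : 𝔾.sliceγl t = slice₁ 𝔾.φ_bdd (𝔾.Γ.γl t) := rfl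

theorem sliceγlS_apply (t : CTensor V V) : 𝔾.sliceγlS t = slice₁ 𝔾.φS_bdd
    (𝔾.Γ.γl (flip V V (map (g := LinearMap.id) 𝔾.SS_bdd IsBdd.id t))) := rfl

theorem sliceγl_tmul (f g : V) : 𝔾.sliceγl (tmul f g) = 𝔾.dualRight (𝔾.fourier g) f :=
  (𝔾.dualRight_fourier g f).symm

theorem sliceγlS_tmul (f g : V) :
    𝔾.sliceγlS (tmul f g) = slice₁ 𝔾.φS_bdd (𝔾.Γ.γl (tmul g (𝔾.S (𝔾.S f)))) := by
  rw [sliceγlS_apply, map_tmul, flip_tmul]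
  rfl

@[fun_prop]
theorem realBdd_sliceγl : IsRealBdd fun t => 𝔾.sliceγl t := by
  simp only [sliceγl_apply]; fun_prop

@[fun_prop]
theorem realBdd_sliceγlS : IsRealBdd fun t => 𝔾.sliceγlS t := by
  simp only [sliceγlS_apply]; fun_prop

/-- On f ⊗ g both sides reduce by strong left invariance to φ(S⁻¹(h) f) with h = (ι ⊗ 𝔉(g))Δ(S(a)).
As `sliceγl` is onto, this transposes S with respect to φ. -/
theorem φ_mul_sliceγlS (a : V) (t : CTensor V V) :
    𝔾.φ (𝔾.mul (𝔾.S a) (𝔾.sliceγlS t)) = 𝔾.φ (𝔾.mul a (𝔾.sliceγl t)) :=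
  ext_tmul (f := fun t => 𝔾.φ (𝔾.mul (𝔾.S a) (𝔾.sliceγlS t)))
    (g := fun t => 𝔾.φ (𝔾.mul a (𝔾.sliceγl t))) (by fun_prop) (by fun_prop) (fun f g => by
      rw [sliceγl_tmul, φ_mul_dualRight, φ_S_dualLeft_mul, sliceγlS_tmul, ← 𝔾.slice₁_left₂,
        slice_comm 𝔾.φS_bdd 𝔾.φ_bdd, left₂_γl, 𝔾.slice₂_right₁, slice₂_φ_ρr, φS_apply]
      simp [S_symm_mul, ← 𝔾.S_mul]) t

/-- Left invariance makes both sides φ(f)φ(g). This preservation of φ will be the invariance of the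
dual counit under the dual antipode. -/
theorem φ_sliceγlS (t : CTensor V V) : 𝔾.φ (𝔾.sliceγlS t) = 𝔾.φ (𝔾.sliceγl t) :=
  ext_tmul (f := fun t => 𝔾.φ (𝔾.sliceγlS t)) (g := fun t => 𝔾.φ (𝔾.sliceγl t))
    (by fun_prop) (by fun_prop) (fun f g => by
      rw [sliceγlS_tmul, sliceγl_apply, slice_comm 𝔾.φS_bdd 𝔾.φ_bdd, slice_comm 𝔾.φ_bdd 𝔾.φ_bdd,
        slice₂_φ_γl, slice₂_φ_γl]
      simp [φS_apply, mul_comm]) t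

/-- An element `u` with `φ(u) = 1`. -/
noncomputable def unitφ : V := 𝔾.exists_φ_eq_one.choose

@[simp] theorem φ_unitφ : 𝔾.φ 𝔾.unitφ = 1 := 𝔾.exists_φ_eq_one.choose_spec

/-- The linear map `w ↦ u ⊗ w`. -/
noncomputable def tmulL {W : Type*} [AddCommGroup W] [Module ℂ W] [Bornology W] (u : V) :
    W →ₗ[ℂ] CTensor V W where
  toFun w := tmul u w
  map_add' := isBddBilin_tmul.add_right u
  map_smul' c w := isBddBilin_tmul.smul_right c u w

/-- The map `T` with `φ(S(a) T(h)) = φ(a h)`. -/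
noncomputable def transS : V →ₗ[ℂ] V := 𝔾.sliceγlS ∘ₗ 𝔾.γlInv ∘ₗ tmulL 𝔾.unitφ

/-- The map `T` with `φ(S(a) k) = φ(a T(k))`. -/
noncomputable def transSInv : V →ₗ[ℂ] V := 𝔾.sliceγl ∘ₗ
  map (g := LinearMap.id) 𝔾.SS_symm_bdd IsBdd.id ∘ₗ flip V V ∘ₗ 𝔾.γlInv ∘ₗ
    tmulL (𝔾.S (𝔾.S 𝔾.unitφ))

theorem transS_apply (h : V) : 𝔾.transS h = 𝔾.sliceγlS (𝔾.γlInv (tmul 𝔾.unitφ h)) := rfl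

theorem transSInv_apply (k : V) : 𝔾.transSInv k = 𝔾.sliceγl (map (g := LinearMap.id)
    𝔾.SS_symm_bdd IsBdd.id (flip V V (𝔾.γlInv (tmul (𝔾.S (𝔾.S 𝔾.unitφ)) k)))) := rfl

@[fun_prop]
theorem realBdd_transS : IsRealBdd fun h => 𝔾.transS h := by
  simp only [transS_apply]; fun_prop

@[fun_prop]
theorem realBdd_transSInv : IsRealBdd fun h => 𝔾.transSInv h := by
  simp only [transSInv_apply]; fun_prop

/-- Because φ(u) = 1, the tensor γ⁻¹(u ⊗ h) is a preimage of `h` under `sliceγl`. -/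
theorem φ_mul_transS (a h : V) : 𝔾.φ (𝔾.mul (𝔾.S a) (𝔾.transS h)) = 𝔾.φ (𝔾.mul a h) := by
  rw [transS_apply, φ_mul_sliceγlS, sliceγl_apply, γl_γlInv, slice₁_tmul, φ_unitφ, one_smul]

theorem φ_transS (h : V) : 𝔾.φ (𝔾.transS h) = 𝔾.φ h := by
  rw [transS_apply, φ_sliceγlS, sliceγl_apply, γl_γlInv, slice₁_tmul, φ_unitφ, one_smul]

/-- The same argument with the two slice maps exchanged; the argument S²(u) compensates for the
functional φ ∘ S⁻². -/
theorem φ_mul_transSInv (a k : V) : 𝔾.φ (𝔾.mul a (𝔾.transSInv k)) = 𝔾.φ (𝔾.mul (𝔾.S a) k) := by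
  have h : ∀ t : CTensor V V, map (g := LinearMap.id) 𝔾.SS_bdd IsBdd.id
      (map (g := LinearMap.id) 𝔾.SS_symm_bdd IsBdd.id t) = t := fun t =>
    ext_tmul (f := fun t => map (g := LinearMap.id) 𝔾.SS_bdd IsBdd.id
      (map (g := LinearMap.id) 𝔾.SS_symm_bdd IsBdd.id t)) (g := fun t => t) (by fun_prop)
      (by fun_prop) (fun p q => by simp) t
  have h' : ∀ t : CTensor V V, flip V V (flip V V t) = t := fun t =>
    ext_tmul (f := fun t => flip V V (flip V V t)) (g := fun t => t) (by fun_prop)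
      (by fun_prop) (fun p q => by simp) t
  rw [transSInv_apply, ← φ_mul_sliceγlS, sliceγlS_apply, h, h', γl_γlInv, slice₁_tmul, φS_apply]
  simp

theorem transS_transSInv (k : V) : 𝔾.transS (𝔾.transSInv k) = k :=
  𝔾.eq_of_φ_mul_left fun c => by
    obtain ⟨a, rfl⟩ := 𝔾.S.surjective c
    rw [φ_mul_transS, φ_mul_transSInv]

theorem transSInv_transS (k : V) : 𝔾.transSInv (𝔾.transS k) = k :=
  𝔾.eq_of_φ_mul_left fun c => by rw [φ_mul_transSInv, φ_mul_transS]

/-- The antipode of the dual. -/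
noncomputable def dualS : 𝔾.Dual ≃ₗ[ℂ] 𝔾.Dual :=
  𝔾.fourier.symm ≪≫ₗ (LinearEquiv.ofLinearMap 𝔾.transS 𝔾.transSInv
    (LinearMap.ext 𝔾.transS_transSInv) (LinearMap.ext 𝔾.transSInv_transS)) ≪≫ₗ 𝔾.fourier

theorem dualS_apply (x : 𝔾.Dual) : 𝔾.dualS x = 𝔾.fourier (𝔾.transS (𝔾.fourier.symm x)) := rfl

theorem dualS_symm_apply (x : 𝔾.Dual) :
    𝔾.dualS.symm x = 𝔾.fourier (𝔾.transSInv (𝔾.fourier.symm x)) := rfl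

@[fun_prop]
theorem realBdd_dualS : IsRealBdd fun x => 𝔾.dualS x := by
  simp only [dualS_apply]; fun_prop

@[fun_prop]
theorem realBdd_dualS_symm : IsRealBdd fun x => 𝔾.dualS.symm x := by
  simp only [dualS_symm_apply]; fun_prop

theorem ev_dualS_symm (x : 𝔾.Dual) (a : V) : 𝔾.ev (𝔾.dualS.symm x) a = 𝔾.ev x (𝔾.S a) := by
  rw [dualS_symm_apply, ev_fourier, φ_mul_transSInv, ev_eq]

theorem ev_dualS (x : 𝔾.Dual) (a : V) : 𝔾.ev (𝔾.dualS x) a = 𝔾.ev x (𝔾.S.symm a) := by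
  obtain ⟨y, rfl⟩ := 𝔾.dualS.symm.surjective x
  rw [ev_dualS_symm]; simp

theorem dualLeft_S (x : 𝔾.Dual) (a : V) :
    𝔾.dualLeft x (𝔾.S a) = 𝔾.S (𝔾.dualRight (𝔾.dualS.symm x) a) :=
  𝔾.eq_of_mul_right fun c => by
    obtain ⟨c, rfl⟩ := 𝔾.S.surjective c
    rw [dualLeft_mul, ← flipS_ρr, 𝔾.slice₂_flipS (𝔾.bdd_evL x) (𝔾.bdd_evL (𝔾.dualS.symm x))
      (fun a => (𝔾.ev_dualS_symm x a).symm), ← mul_dualRight, 𝔾.S_mul]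

theorem dualRight_S (x : 𝔾.Dual) (a : V) :
    𝔾.dualRight x (𝔾.S a) = 𝔾.S (𝔾.dualLeft (𝔾.dualS.symm x) a) :=
  𝔾.eq_of_mul_left fun c => by
    obtain ⟨c, rfl⟩ := 𝔾.S.surjective c
    rw [mul_dualRight, ← flipS_γl, 𝔾.slice₁_flipS (𝔾.bdd_evL x) (𝔾.bdd_evL (𝔾.dualS.symm x))
      (fun a => (𝔾.ev_dualS_symm x a).symm), ← dualLeft_mul, 𝔾.S_mul]

theorem dualLeft_S_symm (x : 𝔾.Dual) (a : V) :
    𝔾.dualLeft x (𝔾.S.symm a) = 𝔾.S.symm (𝔾.dualRight (𝔾.dualS x) a) := by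
  obtain ⟨a, rfl⟩ := 𝔾.S.surjective a
  rw [dualRight_S]; simp

theorem dualRight_S_symm (x : 𝔾.Dual) (a : V) :
    𝔾.dualRight x (𝔾.S.symm a) = 𝔾.S.symm (𝔾.dualLeft (𝔾.dualS x) a) := by
  obtain ⟨a, rfl⟩ := 𝔾.S.surjective a
  rw [dualLeft_S]; simp

/-! ### The product of the dual -/

theorem conv_eq (f g : V) : 𝔾.conv f g = 𝔾.S (𝔾.dualLeft (𝔾.fourier f) (𝔾.S.symm g)) :=
  𝔾.slice₂_φ_ρr _ _

/-- Convolution represents the product of functionals: this is what keeps products inside the dual.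
-/
theorem φ_mul_conv (a f g : V) :
    𝔾.φ (𝔾.mul a (𝔾.conv f g)) = 𝔾.ev (𝔾.fourier f) (𝔾.dualLeft (𝔾.fourier g) a) := by
  rw [conv_eq, mul_S_dualLeft, slice_comm (𝔾.bdd_evL_S_symm _) 𝔾.φ_bdd]
  simp [slice₂_φ_ρr]

theorem bdd_conv : IsBddBilin (RingHom.id ℂ) 𝔾.conv :=
  ((isBddBilin_tmul.swap.compLinear (f := LinearMap.id) IsBdd.id 𝔾.S_symm_bdd).postcomp
    𝔾.Γ.ρr_bdd).postcomp (lift_bdd (isBddBilin_slice₂ 𝔾.φ_bdd))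

/-- The product of the dual. -/
noncomputable def dualMul (x y : 𝔾.Dual) : 𝔾.Dual :=
  𝔾.fourier (𝔾.conv (𝔾.fourier.symm x) (𝔾.fourier.symm y))

theorem bdd_dualMul : IsBddBilin (RingHom.id ℂ) 𝔾.dualMul :=
  (𝔾.bdd_conv.compLinear (f := 𝔾.fourier.symm.toLinearMap) (g := 𝔾.fourier.symm.toLinearMap)
    𝔾.fourier_symm_bdd 𝔾.fourier_symm_bdd).postcomp (f := 𝔾.fourier.toLinearMap) 𝔾.fourier_bdd

theorem ev_dualMul (x y : 𝔾.Dual) (a : V) :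
    𝔾.ev (𝔾.dualMul x y) a = 𝔾.ev x (𝔾.dualLeft y a) := by
  rw [dualMul, ev_fourier, φ_mul_conv]; simp

theorem ev_dualMul' (x y : 𝔾.Dual) (a : V) :
    𝔾.ev (𝔾.dualMul x y) a = 𝔾.ev y (𝔾.dualRight x a) := by
  rw [ev_dualMul, ev_dualLeft]

/-- After pairing with `z`, the claim is that a right slice by `z` commutes with a left slice by
`y`, that is, coassociativity. -/
theorem dualLeft_dualMul (x y : 𝔾.Dual) (a : V) :
    𝔾.dualLeft (𝔾.dualMul x y) a = 𝔾.dualLeft x (𝔾.dualLeft y a) :=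
  𝔾.eq_of_ev fun z => by
    rw [ev_dualLeft, ev_dualMul, ← dualRight_dualLeft, ← ev_dualLeft]

theorem dualRight_dualMul (x y : 𝔾.Dual) (a : V) :
    𝔾.dualRight (𝔾.dualMul x y) a = 𝔾.dualRight y (𝔾.dualRight x a) :=
  𝔾.eq_of_ev fun z => by
    rw [← ev_dualLeft, ev_dualMul', dualRight_dualLeft, ev_dualLeft]

theorem dualMul_assoc (x y z : 𝔾.Dual) :
    𝔾.dualMul (𝔾.dualMul x y) z = 𝔾.dualMul x (𝔾.dualMul y z) :=
  𝔾.ev_ext fun a => by rw [ev_dualMul, ev_dualMul, ev_dualMul, dualLeft_dualMul]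

theorem dualS_dualMul (x y : 𝔾.Dual) :
    𝔾.dualS (𝔾.dualMul x y) = 𝔾.dualMul (𝔾.dualS y) (𝔾.dualS x) :=
  𝔾.ev_ext fun a => by
    rw [ev_dualS, ev_dualMul, ev_dualMul', ev_dualS, dualLeft_S_symm]

/-! ### The involution of the dual -/

/-- The modular element. -/
noncomputable def modular : multipliers 𝔾.bdd_mul := 𝔾.modularMultiplier 𝔾.unitφ

theorem isModularElement_modular : 𝔾.IsModularElement 𝔾.modular :=
  𝔾.isModularElement_modularMultiplier 𝔾.φ_unitφ

/-- The involution of the dual. -/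
noncomputable def dualStar (x : 𝔾.Dual) : 𝔾.Dual :=
  𝔾.fourier (𝔾.convStar 𝔾.modular (𝔾.fourier.symm x))

@[fun_prop]
theorem realBdd_dualStar : IsRealBdd fun x => 𝔾.dualStar x := by
  have h : IsRealBdd fun a => 𝔾.modular.1.2 a := .of_linear _ 𝔾.modular.2.2.1
  unfold dualStar convStar
  exact 𝔾.realBdd_fourier.comp (h.comp (by fun_prop))

theorem dualStar_smul (c : ℂ) (x : 𝔾.Dual) :
    𝔾.dualStar (c • x) = (starRingEnd ℂ) c • 𝔾.dualStar x := by
  simp only [dualStar, convStar, map_smul, 𝔾.star_smul]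

/-- The factor δ replaces φ by φ ∘ S. The antipode reverses the product and cancels against the one
inside the involution, and hermiticity of φ does the rest. -/
theorem ev_dualStar (x : 𝔾.Dual) (a : V) :
    𝔾.ev (𝔾.dualStar x) a = (starRingEnd ℂ) (𝔾.ev x (𝔾.star (𝔾.S a))) := by
  rw [dualStar, convStar, ev_fourier, ← 𝔾.modular.2.2.2.2.1,
    𝔾.φ_modular 𝔾.isModularElement_modular, 𝔾.S_mul, S_star_S, ev_eq, ← φ_star]
  simp

theorem ev_dualStar_dualS_symm (x : 𝔾.Dual) (a : V) :
    𝔾.ev (𝔾.dualStar (𝔾.dualS.symm x)) a = (starRingEnd ℂ) (𝔾.ev x (𝔾.star a)) := by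
  rw [ev_dualStar, ev_dualS_symm, S_star_S]

theorem dualStar_dualStar (x : 𝔾.Dual) : 𝔾.dualStar (𝔾.dualStar x) = x :=
  𝔾.ev_ext fun a => by simp [ev_dualStar, S_star_S]

theorem dualS_symm_dualStar_dualS_symm (x : 𝔾.Dual) :
    𝔾.dualS.symm (𝔾.dualStar (𝔾.dualS.symm x)) = 𝔾.dualStar x :=
  𝔾.ev_ext fun a => by rw [ev_dualS_symm, ev_dualStar_dualS_symm, ev_dualStar]

theorem dualS_dualStar_dualS (x : 𝔾.Dual) : 𝔾.dualS (𝔾.dualStar (𝔾.dualS x)) = 𝔾.dualStar x := by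
  rw [← LinearEquiv.eq_symm_apply, ← 𝔾.dualS_symm_dualStar_dualS_symm (𝔾.dualS x)]
  simp

theorem dualLeft_star (x : 𝔾.Dual) (a : V) :
    𝔾.dualLeft x (𝔾.star a) = 𝔾.star (𝔾.dualLeft (𝔾.dualStar (𝔾.dualS.symm x)) a) :=
  𝔾.eq_of_mul_left fun c => by
    rw [mul_dualLeft, 𝔾.Γ.ρl_tmul, 𝔾.slice₂_starT (𝔾.bdd_evL (𝔾.dualStar (𝔾.dualS.symm x)))
      (𝔾.bdd_evL x) (fun a => by simp [ev_dualStar_dualS_symm]), 𝔾.star_star, ← dualLeft_mul]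
    simp

theorem dualLeft_star_S (x : 𝔾.Dual) (a : V) :
    𝔾.dualLeft x (𝔾.star (𝔾.S a)) = 𝔾.star (𝔾.S (𝔾.dualRight (𝔾.dualStar x) a)) := by
  rw [dualLeft_star, dualLeft_S, dualS_symm_dualStar_dualS_symm]

theorem dualStar_dualMul (x y : 𝔾.Dual) :
    𝔾.dualStar (𝔾.dualMul x y) = 𝔾.dualMul (𝔾.dualStar y) (𝔾.dualStar x) :=
  𝔾.ev_ext fun a => by
    rw [ev_dualStar, ev_dualMul, dualLeft_star_S, ← ev_dualStar, ← ev_dualMul']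

/-! ### The dual algebra -/

/-- Paired with `c`, both sides equal φ(S⁻¹((ι ⊗ 𝔉(c))Δ(g)) f). Expressing the product by γ⁻¹ is
what makes it split. -/
theorem conv_eq_slice₂_γlInv (f g : V) : 𝔾.conv f g = slice₂ 𝔾.φ_bdd (𝔾.γlInv (tmul f g)) := by
  refine 𝔾.eq_of_φ_mul_right fun c => ?_
  have hφ : IsBdd (𝔾.φ ∘ₗ 𝔾.S.symm.toLinearMap) := 𝔾.φ_bdd.comp 𝔾.S_symm_bdd
  have h : ∀ u, slice₂ 𝔾.φ_bdd (flip V V (map (g := LinearMap.id) 𝔾.S_symm_bdd IsBdd.id u)) =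
      slice₁ hφ u := fun u =>
    ext_tmul (f := fun u => slice₂ 𝔾.φ_bdd (flip V V (map (g := LinearMap.id) 𝔾.S_symm_bdd
      IsBdd.id u))) (g := fun u => slice₁ hφ u) (by fun_prop) (by fun_prop)
      (fun p q => by simp) u
  rw [conv_eq, φ_S_dualLeft_mul, γlInv_tmul, h]
  change _ = 𝔾.evL (𝔾.fourier c) _
  rw [slice_comm hφ (𝔾.bdd_evL _), ← mul_dualLeft]
  simp [S_symm_mul]

/-- The map `𝔉 ⊗ 𝔉`. -/
noncomputable def fourierT : CTensor V V →ₗ[ℂ] CTensor 𝔾.Dual 𝔾.Dual :=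
  map (f := 𝔾.fourier.toLinearMap) (g := 𝔾.fourier.toLinearMap) 𝔾.fourier_bdd 𝔾.fourier_bdd

/-- The map `𝔉⁻¹ ⊗ 𝔉⁻¹`. -/
noncomputable def fourierTInv : CTensor 𝔾.Dual 𝔾.Dual →ₗ[ℂ] CTensor V V :=
  map (f := 𝔾.fourier.symm.toLinearMap) (g := 𝔾.fourier.symm.toLinearMap) 𝔾.fourier_symm_bdd
    𝔾.fourier_symm_bdd

@[simp] theorem fourierT_tmul (a b : V) :
    𝔾.fourierT (tmul a b) = tmul (𝔾.fourier a) (𝔾.fourier b) := map_tmul _ _ _ _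

@[simp] theorem fourierTInv_tmul (x y : 𝔾.Dual) :
    𝔾.fourierTInv (tmul x y) = tmul (𝔾.fourier.symm x) (𝔾.fourier.symm y) := map_tmul _ _ _ _

@[fun_prop]
theorem realBdd_fourierT : IsRealBdd fun t => 𝔾.fourierT t := realBdd_map _ _

@[fun_prop]
theorem realBdd_fourierTInv : IsRealBdd fun t => 𝔾.fourierTInv t := realBdd_map _ _

@[simp] theorem fourierT_fourierTInv (t : CTensor 𝔾.Dual 𝔾.Dual) :
    𝔾.fourierT (𝔾.fourierTInv t) = t :=
  ext_tmul (f := fun t => 𝔾.fourierT (𝔾.fourierTInv t)) (g := fun t => t) (by fun_prop)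
    (by fun_prop) (fun x y => by simp) t

@[simp] theorem fourierTInv_fourierT (t : CTensor V V) : 𝔾.fourierTInv (𝔾.fourierT t) = t :=
  ext_tmul (f := fun t => 𝔾.fourierTInv (𝔾.fourierT t)) (g := fun t => t) (by fun_prop)
    (by fun_prop) (fun x y => by simp) t

theorem lift_dualMul_fourierT (t : CTensor V V) :
    lift 𝔾.bdd_dualMul (𝔾.fourierT t) = 𝔾.fourier (slice₂ 𝔾.φ_bdd (𝔾.γlInv t)) :=
  ext_tmul (f := fun t => lift 𝔾.bdd_dualMul (𝔾.fourierT t))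
    (g := fun t => 𝔾.fourier (slice₂ 𝔾.φ_bdd (𝔾.γlInv t)))
    ((realBdd_lift 𝔾.bdd_dualMul).comp 𝔾.realBdd_fourierT) (𝔾.realBdd_fourier.comp (by fun_prop))
    (fun f g => by
      rw [fourierT_tmul, lift_tmul, ← conv_eq_slice₂_γlInv, dualMul]
      simp only [LinearEquiv.symm_apply_apply]) t

/-- A bounded linear section of the product of the dual. -/
noncomputable def mulSection : 𝔾.Dual →ₗ[ℂ] CTensor 𝔾.Dual 𝔾.Dual :=
  𝔾.fourierT ∘ₗ 𝔾.Γ.γl ∘ₗ flip V V ∘ₗ tmulL 𝔾.unitφ ∘ₗ 𝔾.fourier.symm.toLinearMap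

theorem mulSection_apply (x : 𝔾.Dual) :
    𝔾.mulSection x = 𝔾.fourierT (𝔾.Γ.γl (tmul (𝔾.fourier.symm x) 𝔾.unitφ)) := by
  rw [← flip_tmul]; rfl

@[fun_prop]
theorem realBdd_mulSection : IsRealBdd fun x => 𝔾.mulSection x := by
  simp only [mulSection_apply]; fun_prop

/-- The section applies γ to the representative of `x` tensored with u; the product undoes γ and
integrates u to one. -/
theorem lift_dualMul_mulSection (x : 𝔾.Dual) : lift 𝔾.bdd_dualMul (𝔾.mulSection x) = x := by
  rw [mulSection_apply, lift_dualMul_fourierT, γlInv_γl, slice₂_tmul]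
  simp

/-- The dual as a bornological `*`-algebra. -/
noncomputable def dualAlgebra : BornStarAlgebra 𝔾.Dual where
  mul := 𝔾.dualMul
  bdd_mul := 𝔾.bdd_dualMul
  mul_assoc := 𝔾.dualMul_assoc
  essential := .of_section 𝔾.mulSection 𝔾.realBdd_mulSection.bdd 𝔾.lift_dualMul_mulSection
  star := 𝔾.dualStar
  star_add := 𝔾.realBdd_dualStar.map_add
  star_smul := 𝔾.dualStar_smul
  star_star := 𝔾.dualStar_dualStar
  star_mul := 𝔾.dualStar_dualMul
  star_bdd := 𝔾.realBdd_dualStar.bdd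

@[simp] theorem dualAlgebra_mul (x y : 𝔾.Dual) : 𝔾.dualAlgebra.mul x y = 𝔾.dualMul x y := rfl

@[simp] theorem dualAlgebra_star (x : 𝔾.Dual) : 𝔾.dualAlgebra.star x = 𝔾.dualStar x := rfl

theorem dual_approximation : HasApproximationProperty 𝔾.Dual :=
  𝔾.approximation.of_equiv 𝔾.fourier 𝔾.fourier_bdd 𝔾.fourier_symm_bdd

end BornQuantumGroup

end

section

variable {V : Type u} [AddCommGroup V] [Module ℂ V] [Bornology V]

namespace BornQuantumGroup

open CTensor

variable [CompleteBornSpace V] (𝔾 : BornQuantumGroup V)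

/-! ### The pairing of `Â ⊗̂ Â` and `A ⊗ A` -/

/-- Evaluation at `a`, as a functional on the dual. -/
noncomputable def evR (a : V) : 𝔾.Dual →ₗ[ℂ] ℂ where
  toFun x := 𝔾.ev x a
  map_add' _ _ := rfl
  map_smul' _ _ := rfl

@[simp] theorem evR_apply (a : V) (x : 𝔾.Dual) : 𝔾.evR a x = 𝔾.ev x a := rfl

theorem bdd_evR (a : V) : IsBdd (𝔾.evR a) := (𝔾.realBdd_ev_left a).bdd

@[simp] theorem evT_tmul (a b : V) (x y : 𝔾.Dual) :
    𝔾.evT a b (tmul x y) = 𝔾.ev x a * 𝔾.ev y b := lift_tmul _ _ _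

@[fun_prop]
theorem realBdd_evT (a b : V) : IsRealBdd fun t => 𝔾.evT a b t := realBdd_lift _

theorem evT_bdd (a b : V) : IsBdd (𝔾.evT a b) := lift_bdd _

theorem evT_eq (a b : V) (t : CTensor 𝔾.Dual 𝔾.Dual) :
    𝔾.evT a b t = 𝔾.ev (slice₂ (𝔾.bdd_evR b) t) a :=
  ext_tmul (f := fun t => 𝔾.evT a b t) (g := fun t => 𝔾.ev (slice₂ (𝔾.bdd_evR b) t) a)
    (by fun_prop) (by fun_prop) (fun x y => by
      rw [evT_tmul, slice₂_tmul, mul_comm]; rfl) t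

theorem ev_zero (a : V) : 𝔾.ev 0 a = 0 := rfl

/-- The approximation property is transported by 𝔉, and evaluations at points of A separate the
functionals in the dual. -/
theorem eq_of_evT {s t : CTensor 𝔾.Dual 𝔾.Dual} (h : ∀ a b, 𝔾.evT a b s = 𝔾.evT a b t) :
    s = t := by
  refine sub_eq_zero.1 (eq_zero_of_slice₂ 𝔾.dual_approximation 𝔾.evR 𝔾.bdd_evR (fun x hx => ?_) _
    fun b => 𝔾.ev_ext fun a => ?_)
  · exact 𝔾.ev_ext hx
  · rw [← evT_eq, map_sub, h, sub_self, ev_zero]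

/-- Multiplication in the dual is transposed to slicing in A. Through such rules, products in Â ⊗̂ Â
become substitutions in the pairing. -/
theorem evT_right₁ (a b : V) (z : 𝔾.Dual) (s : CTensor 𝔾.Dual 𝔾.Dual) :
    𝔾.evT a b (𝔾.dualAlgebra.right₁ z s) = 𝔾.evT (𝔾.dualLeft z a) b s :=
  ext_tmul (f := fun s => 𝔾.evT a b (𝔾.dualAlgebra.right₁ z s))
    (g := fun s => 𝔾.evT (𝔾.dualLeft z a) b s) (by fun_prop) (by fun_prop)
    (fun x y => by simp [ev_dualMul]) s

theorem evT_right₂ (a b : V) (z : 𝔾.Dual) (s : CTensor 𝔾.Dual 𝔾.Dual) :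
    𝔾.evT a b (𝔾.dualAlgebra.right₂ z s) = 𝔾.evT a (𝔾.dualLeft z b) s :=
  ext_tmul (f := fun s => 𝔾.evT a b (𝔾.dualAlgebra.right₂ z s))
    (g := fun s => 𝔾.evT a (𝔾.dualLeft z b) s) (by fun_prop) (by fun_prop)
    (fun x y => by simp [ev_dualMul]) s

theorem evT_left₁ (a b : V) (z : 𝔾.Dual) (s : CTensor 𝔾.Dual 𝔾.Dual) :
    𝔾.evT a b (𝔾.dualAlgebra.left₁ z s) = 𝔾.evT (𝔾.dualRight z a) b s :=
  ext_tmul (f := fun s => 𝔾.evT a b (𝔾.dualAlgebra.left₁ z s))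
    (g := fun s => 𝔾.evT (𝔾.dualRight z a) b s) (by fun_prop) (by fun_prop)
    (fun x y => by simp [ev_dualMul']) s

theorem evT_left₂ (a b : V) (z : 𝔾.Dual) (s : CTensor 𝔾.Dual 𝔾.Dual) :
    𝔾.evT a b (𝔾.dualAlgebra.left₂ z s) = 𝔾.evT a (𝔾.dualRight z b) s :=
  ext_tmul (f := fun s => 𝔾.evT a b (𝔾.dualAlgebra.left₂ z s))
    (g := fun s => 𝔾.evT a (𝔾.dualRight z b) s) (by fun_prop) (by fun_prop)
    (fun x y => by simp [ev_dualMul']) s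

theorem evT_mulT_right (a b : V) (z w : 𝔾.Dual) (s : CTensor 𝔾.Dual 𝔾.Dual) :
    𝔾.evT a b (𝔾.dualAlgebra.mulT s (tmul z w)) =
      𝔾.evT (𝔾.dualLeft z a) (𝔾.dualLeft w b) s := by
  rw [𝔾.dualAlgebra.mulT_tmul_right, evT_right₁, evT_right₂]

theorem evT_mulT_left (a b : V) (z w : 𝔾.Dual) (s : CTensor 𝔾.Dual 𝔾.Dual) :
    𝔾.evT a b (𝔾.dualAlgebra.mulT (tmul z w) s) =
      𝔾.evT (𝔾.dualRight z a) (𝔾.dualRight w b) s := by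
  rw [𝔾.dualAlgebra.mulT_tmul_left, evT_left₁, evT_left₂]

theorem evT_starT (a b : V) (s : CTensor 𝔾.Dual 𝔾.Dual) :
    𝔾.evT a b (𝔾.dualAlgebra.starT s) =
      (starRingEnd ℂ) (𝔾.evT (𝔾.star (𝔾.S a)) (𝔾.star (𝔾.S b)) s) :=
  ext_tmul (f := fun s => 𝔾.evT a b (𝔾.dualAlgebra.starT s))
    (g := fun s => (starRingEnd ℂ) (𝔾.evT (𝔾.star (𝔾.S a)) (𝔾.star (𝔾.S b)) s)) (by fun_prop)
    (by fun_prop) (fun x y => by simp [ev_dualStar]) s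

/-- The pairing of `Â ⊗̂ (Â ⊗̂ Â)` with `a ⊗ (b ⊗ c)`. -/
noncomputable def evT₃ (a b c : V) : CTensor 𝔾.Dual (CTensor 𝔾.Dual 𝔾.Dual) →ₗ[ℂ] ℂ :=
  𝔾.evR a ∘ₗ slice₂ (𝔾.evT_bdd b c)

@[simp] theorem evT₃_tmul (a b c : V) (x : 𝔾.Dual) (s : CTensor 𝔾.Dual 𝔾.Dual) :
    𝔾.evT₃ a b c (tmul x s) = 𝔾.ev x a * 𝔾.evT b c s := by
  rw [evT₃, LinearMap.comp_apply, slice₂_tmul, map_smul, smul_eq_mul, mul_comm]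
  rfl

@[fun_prop]
theorem realBdd_evT₃ (a b c : V) : IsRealBdd fun t => 𝔾.evT₃ a b c t :=
  (IsRealBdd.of_linear _ (𝔾.bdd_evR a)).comp (realBdd_slice₂ (𝔾.evT_bdd b c))

theorem eq_of_evT₃ {s t : CTensor 𝔾.Dual (CTensor 𝔾.Dual 𝔾.Dual)}
    (h : ∀ a b c, 𝔾.evT₃ a b c s = 𝔾.evT₃ a b c t) : s = t := by
  refine sub_eq_zero.1 (eq_zero_of_slice₂ 𝔾.dual_approximation (fun p : V × V => 𝔾.evT p.1 p.2)
    (fun p => 𝔾.evT_bdd p.1 p.2) (fun u hu => ?_) _ fun p => 𝔾.ev_ext fun a => ?_)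
  · exact 𝔾.eq_of_evT fun a b => (hu (a, b)).trans (map_zero _).symm
  · change 𝔾.evT₃ a p.1 p.2 (s - t) = 0
    rw [map_sub, h, sub_self]

theorem evT₃_mulT₃_right (a b c : V) (z w v : 𝔾.Dual)
    (s : CTensor 𝔾.Dual (CTensor 𝔾.Dual 𝔾.Dual)) :
    𝔾.evT₃ a b c (𝔾.dualAlgebra.mulT₃ s (tmul z (tmul w v))) =
      𝔾.evT₃ (𝔾.dualLeft z a) (𝔾.dualLeft w b) (𝔾.dualLeft v c) s :=
  ext_tmul (f := fun s => 𝔾.evT₃ a b c (𝔾.dualAlgebra.mulT₃ s (tmul z (tmul w v))))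
    (g := fun s => 𝔾.evT₃ (𝔾.dualLeft z a) (𝔾.dualLeft w b) (𝔾.dualLeft v c) s) (by fun_prop)
    (by fun_prop) (fun x t => by simp [ev_dualMul, evT_mulT_right]) s

theorem evT₃_mulT₃_left (a b c : V) (z w v : 𝔾.Dual)
    (s : CTensor 𝔾.Dual (CTensor 𝔾.Dual 𝔾.Dual)) :
    𝔾.evT₃ a b c (𝔾.dualAlgebra.mulT₃ (tmul z (tmul w v)) s) =
      𝔾.evT₃ (𝔾.dualRight z a) (𝔾.dualRight w b) (𝔾.dualRight v c) s :=
  ext_tmul (f := fun s => 𝔾.evT₃ a b c (𝔾.dualAlgebra.mulT₃ (tmul z (tmul w v)) s))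
    (g := fun s => 𝔾.evT₃ (𝔾.dualRight z a) (𝔾.dualRight w b) (𝔾.dualRight v c) s) (by fun_prop)
    (by fun_prop) (fun x t => by simp [ev_dualMul', evT_mulT_left]) s

/-! ### The Galois map of the dual -/

theorem slice₂_φ_Δ_γl (a : V) (t : CTensor V V) :
    slice₂ 𝔾.φ_bdd ((𝔾.Γ.Δ a).1.1 (𝔾.Γ.γl t)) = slice₁ (𝔾.bdd_φ_mulLeft a) t :=
  ext_tmul (f := fun s => slice₂ 𝔾.φ_bdd ((𝔾.Γ.Δ a).1.1 (𝔾.Γ.γl s)))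
    (g := fun s => slice₁ (𝔾.bdd_φ_mulLeft a) s) (by fun_prop) (by fun_prop)
    (fun p q => by
      rw [Δ_left_γl, slice₂_φ_γl, slice₁_tmul]
      rfl) t

theorem slice₂_φ_Δ_tmul (a f g : V) :
    slice₂ 𝔾.φ_bdd ((𝔾.Γ.Δ a).1.1 (tmul f g)) = 𝔾.mul (𝔾.dualLeft (𝔾.fourier g) a) f := by
  rw [Δ_left_tmul', 𝔾.slice₂_right₁, dualLeft_fourier]

theorem evT_fourierT (a b : V) (t : CTensor V V) :
    𝔾.evT a b (𝔾.fourierT t) = 𝔾.φ (𝔾.mul b (slice₁ (𝔾.bdd_φ_mulLeft a) t)) :=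
  ext_tmul (f := fun t => 𝔾.evT a b (𝔾.fourierT t))
    (g := fun t => 𝔾.φ (𝔾.mul b (slice₁ (𝔾.bdd_φ_mulLeft a) t))) (by fun_prop) (by fun_prop)
    (fun p q => by
      rw [slice₁_tmul, 𝔾.bdd_mul.smul_right, map_smul]
      simp [ev_fourier, BornStarAlgebra.mulLeft]) t

/-- The Galois map `x ⊗ y ↦ Δ(x) (y ⊗ 1)` of the dual. -/
noncomputable def dualγ : CTensor 𝔾.Dual 𝔾.Dual →ₗ[ℂ] CTensor 𝔾.Dual 𝔾.Dual :=
  𝔾.fourierT ∘ₗ 𝔾.γlInv ∘ₗ 𝔾.fourierTInv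

/-- The inverse of the Galois map of the dual. -/
noncomputable def dualγInv : CTensor 𝔾.Dual 𝔾.Dual →ₗ[ℂ] CTensor 𝔾.Dual 𝔾.Dual :=
  𝔾.fourierT ∘ₗ 𝔾.Γ.γl ∘ₗ 𝔾.fourierTInv

theorem dualγ_apply (t : CTensor 𝔾.Dual 𝔾.Dual) :
    𝔾.dualγ t = 𝔾.fourierT (𝔾.γlInv (𝔾.fourierTInv t)) := rfl

theorem dualγInv_apply (t : CTensor 𝔾.Dual 𝔾.Dual) :
    𝔾.dualγInv t = 𝔾.fourierT (𝔾.Γ.γl (𝔾.fourierTInv t)) := rfl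

@[fun_prop]
theorem realBdd_dualγ : IsRealBdd fun t => 𝔾.dualγ t := by
  simp only [dualγ_apply]; fun_prop

@[fun_prop]
theorem realBdd_dualγInv : IsRealBdd fun t => 𝔾.dualγInv t := by
  simp only [dualγInv_apply]; fun_prop

@[simp] theorem dualγ_dualγInv (t : CTensor 𝔾.Dual 𝔾.Dual) : 𝔾.dualγ (𝔾.dualγInv t) = t := by
  simp [dualγ_apply, dualγInv_apply]

/-- The integral against `a` of the first leg of γ⁻¹(s) is (ι ⊗ φ)(Δ(a)s), by left invariance. The
outcome is the pairing that skew duality prescribes for Δ̂(x)(z ⊗ 1), which identifies `dualγ` as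
the Galois map. -/
theorem evT_dualγ (a b : V) (x z : 𝔾.Dual) :
    𝔾.evT a b (𝔾.dualγ (tmul x z)) = 𝔾.ev x (𝔾.mul b (𝔾.dualLeft z a)) := by
  rw [dualγ_apply, evT_fourierT, ← slice₂_φ_Δ_γl, γl_γlInv, fourierTInv_tmul, slice₂_φ_Δ_tmul,
    ev_eq, 𝔾.mul_assoc]
  simp

theorem dualγ_mul (x z z' : 𝔾.Dual) :
    𝔾.dualγ (tmul x (𝔾.dualMul z z')) = 𝔾.dualAlgebra.right₁ z' (𝔾.dualγ (tmul x z)) :=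
  𝔾.eq_of_evT fun a b => by rw [evT_right₁, evT_dualγ, evT_dualγ, dualLeft_dualMul]

end BornQuantumGroup

end

section

theorem IsBddBilin.postcomp_conj {V W X Y : Type*} [AddCommGroup V] [Module ℂ V] [Bornology V]
    [AddCommGroup W] [Module ℂ W] [Bornology W] [AddCommGroup X] [Module ℂ X] [Bornology X]
    [AddCommGroup Y] [Module ℂ Y] [Bornology Y]
    {β : V → W → X} (h : IsBddBilin (starRingEnd ℂ) β)
    {f : X →ₛₗ[starRingEnd ℂ] Y} (hf : IsBdd f) :
    IsBddBilin (RingHom.id ℂ) fun v w => f (β v w) where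
  add_left a a' b := by rw [h.add_left, map_add]
  add_right a b b' := by rw [h.add_right, map_add]
  smul_left c a b := by rw [h.smul_left, LinearMap.map_smulₛₗ]; simp
  smul_right c a b := by rw [h.smul_right, LinearMap.map_smulₛₗ]; simp
  bdd s t hs ht := (hf _ (h.bdd s t hs ht)).subset (by
    rintro _ ⟨a, ha, b, hb, rfl⟩
    exact ⟨_, ⟨a, ha, b, hb, rfl⟩, rfl⟩)

section

variable {V : Type u} [AddCommGroup V] [Module ℂ V] [Bornology V] [CompleteBornSpace V]

/-! ### Involution on the threefold tensor product -/

namespace BornStarAlgebra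

open CTensor

variable (𝒜 : BornStarAlgebra V)

theorem starT_bdd : IsBdd 𝒜.starT := lift_bdd _

theorem bdd_star₃ : IsBddBilin (starRingEnd ℂ)
    fun a t => (tmul (𝒜.star a) (𝒜.starT t) : CTensor V (CTensor V V)) :=
  isBddBilin_tmul.comp 𝒜.star_bdd 𝒜.starT_bdd 𝒜.star_add 𝒜.star_smul (map_add _)
    (LinearMap.map_smulₛₗ _)

/-- The involution `a ⊗ t ↦ a̅ ⊗ t̅` of `A ⊗̂ (A ⊗̂ A)`. -/
noncomputable def star₃ : CTensor V (CTensor V V) →ₛₗ[starRingEnd ℂ] CTensor V (CTensor V V) :=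
  lift 𝒜.bdd_star₃

theorem star₃_bdd : IsBdd 𝒜.star₃ := lift_bdd _

@[simp] theorem star₃_tmul (a : V) (t : CTensor V V) :
    𝒜.star₃ (tmul a t) = tmul (𝒜.star a) (𝒜.starT t) := lift_tmul _ _ _

@[fun_prop]
theorem realBdd_star₃ : IsRealBdd fun t => 𝒜.star₃ t := .of_antilinear _ 𝒜.star₃_bdd

@[simp] theorem star₃_star₃ (t : CTensor V (CTensor V V)) : 𝒜.star₃ (𝒜.star₃ t) = t :=
  ext_tmul (f := fun t => 𝒜.star₃ (𝒜.star₃ t)) (g := fun t => t) (by fun_prop) (by fun_prop)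
    (fun v w => by simp) t

theorem star₃_mulT₃ (s t : CTensor V (CTensor V V)) :
    𝒜.star₃ (𝒜.mulT₃ s t) = 𝒜.mulT₃ (𝒜.star₃ t) (𝒜.star₃ s) :=
  ext_tmul₂ (f := fun s t => 𝒜.star₃ (𝒜.mulT₃ s t))
    (g := fun s t => 𝒜.mulT₃ (𝒜.star₃ t) (𝒜.star₃ s)) (by intro; fun_prop) (by intro; fun_prop)
    (by intro; fun_prop) (by intro; fun_prop) (fun a b c d => by simp [starT_mulT]) s t

end BornStarAlgebra

namespace BornQuantumGroup

open CTensor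

variable (𝔾 : BornQuantumGroup V)

/-! ### The coproduct of the dual -/

/-- The product of the dual on the completed tensor product. -/
noncomputable def dualMulL : CTensor 𝔾.Dual 𝔾.Dual →ₗ[ℂ] 𝔾.Dual := lift 𝔾.bdd_dualMul

theorem dualMulL_bdd : IsBdd 𝔾.dualMulL := lift_bdd _

@[simp] theorem dualMulL_tmul (x y : 𝔾.Dual) : 𝔾.dualMulL (tmul x y) = 𝔾.dualMul x y :=
  lift_tmul _ _ _

theorem dualγ_bdd : IsBdd 𝔾.dualγ := 𝔾.realBdd_dualγ.bdd

theorem dualγInv_bdd : IsBdd 𝔾.dualγInv := 𝔾.realBdd_dualγInv.bdd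

theorem mulSection_bdd : IsBdd 𝔾.mulSection := 𝔾.realBdd_mulSection.bdd

/-- The map `x ⊗ t ↦ Δ(x) t` of the dual. -/
noncomputable def comulAct :
    CTensor 𝔾.Dual (CTensor 𝔾.Dual 𝔾.Dual) →ₗ[ℂ] CTensor 𝔾.Dual 𝔾.Dual :=
  map (f := LinearMap.id) IsBdd.id 𝔾.dualMulL_bdd ∘ₗ assoc 𝔾.Dual 𝔾.Dual 𝔾.Dual ∘ₗ
    map (g := LinearMap.id) 𝔾.dualγ_bdd IsBdd.id ∘ₗ assocInv 𝔾.Dual 𝔾.Dual 𝔾.Dual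

theorem comulAct_apply (t : CTensor 𝔾.Dual (CTensor 𝔾.Dual 𝔾.Dual)) :
    𝔾.comulAct t = map (f := LinearMap.id) IsBdd.id 𝔾.dualMulL_bdd (assoc 𝔾.Dual 𝔾.Dual 𝔾.Dual
      (map (g := LinearMap.id) 𝔾.dualγ_bdd IsBdd.id (assocInv 𝔾.Dual 𝔾.Dual 𝔾.Dual t))) := rfl

@[fun_prop]
theorem realBdd_comulAct : IsRealBdd fun t => 𝔾.comulAct t := by
  simp only [comulAct_apply]; fun_prop

theorem comulAct_bdd : IsBdd 𝔾.comulAct := 𝔾.realBdd_comulAct.bdd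

theorem map_dualMulL_assoc (s : CTensor 𝔾.Dual 𝔾.Dual) (w : 𝔾.Dual) :
    map (f := LinearMap.id) IsBdd.id 𝔾.dualMulL_bdd (assoc 𝔾.Dual 𝔾.Dual 𝔾.Dual (tmul s w)) =
      𝔾.dualAlgebra.right₂ w s :=
  ext_tmul (f := fun s => map (f := LinearMap.id) IsBdd.id 𝔾.dualMulL_bdd
      (assoc 𝔾.Dual 𝔾.Dual 𝔾.Dual (tmul s w))) (g := fun s => 𝔾.dualAlgebra.right₂ w s)
    (by fun_prop) (by fun_prop) (fun x y => by simp) s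

theorem comulAct_tmul (x z w : 𝔾.Dual) :
    𝔾.comulAct (tmul x (tmul z w)) = 𝔾.dualAlgebra.right₂ w (𝔾.dualγ (tmul x z)) := by
  rw [comulAct_apply, assocInv_tmul_tmul, map_tmul, LinearMap.id_apply, map_dualMulL_assoc]

/-- A bounded section of the map `x ⊗ t ↦ Δ(x) t`. -/
noncomputable def comulSection (t : CTensor 𝔾.Dual 𝔾.Dual) :
    CTensor 𝔾.Dual (CTensor 𝔾.Dual 𝔾.Dual) :=
  assoc 𝔾.Dual 𝔾.Dual 𝔾.Dual (map (g := LinearMap.id) 𝔾.dualγInv_bdd IsBdd.id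
    (assocInv 𝔾.Dual 𝔾.Dual 𝔾.Dual (map (f := LinearMap.id) IsBdd.id 𝔾.mulSection_bdd t)))

@[fun_prop]
theorem realBdd_comulSection : IsRealBdd fun t => 𝔾.comulSection t := by
  unfold comulSection; fun_prop

/-- The section splits the second leg by `mulSection` and then undoes the dual Galois map, inverting
the two stages of `comulAct` in turn. -/
theorem comulAct_comulSection (t : CTensor 𝔾.Dual 𝔾.Dual) :
    𝔾.comulAct (𝔾.comulSection t) = t := by
  have h₁ : ∀ s : CTensor (CTensor 𝔾.Dual 𝔾.Dual) 𝔾.Dual,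
      map (g := LinearMap.id) 𝔾.dualγ_bdd IsBdd.id
      (map (g := LinearMap.id) 𝔾.dualγInv_bdd IsBdd.id s) = s := fun s =>
    ext_tmul (f := fun s : CTensor (CTensor 𝔾.Dual 𝔾.Dual) 𝔾.Dual =>
      map (g := LinearMap.id) 𝔾.dualγ_bdd IsBdd.id
      (map (g := LinearMap.id) 𝔾.dualγInv_bdd IsBdd.id s)) (g := fun s => s) (by fun_prop)
      (by fun_prop) (fun x y => by simp) s
  have h₂ : ∀ s : CTensor 𝔾.Dual 𝔾.Dual, map (f := LinearMap.id) IsBdd.id 𝔾.dualMulL_bdd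
      (map (f := LinearMap.id) IsBdd.id 𝔾.mulSection_bdd s) = s := fun s =>
    ext_tmul (f := fun s : CTensor 𝔾.Dual 𝔾.Dual =>
      map (f := LinearMap.id) IsBdd.id 𝔾.dualMulL_bdd
      (map (f := LinearMap.id) IsBdd.id 𝔾.mulSection_bdd s)) (g := fun s => s) (by fun_prop)
      (by fun_prop) (fun x y => by
        rw [map_tmul, map_tmul]
        exact congrArg (tmul x) (𝔾.lift_dualMul_mulSection y)) s
  rw [comulAct_apply, comulSection, assocInv_assoc, h₁, assoc_assocInv, h₂]

/-- The left multiplication by the coproduct of an element of the dual. -/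
noncomputable def comulLeft (x : 𝔾.Dual) : CTensor 𝔾.Dual 𝔾.Dual →ₗ[ℂ] CTensor 𝔾.Dual 𝔾.Dual :=
  𝔾.comulAct ∘ₗ tmulL x

theorem comulLeft_apply (x : 𝔾.Dual) (t : CTensor 𝔾.Dual 𝔾.Dual) :
    𝔾.comulLeft x t = 𝔾.comulAct (tmul x t) := rfl

/-- The right multiplication by the coproduct of an element of the dual. -/
noncomputable def comulRight (x : 𝔾.Dual) :
    CTensor 𝔾.Dual 𝔾.Dual →ₗ[ℂ] CTensor 𝔾.Dual 𝔾.Dual where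
  toFun t := 𝔾.dualAlgebra.starT (𝔾.comulLeft (𝔾.dualStar x) (𝔾.dualAlgebra.starT t))
  map_add' s t := by simp only [map_add]
  map_smul' c t := by simp

theorem comulRight_apply (x : 𝔾.Dual) (t : CTensor 𝔾.Dual 𝔾.Dual) : 𝔾.comulRight x t =
    𝔾.dualAlgebra.starT (𝔾.comulLeft (𝔾.dualStar x) (𝔾.dualAlgebra.starT t)) := rfl

theorem bdd_comulLeft : IsBddBilin (RingHom.id ℂ) fun x t => 𝔾.comulLeft x t :=
  isBddBilin_tmul.postcomp 𝔾.comulAct_bdd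

theorem bdd_comulRight : IsBddBilin (RingHom.id ℂ) fun x t => 𝔾.comulRight x t :=
  (𝔾.bdd_comulLeft.comp 𝔾.dualAlgebra.star_bdd 𝔾.dualAlgebra.starT_bdd 𝔾.dualAlgebra.star_add
    𝔾.dualAlgebra.star_smul (map_add _) (LinearMap.map_smulₛₗ _)).postcomp_conj
    𝔾.dualAlgebra.starT_bdd

@[fun_prop]
theorem realBdd_comulLeft (x : 𝔾.Dual) : IsRealBdd fun t => 𝔾.comulLeft x t :=
  𝔾.bdd_comulLeft.realBdd_right x

@[fun_prop]
theorem realBdd_comulRight (x : 𝔾.Dual) : IsRealBdd fun t => 𝔾.comulRight x t :=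
  𝔾.bdd_comulRight.realBdd_right x

theorem comulLeft_tmul (x z w : 𝔾.Dual) :
    𝔾.comulLeft x (tmul z w) = 𝔾.dualAlgebra.right₂ w (𝔾.dualγ (tmul x z)) :=
  𝔾.comulAct_tmul x z w

theorem evT_comulLeft (a b : V) (x z w : 𝔾.Dual) :
    𝔾.evT a b (𝔾.comulLeft x (tmul z w)) =
      𝔾.ev x (𝔾.mul (𝔾.dualLeft w b) (𝔾.dualLeft z a)) := by
  rw [comulLeft_tmul, evT_right₂, evT_dualγ]

/-- Right multiplication is defined by conjugating the left one; the antilinear map a ↦ S(a)‾ turns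
left slices into right slices and preserves the order of products. -/
theorem evT_comulRight (a b : V) (x z w : 𝔾.Dual) :
    𝔾.evT a b (𝔾.comulRight x (tmul z w)) =
      𝔾.ev x (𝔾.mul (𝔾.dualRight w b) (𝔾.dualRight z a)) := by
  rw [comulRight_apply, evT_starT, BornStarAlgebra.starT_tmul, evT_comulLeft]
  simp only [dualAlgebra_star, dualLeft_star_S, dualStar_dualStar]
  rw [← 𝔾.star_mul, ← 𝔾.S_mul, ← ev_dualStar, dualStar_dualStar]

theorem comulLeft_mulT (x : 𝔾.Dual) (s t : CTensor 𝔾.Dual 𝔾.Dual) :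
    𝔾.comulLeft x (𝔾.dualAlgebra.mulT s t) = 𝔾.dualAlgebra.mulT (𝔾.comulLeft x s) t :=
  ext_tmul₂ (f := fun s t => 𝔾.comulLeft x (𝔾.dualAlgebra.mulT s t))
    (g := fun s t => 𝔾.dualAlgebra.mulT (𝔾.comulLeft x s) t) (by intro; fun_prop)
    (by intro; fun_prop) (by intro; fun_prop) (by intro; fun_prop) (fun z w z' w' =>
      𝔾.eq_of_evT fun a b => by
        rw [𝔾.dualAlgebra.mulT_tmul, evT_comulLeft, evT_mulT_right, evT_comulLeft]
        simp [dualLeft_dualMul]) s t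

theorem comulRight_mulT (x : 𝔾.Dual) (s t : CTensor 𝔾.Dual 𝔾.Dual) :
    𝔾.comulRight x (𝔾.dualAlgebra.mulT s t) = 𝔾.dualAlgebra.mulT s (𝔾.comulRight x t) := by
  rw [comulRight_apply, BornStarAlgebra.starT_mulT, comulLeft_mulT, BornStarAlgebra.starT_mulT,
    BornStarAlgebra.starT_starT, comulRight_apply]

/-- In the pairing the two sides differ only in the order of left and right slices, which commute.
-/
theorem mulT_comul (x : 𝔾.Dual) (s t : CTensor 𝔾.Dual 𝔾.Dual) :
    𝔾.dualAlgebra.mulT (𝔾.comulRight x s) t = 𝔾.dualAlgebra.mulT s (𝔾.comulLeft x t) :=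
  ext_tmul₂ (f := fun s t => 𝔾.dualAlgebra.mulT (𝔾.comulRight x s) t)
    (g := fun s t => 𝔾.dualAlgebra.mulT s (𝔾.comulLeft x t)) (by intro; fun_prop)
    (by intro; fun_prop) (by intro; fun_prop) (by intro; fun_prop) (fun z w z' w' =>
      𝔾.eq_of_evT fun a b => by
        rw [evT_mulT_right, evT_comulRight, evT_mulT_left, evT_comulLeft, dualRight_dualLeft,
          dualRight_dualLeft]) s t

/-- The coproduct of the dual. -/
noncomputable def dualΔ : 𝔾.Dual →ₗ[ℂ] multipliers 𝔾.dualAlgebra.bdd_mulT where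
  toFun x := ⟨(𝔾.comulLeft x, 𝔾.comulRight x), (𝔾.realBdd_comulLeft x).bdd,
    (𝔾.realBdd_comulRight x).bdd, 𝔾.comulLeft_mulT x, 𝔾.comulRight_mulT x, 𝔾.mulT_comul x⟩
  map_add' x y := Subtype.ext (Prod.ext (LinearMap.ext (𝔾.bdd_comulLeft.add_left x y))
    (LinearMap.ext (𝔾.bdd_comulRight.add_left x y)))
  map_smul' c x := Subtype.ext (Prod.ext (LinearMap.ext (𝔾.bdd_comulLeft.smul_left c x))
    (LinearMap.ext (𝔾.bdd_comulRight.smul_left c x)))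

/-- The product `(ι ⊗ y)(Δ(b)) (ι ⊗ x)(Δ(a))` attached to `x ⊗ y`. -/
noncomputable def dualLeftProd (a b : V) : CTensor 𝔾.Dual 𝔾.Dual →ₗ[ℂ] V :=
  lift (β := fun x y => 𝔾.mul (𝔾.dualLeft y b) (𝔾.dualLeft x a))
    (𝔾.bdd_mul.swap.comp (τ := RingHom.id ℂ) (f := fun x => 𝔾.dualLeft x a)
      (g := fun y => 𝔾.dualLeft y b) (𝔾.realBdd_dualLeft' a).bdd (𝔾.realBdd_dualLeft' b).bdd
      (𝔾.realBdd_dualLeft' a).map_add (fun c x => by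
        simp only [dualLeft, map_smul, isBddBilin_tmul.smul_right, RingHom.id_apply, 𝔾.Γ.γr_smul])
      (𝔾.realBdd_dualLeft' b).map_add (fun c x => by
        simp only [dualLeft, map_smul, isBddBilin_tmul.smul_right, RingHom.id_apply,
          𝔾.Γ.γr_smul]))

@[simp] theorem dualLeftProd_tmul (a b : V) (x y : 𝔾.Dual) :
    𝔾.dualLeftProd a b (tmul x y) = 𝔾.mul (𝔾.dualLeft y b) (𝔾.dualLeft x a) := lift_tmul _ _ _

@[fun_prop]
theorem realBdd_dualLeftProd (a b : V) : IsRealBdd fun s => 𝔾.dualLeftProd a b s :=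
  realBdd_lift _

theorem evT_comulLeft' (a b : V) (x : 𝔾.Dual) (s : CTensor 𝔾.Dual 𝔾.Dual) :
    𝔾.evT a b (𝔾.comulLeft x s) = 𝔾.ev x (𝔾.dualLeftProd a b s) :=
  ext_tmul (f := fun s => 𝔾.evT a b (𝔾.comulLeft x s))
    (g := fun s => 𝔾.ev x (𝔾.dualLeftProd a b s)) (by fun_prop) (by fun_prop)
    (fun z w => by rw [evT_comulLeft, dualLeftProd_tmul]) s

theorem dualLeftProd_right₂ (a b : V) (w : 𝔾.Dual) (s : CTensor 𝔾.Dual 𝔾.Dual) :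
    𝔾.dualLeftProd a b (𝔾.dualAlgebra.right₂ w s) = 𝔾.dualLeftProd a (𝔾.dualLeft w b) s :=
  ext_tmul (f := fun s => 𝔾.dualLeftProd a b (𝔾.dualAlgebra.right₂ w s))
    (g := fun s => 𝔾.dualLeftProd a (𝔾.dualLeft w b) s) (by fun_prop) (by fun_prop)
    (fun z w => by simp [dualLeft_dualMul]) s

theorem bdd_sliceΔ : IsBddBilin (RingHom.id ℂ)
    fun (a : V) (s : CTensor V V) => slice₂ 𝔾.φ_bdd ((𝔾.Γ.Δ a).1.1 s) :=
  𝔾.Γ.hom.bdd_left.postcomp (lift_bdd (isBddBilin_slice₂ 𝔾.φ_bdd))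

/-- The map `r ⊗ v, s ↦ r ⊗ (ι ⊗ φ)(Δ(v) s)`. -/
noncomputable def sliceΔ (w s : CTensor V V) : CTensor V V :=
  act (isBddBilin_smul (V := V)).swap 𝔾.bdd_sliceΔ w (tmul (1 : ℂ) s)

theorem sliceΔ_tmul (r v : V) (s : CTensor V V) :
    𝔾.sliceΔ (tmul r v) s = tmul r (slice₂ 𝔾.φ_bdd ((𝔾.Γ.Δ v).1.1 s)) := by
  rw [sliceΔ, act_tmul, one_smul]

@[fun_prop]
theorem realBdd_sliceΔ_left (s : CTensor V V) : IsRealBdd fun w => 𝔾.sliceΔ w s :=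
  realBdd_act_left _ _ _

@[fun_prop]
theorem realBdd_sliceΔ_right (w : CTensor V V) : IsRealBdd fun s => 𝔾.sliceΔ w s :=
  (realBdd_act_right _ _ w).comp (realBdd_tmul_right _)

theorem sliceΔ_γl (w : CTensor V V) (p q : V) :
    𝔾.sliceΔ w (𝔾.Γ.γl (tmul p q)) = tmul (slice₂ (𝔾.bdd_evL (𝔾.fourier p)) w) q :=
  ext_tmul (f := fun w => 𝔾.sliceΔ w (𝔾.Γ.γl (tmul p q)))
    (g := fun w => tmul (slice₂ (𝔾.bdd_evL (𝔾.fourier p)) w) q) (by fun_prop) (by fun_prop)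
    (fun r v => by
      rw [sliceΔ_tmul, slice₂_φ_Δ_γl, slice₁_tmul, slice₂_tmul, isBddBilin_tmul.smul_left,
        isBddBilin_tmul.smul_right]
      rfl) w

theorem sliceΔ_tmul_right (w : CTensor V V) (f g : V) :
    𝔾.sliceΔ w (tmul f g) = 𝔾.right₂ f
      (map (f := LinearMap.id) IsBdd.id (𝔾.dualLeftL_bdd (𝔾.fourier g)) w) :=
  ext_tmul (f := fun w => 𝔾.sliceΔ w (tmul f g)) (g := fun w => 𝔾.right₂ f
      (map (f := LinearMap.id) IsBdd.id (𝔾.dualLeftL_bdd (𝔾.fourier g)) w)) (by fun_prop)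
    (by fun_prop) (fun r v => by rw [sliceΔ_tmul, slice₂_φ_Δ_tmul]; simp) w

/-- By surjectivity take s = γ(p ⊗ q). Left invariance then collapses the inner slice to ((ι ⊗
𝔉(p))Δ(a))c ⊗ q, and the outer slice multiplies by (ι ⊗ 𝔉(q))Δ(b). -/
theorem dualLeftProd_γlInv (a b c : V) (s : CTensor V V) :
    𝔾.mul (𝔾.dualLeftProd a b (𝔾.fourierT (𝔾.γlInv s))) c =
      slice₂ 𝔾.φ_bdd ((𝔾.Γ.Δ b).1.1 (𝔾.sliceΔ (𝔾.Γ.γl (tmul a c)) s)) := by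
  have h : ∀ t, 𝔾.mul (𝔾.dualLeftProd a b (𝔾.fourierT t)) c =
      slice₂ 𝔾.φ_bdd ((𝔾.Γ.Δ b).1.1 (𝔾.sliceΔ (𝔾.Γ.γl (tmul a c)) (𝔾.Γ.γl t))) := fun t =>
    ext_tmul (f := fun t => 𝔾.mul (𝔾.dualLeftProd a b (𝔾.fourierT t)) c)
      (g := fun t => slice₂ 𝔾.φ_bdd ((𝔾.Γ.Δ b).1.1 (𝔾.sliceΔ (𝔾.Γ.γl (tmul a c)) (𝔾.Γ.γl t))))
      (by fun_prop) (by fun_prop) (fun p q => by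
        rw [sliceΔ_γl, slice₂_φ_Δ_tmul, ← dualLeft_mul, fourierT_tmul, dualLeftProd_tmul,
          𝔾.mul_assoc]) t
  rw [h, γl_γlInv]

/-- The transpose of Δ(ba') = Δ(b)Δ(a') with a' = (ι ⊗ z)Δ(a). Coassociativity rewrites the inner
slice as Δ(a'), after which multiplicativity of Δ combines the two factors. -/
theorem dualLeftProd_dualγ (a b : V) (y z : 𝔾.Dual) :
    𝔾.dualLeftProd a b (𝔾.dualγ (tmul y z)) = 𝔾.dualLeft y (𝔾.mul b (𝔾.dualLeft z a)) := by
  obtain ⟨f, rfl⟩ := 𝔾.fourier.surjective y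
  obtain ⟨g, rfl⟩ := 𝔾.fourier.surjective z
  refine 𝔾.eq_of_mul_right fun c => ?_
  rw [dualγ_apply, fourierTInv_tmul, LinearEquiv.symm_apply_apply, LinearEquiv.symm_apply_apply,
    dualLeftProd_γlInv, sliceΔ_tmul_right, ← γl_dualLeft, ← Δ_left_tmul, ← 𝔾.Γ.hom.map_mul_left,
    slice₂_φ_Δ_tmul]

theorem comulLeft_dualMul (x y : 𝔾.Dual) (t : CTensor 𝔾.Dual 𝔾.Dual) :
    𝔾.comulLeft (𝔾.dualMul x y) t = 𝔾.comulLeft x (𝔾.comulLeft y t) :=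
  ext_tmul (f := fun t => 𝔾.comulLeft (𝔾.dualMul x y) t)
    (g := fun t => 𝔾.comulLeft x (𝔾.comulLeft y t)) (by fun_prop) (by fun_prop)
    (fun z w => 𝔾.eq_of_evT fun a b => by
      rw [evT_comulLeft, evT_comulLeft', comulLeft_tmul, dualLeftProd_right₂, dualLeftProd_dualγ,
        ev_dualMul]) t

theorem comulRight_dualMul (x y : 𝔾.Dual) (t : CTensor 𝔾.Dual 𝔾.Dual) :
    𝔾.comulRight (𝔾.dualMul x y) t = 𝔾.comulRight y (𝔾.comulRight x t) := by
  simp only [comulRight_apply, dualStar_dualMul, comulLeft_dualMul, BornStarAlgebra.starT_starT]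

theorem dualΔ_hom : IsEssentialHom 𝔾.dualAlgebra.mul 𝔾.dualΔ where
  map_mul_left := 𝔾.comulLeft_dualMul
  map_mul_right := 𝔾.comulRight_dualMul
  bdd_left := 𝔾.bdd_comulLeft
  bdd_right := 𝔾.bdd_comulRight
  essential_left := .of_section 𝔾.comulSection 𝔾.realBdd_comulSection.bdd fun t => by
    have h : ∀ s, lift 𝔾.bdd_comulLeft s = 𝔾.comulAct s := fun s =>
      ext_tmul (f := fun s => lift 𝔾.bdd_comulLeft s) (g := fun s => 𝔾.comulAct s)
        (realBdd_lift _) (by fun_prop) (fun x t => lift_tmul _ _ _) s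
    exact (h _).trans (𝔾.comulAct_comulSection t)
  -- The section for right multiplication is the conjugate of the section for left multiplication.
  essential_right := .of_section
    (fun t => 𝔾.dualAlgebra.star₃ (𝔾.comulSection (𝔾.dualAlgebra.starT t)))
    (IsRealBdd.bdd (by fun_prop)) fun t => by
    have h : ∀ s, lift 𝔾.bdd_comulRight (𝔾.dualAlgebra.star₃ s) =
        𝔾.dualAlgebra.starT (𝔾.comulAct s) := fun s =>
      ext_tmul (f := fun s => lift 𝔾.bdd_comulRight (𝔾.dualAlgebra.star₃ s))
        (g := fun s => 𝔾.dualAlgebra.starT (𝔾.comulAct s))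
        ((realBdd_lift 𝔾.bdd_comulRight).comp (by fun_prop)) (by fun_prop) (fun x t => by
          rw [BornStarAlgebra.star₃_tmul, lift_tmul, comulRight_apply, dualAlgebra_star,
            dualStar_dualStar, BornStarAlgebra.starT_starT, comulLeft_apply]) s
    refine (h _).trans ?_
    rw [comulAct_comulSection, BornStarAlgebra.starT_starT]

end BornQuantumGroup

end

end

section

section

variable {V : Type u} [AddCommGroup V] [Module ℂ V] [Bornology V] [CompleteBornSpace V]

namespace BornQuantumGroup

open CTensor

variable (𝔾 : BornQuantumGroup V)

/-! ### Coassociativity of the dual -/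

theorem bdd_dualγ_tmulL (x : 𝔾.Dual) : IsBdd (𝔾.dualγ ∘ₗ tmulL x) :=
  𝔾.dualγ_bdd.comp (isBddBilin_tmul.isBdd_right x)

/-- The left multiplication by `(Δ ⊗ ι)(Δ(x))`. -/
noncomputable def comul₃Left (x : 𝔾.Dual) :
    CTensor 𝔾.Dual (CTensor 𝔾.Dual 𝔾.Dual) →ₗ[ℂ] CTensor 𝔾.Dual (CTensor 𝔾.Dual 𝔾.Dual) :=
  map (f := LinearMap.id) IsBdd.id 𝔾.comulAct_bdd ∘ₗ
    assoc 𝔾.Dual 𝔾.Dual (CTensor 𝔾.Dual 𝔾.Dual) ∘ₗ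
    map (g := LinearMap.id) (𝔾.bdd_dualγ_tmulL x) IsBdd.id

theorem comul₃Left_apply (x : 𝔾.Dual) (t : CTensor 𝔾.Dual (CTensor 𝔾.Dual 𝔾.Dual)) :
    𝔾.comul₃Left x t = map (f := LinearMap.id) IsBdd.id 𝔾.comulAct_bdd
      (assoc 𝔾.Dual 𝔾.Dual (CTensor 𝔾.Dual 𝔾.Dual)
        (map (g := LinearMap.id) (𝔾.bdd_dualγ_tmulL x) IsBdd.id t)) := rfl

@[fun_prop]
theorem realBdd_comul₃Left (x : 𝔾.Dual) : IsRealBdd fun t => 𝔾.comul₃Left x t := by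
  simp only [comul₃Left_apply]; fun_prop

theorem comul₃Left_tmul (x z : 𝔾.Dual) (s : CTensor 𝔾.Dual 𝔾.Dual) :
    𝔾.comul₃Left x (tmul z s) = map (f := LinearMap.id) IsBdd.id 𝔾.comulAct_bdd
      (assoc 𝔾.Dual 𝔾.Dual (CTensor 𝔾.Dual 𝔾.Dual) (tmul (𝔾.dualγ (tmul x z)) s)) := by
  rw [comul₃Left_apply, map_tmul]
  rfl

/-- This is the ι ⊗ Δ half, which the definition is built for: it needs only that Δ̂ is
multiplicative and that `dualγ` is right linear in its second argument. -/
theorem comul₃Left_act (x : 𝔾.Dual) (t : CTensor 𝔾.Dual 𝔾.Dual)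
    (z : CTensor 𝔾.Dual (CTensor 𝔾.Dual 𝔾.Dual)) :
    𝔾.comul₃Left x (act 𝔾.dualAlgebra.bdd_mul 𝔾.bdd_comulLeft t z) =
      act 𝔾.dualAlgebra.bdd_mul 𝔾.bdd_comulLeft (𝔾.comulLeft x t) z := by
  refine ext_tmul₂
    (f := fun t z => 𝔾.comul₃Left x (act 𝔾.dualAlgebra.bdd_mul 𝔾.bdd_comulLeft t z))
    (g := fun t z => act 𝔾.dualAlgebra.bdd_mul 𝔾.bdd_comulLeft (𝔾.comulLeft x t) z)
    (by intro; fun_prop) (by intro; fun_prop) (by intro; fun_prop) (by intro; fun_prop)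
    (fun v w z s => ?_) t z
  rw [act_tmul, dualAlgebra_mul, comul₃Left_tmul, dualγ_mul, comulLeft_tmul]
  exact ext_tmul (f := fun u => map (f := LinearMap.id) IsBdd.id 𝔾.comulAct_bdd
      (assoc 𝔾.Dual 𝔾.Dual (CTensor 𝔾.Dual 𝔾.Dual) (tmul (𝔾.dualAlgebra.right₁ z u)
        (𝔾.comulLeft w s))))
    (g := fun u => act 𝔾.dualAlgebra.bdd_mul 𝔾.bdd_comulLeft (𝔾.dualAlgebra.right₂ w u)
      (tmul z s)) (by fun_prop) (by fun_prop) (fun p q => by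
        simp [act_tmul, comulLeft_dualMul, ← comulLeft_apply]) _

theorem evT₃_assoc (a b c : V) (s : CTensor 𝔾.Dual 𝔾.Dual) (v : 𝔾.Dual) :
    𝔾.evT₃ a b c (assoc 𝔾.Dual 𝔾.Dual 𝔾.Dual (tmul s v)) = 𝔾.evT a b s * 𝔾.ev v c :=
  ext_tmul (f := fun s => 𝔾.evT₃ a b c (assoc 𝔾.Dual 𝔾.Dual 𝔾.Dual (tmul s v)))
    (g := fun s => 𝔾.evT a b s * 𝔾.ev v c) (by fun_prop) (by fun_prop)
    (fun x y => by simp [mul_assoc]) s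

/-- The iterated coproduct evaluates `x` on a triple product in A. Its independence of the
bracketing, which is associativity of A, is the source of coassociativity. -/
theorem evT₃_comul₃Left_tmul (a b c : V) (x z w v : 𝔾.Dual) :
    𝔾.evT₃ a b c (𝔾.comul₃Left x (tmul z (tmul w v))) =
      𝔾.ev x (𝔾.mul (𝔾.dualLeft v c) (𝔾.mul (𝔾.dualLeft w b) (𝔾.dualLeft z a))) := by
  have h : ∀ u, 𝔾.evT₃ a b c (map (f := LinearMap.id) IsBdd.id 𝔾.comulAct_bdd
      (assoc 𝔾.Dual 𝔾.Dual (CTensor 𝔾.Dual 𝔾.Dual) (tmul u (tmul w v)))) =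
      𝔾.evT a (𝔾.mul (𝔾.dualLeft v c) (𝔾.dualLeft w b)) u := fun u =>
    ext_tmul (f := fun u => 𝔾.evT₃ a b c (map (f := LinearMap.id) IsBdd.id 𝔾.comulAct_bdd
      (assoc 𝔾.Dual 𝔾.Dual (CTensor 𝔾.Dual 𝔾.Dual) (tmul u (tmul w v)))))
      (g := fun u => 𝔾.evT a (𝔾.mul (𝔾.dualLeft v c) (𝔾.dualLeft w b)) u) (by fun_prop)
      (by fun_prop) (fun p q => by
        rw [assoc_tmul_tmul, map_tmul, evT₃_tmul, ← comulLeft_apply, evT_comulLeft, evT_tmul]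
        rfl) u
  rw [comul₃Left_tmul, h, evT_dualγ, 𝔾.mul_assoc]

theorem evT₃_comul₃Left_assoc (a b c : V) (x v : 𝔾.Dual) (s : CTensor 𝔾.Dual 𝔾.Dual) :
    𝔾.evT₃ a b c (𝔾.comul₃Left x (assoc 𝔾.Dual 𝔾.Dual 𝔾.Dual (tmul s v))) =
      𝔾.ev x (𝔾.mul (𝔾.dualLeft v c) (𝔾.dualLeftProd a b s)) :=
  ext_tmul (f := fun s => 𝔾.evT₃ a b c (𝔾.comul₃Left x (assoc 𝔾.Dual 𝔾.Dual 𝔾.Dual (tmul s v))))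
    (g := fun s => 𝔾.ev x (𝔾.mul (𝔾.dualLeft v c) (𝔾.dualLeftProd a b s))) (by fun_prop)
    (by fun_prop) (fun z w => by
      rw [assoc_tmul_tmul, evT₃_comul₃Left_tmul, dualLeftProd_tmul]) s

theorem dualLeftProd_comulLeft (a b : V) (y : 𝔾.Dual) (s : CTensor 𝔾.Dual 𝔾.Dual) :
    𝔾.dualLeftProd a b (𝔾.comulLeft y s) = 𝔾.dualLeft y (𝔾.dualLeftProd a b s) :=
  ext_tmul (f := fun s => 𝔾.dualLeftProd a b (𝔾.comulLeft y s))
    (g := fun s => 𝔾.dualLeft y (𝔾.dualLeftProd a b s)) (by fun_prop) (by fun_prop)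
    (fun z w => by
      rw [comulLeft_tmul, dualLeftProd_right₂, dualLeftProd_dualγ, dualLeftProd_tmul]) s

/-- For the Δ ⊗ ι half the pairing with a ⊗ b ⊗ c is compared. Multiplicativity of Δ̂ moves the
slices by `y` outside the product attached to the first two legs. -/
theorem comul₃Left_assoc_act (x : 𝔾.Dual) (t : CTensor 𝔾.Dual 𝔾.Dual)
    (z : CTensor (CTensor 𝔾.Dual 𝔾.Dual) 𝔾.Dual) :
    𝔾.comul₃Left x (assoc 𝔾.Dual 𝔾.Dual 𝔾.Dual
        (act 𝔾.bdd_comulLeft 𝔾.dualAlgebra.bdd_mul t z)) =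
      assoc 𝔾.Dual 𝔾.Dual 𝔾.Dual
        (act 𝔾.bdd_comulLeft 𝔾.dualAlgebra.bdd_mul (𝔾.comulLeft x t) z) := by
  refine ext_tmul₂
    (f := fun t z => 𝔾.comul₃Left x (assoc 𝔾.Dual 𝔾.Dual 𝔾.Dual
        (act 𝔾.bdd_comulLeft 𝔾.dualAlgebra.bdd_mul t z)))
    (g := fun t z => assoc 𝔾.Dual 𝔾.Dual 𝔾.Dual
        (act 𝔾.bdd_comulLeft 𝔾.dualAlgebra.bdd_mul (𝔾.comulLeft x t) z))
    (by intro; fun_prop) (by intro; fun_prop) (by intro; fun_prop) (by intro; fun_prop)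
    (fun y y' s v => 𝔾.eq_of_evT₃ fun a b c => ?_) t z
  have h : ∀ u, 𝔾.evT₃ a b c (assoc 𝔾.Dual 𝔾.Dual 𝔾.Dual
        (act 𝔾.bdd_comulLeft 𝔾.dualAlgebra.bdd_mul u (tmul s v))) =
      𝔾.evT (𝔾.dualLeftProd a b s) (𝔾.dualLeft v c) u := fun u =>
    ext_tmul (f := fun u => 𝔾.evT₃ a b c (assoc 𝔾.Dual 𝔾.Dual 𝔾.Dual
        (act 𝔾.bdd_comulLeft 𝔾.dualAlgebra.bdd_mul u (tmul s v))))
      (g := fun u => 𝔾.evT (𝔾.dualLeftProd a b s) (𝔾.dualLeft v c) u) (by fun_prop)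
      (by fun_prop) (fun p q => by
        rw [act_tmul, evT₃_assoc, evT_comulLeft', evT_tmul, dualAlgebra_mul, ev_dualMul]) u
  rw [h, evT_comulLeft, act_tmul, evT₃_comul₃Left_assoc, dualLeftProd_comulLeft, dualAlgebra_mul,
    dualLeft_dualMul]

/-- The right multiplication by `(Δ ⊗ ι)(Δ(x))`. -/
noncomputable def comul₃Right (x : 𝔾.Dual) :
    CTensor 𝔾.Dual (CTensor 𝔾.Dual 𝔾.Dual) →ₗ[ℂ] CTensor 𝔾.Dual (CTensor 𝔾.Dual 𝔾.Dual) where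
  toFun t := 𝔾.dualAlgebra.star₃ (𝔾.comul₃Left (𝔾.dualStar x) (𝔾.dualAlgebra.star₃ t))
  map_add' s t := by simp only [map_add]
  map_smul' c t := by simp

theorem comul₃Right_apply (x : 𝔾.Dual) (t : CTensor 𝔾.Dual (CTensor 𝔾.Dual 𝔾.Dual)) :
    𝔾.comul₃Right x t =
      𝔾.dualAlgebra.star₃ (𝔾.comul₃Left (𝔾.dualStar x) (𝔾.dualAlgebra.star₃ t)) := rfl

@[fun_prop]
theorem realBdd_comul₃Right (x : 𝔾.Dual) : IsRealBdd fun t => 𝔾.comul₃Right x t := by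
  simp only [comul₃Right_apply]; fun_prop

theorem starT_comulRight (x : 𝔾.Dual) (t : CTensor 𝔾.Dual 𝔾.Dual) :
    𝔾.dualAlgebra.starT (𝔾.comulRight x t) =
      𝔾.comulLeft (𝔾.dualStar x) (𝔾.dualAlgebra.starT t) := by
  rw [comulRight_apply, BornStarAlgebra.starT_starT]

theorem starT_comulLeft (x : 𝔾.Dual) (t : CTensor 𝔾.Dual 𝔾.Dual) :
    𝔾.dualAlgebra.starT (𝔾.comulLeft x t) =
      𝔾.comulRight (𝔾.dualStar x) (𝔾.dualAlgebra.starT t) := by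
  rw [comulRight_apply, BornStarAlgebra.starT_starT, dualStar_dualStar]

/-- Conjugation carries the left-handed coassociativity identities to the right-handed ones. -/
theorem star₃_act (t : CTensor 𝔾.Dual 𝔾.Dual) (z : CTensor 𝔾.Dual (CTensor 𝔾.Dual 𝔾.Dual)) :
    𝔾.dualAlgebra.star₃ (act 𝔾.dualAlgebra.bdd_mul.swap 𝔾.bdd_comulRight t z) =
      act 𝔾.dualAlgebra.bdd_mul 𝔾.bdd_comulLeft (𝔾.dualAlgebra.starT t)
        (𝔾.dualAlgebra.star₃ z) :=
  ext_tmul₂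
    (f := fun t z => 𝔾.dualAlgebra.star₃ (act 𝔾.dualAlgebra.bdd_mul.swap 𝔾.bdd_comulRight t z))
    (g := fun t z => act 𝔾.dualAlgebra.bdd_mul 𝔾.bdd_comulLeft (𝔾.dualAlgebra.starT t)
      (𝔾.dualAlgebra.star₃ z))
    (by intro; fun_prop) (by intro; fun_prop) (by intro; fun_prop) (by intro; fun_prop)
    (fun v w z s => by
      simp only [act_tmul, BornStarAlgebra.star₃_tmul, BornStarAlgebra.starT_tmul,
        starT_comulRight, dualAlgebra_mul, dualStar_dualMul, dualAlgebra_star]) t z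

theorem bdd_star₃' : IsBddBilin (starRingEnd ℂ) fun s x =>
    (tmul (𝔾.dualAlgebra.starT s) (𝔾.dualStar x) : CTensor (CTensor 𝔾.Dual 𝔾.Dual) 𝔾.Dual) :=
  isBddBilin_tmul.comp 𝔾.dualAlgebra.starT_bdd 𝔾.dualAlgebra.star_bdd (map_add _)
    (LinearMap.map_smulₛₗ _) 𝔾.dualAlgebra.star_add 𝔾.dualAlgebra.star_smul

theorem star₃_assoc_tmul (s : CTensor 𝔾.Dual 𝔾.Dual) (v : 𝔾.Dual) :
    𝔾.dualAlgebra.star₃ (assoc 𝔾.Dual 𝔾.Dual 𝔾.Dual (tmul s v)) =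
      assoc 𝔾.Dual 𝔾.Dual 𝔾.Dual (tmul (𝔾.dualAlgebra.starT s) (𝔾.dualStar v)) :=
  ext_tmul (f := fun s => 𝔾.dualAlgebra.star₃ (assoc 𝔾.Dual 𝔾.Dual 𝔾.Dual (tmul s v)))
    (g := fun s => assoc 𝔾.Dual 𝔾.Dual 𝔾.Dual (tmul (𝔾.dualAlgebra.starT s) (𝔾.dualStar v)))
    (by fun_prop) (by fun_prop) (fun x y => by simp) s

theorem star₃_assoc_act (t : CTensor 𝔾.Dual 𝔾.Dual)
    (z : CTensor (CTensor 𝔾.Dual 𝔾.Dual) 𝔾.Dual) :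
    𝔾.dualAlgebra.star₃ (assoc 𝔾.Dual 𝔾.Dual 𝔾.Dual
      (act 𝔾.bdd_comulRight 𝔾.dualAlgebra.bdd_mul.swap t z)) =
      assoc 𝔾.Dual 𝔾.Dual 𝔾.Dual (act 𝔾.bdd_comulLeft 𝔾.dualAlgebra.bdd_mul
        (𝔾.dualAlgebra.starT t) (lift 𝔾.bdd_star₃' z)) :=
  ext_tmul₂
    (f := fun t z => 𝔾.dualAlgebra.star₃ (assoc 𝔾.Dual 𝔾.Dual 𝔾.Dual
      (act 𝔾.bdd_comulRight 𝔾.dualAlgebra.bdd_mul.swap t z)))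
    (g := fun t z => assoc 𝔾.Dual 𝔾.Dual 𝔾.Dual (act 𝔾.bdd_comulLeft 𝔾.dualAlgebra.bdd_mul
        (𝔾.dualAlgebra.starT t) (lift 𝔾.bdd_star₃' z)))
    (by intro; fun_prop) (by intro; fun_prop) (by intro; fun_prop)
    (by intro t; exact realBdd_assoc.comp ((realBdd_act_right _ _ _).comp (realBdd_lift_conj _)))
    (fun v w s z => by
      simp only [act_tmul, star₃_assoc_tmul, BornStarAlgebra.starT_tmul, lift_tmul,
        starT_comulRight, dualAlgebra_star, dualAlgebra_mul, dualStar_dualMul]) t z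

theorem comul₃Left_mulT₃ (x : 𝔾.Dual) (s t : CTensor 𝔾.Dual (CTensor 𝔾.Dual 𝔾.Dual)) :
    𝔾.comul₃Left x (𝔾.dualAlgebra.mulT₃ s t) = 𝔾.dualAlgebra.mulT₃ (𝔾.comul₃Left x s) t := by
  refine ext_tmul₃ (f := fun t => 𝔾.comul₃Left x (𝔾.dualAlgebra.mulT₃ s t))
    (g := fun t => 𝔾.dualAlgebra.mulT₃ (𝔾.comul₃Left x s) t) (by fun_prop) (by fun_prop)
    (fun z' w' v' => ?_) t
  refine ext_tmul₃ (f := fun s => 𝔾.comul₃Left x (𝔾.dualAlgebra.mulT₃ s (tmul z' (tmul w' v'))))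
    (g := fun s => 𝔾.dualAlgebra.mulT₃ (𝔾.comul₃Left x s) (tmul z' (tmul w' v')))
    (by fun_prop) (by fun_prop) (fun z w v => 𝔾.eq_of_evT₃ fun a b c => ?_) s
  rw [evT₃_mulT₃_right, BornStarAlgebra.mulT₃_tmul, BornStarAlgebra.mulT_tmul,
    evT₃_comul₃Left_tmul, evT₃_comul₃Left_tmul]
  simp [dualLeft_dualMul]

theorem evT₃_star₃ (a b c : V) (s : CTensor 𝔾.Dual (CTensor 𝔾.Dual 𝔾.Dual)) :
    𝔾.evT₃ a b c (𝔾.dualAlgebra.star₃ s) = (starRingEnd ℂ)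
      (𝔾.evT₃ (𝔾.star (𝔾.S a)) (𝔾.star (𝔾.S b)) (𝔾.star (𝔾.S c)) s) :=
  ext_tmul (f := fun s => 𝔾.evT₃ a b c (𝔾.dualAlgebra.star₃ s))
    (g := fun s => (starRingEnd ℂ)
      (𝔾.evT₃ (𝔾.star (𝔾.S a)) (𝔾.star (𝔾.S b)) (𝔾.star (𝔾.S c)) s)) (by fun_prop)
    (by fun_prop) (fun x y => by simp [ev_dualStar, evT_starT]) s

theorem evT₃_comul₃Right_tmul (a b c : V) (x z w v : 𝔾.Dual) :
    𝔾.evT₃ a b c (𝔾.comul₃Right x (tmul z (tmul w v))) =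
      𝔾.ev x (𝔾.mul (𝔾.dualRight v c) (𝔾.mul (𝔾.dualRight w b) (𝔾.dualRight z a))) := by
  rw [comul₃Right_apply, evT₃_star₃, BornStarAlgebra.star₃_tmul, BornStarAlgebra.starT_tmul,
    evT₃_comul₃Left_tmul]
  simp only [dualAlgebra_star, dualLeft_star_S, dualStar_dualStar]
  rw [← 𝔾.star_mul, ← 𝔾.S_mul, ← 𝔾.star_mul, ← 𝔾.S_mul, ← ev_dualStar, dualStar_dualStar]

theorem mulT₃_comul₃ (x : 𝔾.Dual) (s t : CTensor 𝔾.Dual (CTensor 𝔾.Dual 𝔾.Dual)) :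
    𝔾.dualAlgebra.mulT₃ (𝔾.comul₃Right x s) t = 𝔾.dualAlgebra.mulT₃ s (𝔾.comul₃Left x t) := by
  refine ext_tmul₃ (f := fun t => 𝔾.dualAlgebra.mulT₃ (𝔾.comul₃Right x s) t)
    (g := fun t => 𝔾.dualAlgebra.mulT₃ s (𝔾.comul₃Left x t)) (by fun_prop) (by fun_prop)
    (fun z' w' v' => ?_) t
  refine ext_tmul₃
    (f := fun s => 𝔾.dualAlgebra.mulT₃ (𝔾.comul₃Right x s) (tmul z' (tmul w' v')))
    (g := fun s => 𝔾.dualAlgebra.mulT₃ s (𝔾.comul₃Left x (tmul z' (tmul w' v'))))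
    (by fun_prop) (by fun_prop) (fun z w v => 𝔾.eq_of_evT₃ fun a b c => ?_) s
  rw [evT₃_mulT₃_right, evT₃_mulT₃_left, evT₃_comul₃Left_tmul, evT₃_comul₃Right_tmul]
  simp only [dualRight_dualLeft]

/-- The multiplier `(Δ ⊗ ι)(Δ(x)) = (ι ⊗ Δ)(Δ(x))`. -/
noncomputable def comul₃ (x : 𝔾.Dual) : multipliers 𝔾.dualAlgebra.bdd_mulT₃ :=
  ⟨(𝔾.comul₃Left x, 𝔾.comul₃Right x), (𝔾.realBdd_comul₃Left x).bdd,
    (𝔾.realBdd_comul₃Right x).bdd, 𝔾.comul₃Left_mulT₃ x, fun s t => by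
      change 𝔾.comul₃Right x _ = 𝔾.dualAlgebra.mulT₃ s (𝔾.comul₃Right x t)
      rw [comul₃Right_apply, BornStarAlgebra.star₃_mulT₃, comul₃Left_mulT₃,
        BornStarAlgebra.star₃_mulT₃, BornStarAlgebra.star₃_star₃, comul₃Right_apply],
    𝔾.mulT₃_comul₃ x⟩

/-! ### The dual Galois maps -/

/-- The map `Ŝ ⊗ Ŝ` followed by the flip. -/
noncomputable def dualFlipS : CTensor 𝔾.Dual 𝔾.Dual →ₗ[ℂ] CTensor 𝔾.Dual 𝔾.Dual :=
  lift (isBddBilin_tmul.compLinear (f := 𝔾.dualS.toLinearMap) (g := 𝔾.dualS.toLinearMap)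
    𝔾.realBdd_dualS.bdd 𝔾.realBdd_dualS.bdd).swap

@[simp] theorem dualFlipS_tmul (x y : 𝔾.Dual) :
    𝔾.dualFlipS (tmul x y) = tmul (𝔾.dualS y) (𝔾.dualS x) := lift_tmul _ _ _

@[fun_prop]
theorem realBdd_dualFlipS : IsRealBdd fun t => 𝔾.dualFlipS t := realBdd_lift _

theorem evT_dualFlipS (a b : V) (t : CTensor 𝔾.Dual 𝔾.Dual) :
    𝔾.evT a b (𝔾.dualFlipS t) = 𝔾.evT (𝔾.S.symm b) (𝔾.S.symm a) t :=
  ext_tmul (f := fun t => 𝔾.evT a b (𝔾.dualFlipS t))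
    (g := fun t => 𝔾.evT (𝔾.S.symm b) (𝔾.S.symm a) t) (by fun_prop) (by fun_prop)
    (fun x y => by simp [ev_dualS, mul_comm]) t

/-- The Galois map `x ⊗ y ↦ (1 ⊗ x) Δ(y)` of the dual. -/
noncomputable def dualρ : CTensor 𝔾.Dual 𝔾.Dual →ₗ[ℂ] CTensor 𝔾.Dual 𝔾.Dual :=
  𝔾.dualFlipS ∘ₗ 𝔾.dualγ ∘ₗ
    lift (isBddBilin_tmul.compLinear (f := 𝔾.dualS.symm.toLinearMap)
      (g := 𝔾.dualS.symm.toLinearMap) 𝔾.realBdd_dualS_symm.bdd 𝔾.realBdd_dualS_symm.bdd).swap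

theorem dualρ_tmul (x z : 𝔾.Dual) : 𝔾.dualρ (tmul x z) =
    𝔾.dualFlipS (𝔾.dualγ (tmul (𝔾.dualS.symm z) (𝔾.dualS.symm x))) :=
  congrArg (fun t => 𝔾.dualFlipS (𝔾.dualγ t)) (lift_tmul _ _ _)

@[fun_prop]
theorem realBdd_dualρ : IsRealBdd fun t => 𝔾.dualρ t :=
  𝔾.realBdd_dualFlipS.comp (𝔾.realBdd_dualγ.comp (realBdd_lift _))

/-- Writing b as an antipode, the dual antipode cancels against that in A, and the reversal of
products exchanges the two legs of the formula for `dualγ`. -/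
theorem evT_dualρ (a b : V) (x z : 𝔾.Dual) :
    𝔾.evT a b (𝔾.dualρ (tmul x z)) = 𝔾.ev z (𝔾.mul (𝔾.dualRight x b) a) := by
  obtain ⟨b, rfl⟩ := 𝔾.S.surjective b
  rw [dualρ_tmul, evT_dualFlipS, evT_dualγ, ev_dualS_symm, 𝔾.S_mul, dualRight_S]
  simp

/-- The dual with its coproduct. -/
noncomputable def dualΓ : Coproduct 𝔾.dualAlgebra where
  Δ := 𝔾.dualΔ
  hom := 𝔾.dualΔ_hom
  star_left x t := by
    change 𝔾.comulLeft (𝔾.dualStar x) t = 𝔾.dualAlgebra.starT (𝔾.comulRight x _)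
    rw [starT_comulRight, BornStarAlgebra.starT_starT]
  star_right _ _ := by
    change 𝔾.comulRight (𝔾.dualStar _) _ = 𝔾.dualAlgebra.starT (𝔾.comulLeft _ _)
    rw [starT_comulLeft, BornStarAlgebra.starT_starT]
  coassoc x := by
    refine ⟨𝔾.comul₃ x, 𝔾.comul₃Left_act x, fun t z => ?_, 𝔾.comul₃Left_assoc_act x, fun t z => ?_⟩
    · change 𝔾.dualAlgebra.star₃ (𝔾.comul₃Left (𝔾.dualStar x) (𝔾.dualAlgebra.star₃
        (act 𝔾.dualAlgebra.bdd_mul.swap 𝔾.bdd_comulRight t z))) =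
        act 𝔾.dualAlgebra.bdd_mul.swap 𝔾.bdd_comulRight (𝔾.comulRight x t) z
      rw [star₃_act, comul₃Left_act, ← starT_comulRight, ← star₃_act,
        BornStarAlgebra.star₃_star₃]
    · change 𝔾.dualAlgebra.star₃ (𝔾.comul₃Left (𝔾.dualStar x) (𝔾.dualAlgebra.star₃
        (assoc 𝔾.Dual 𝔾.Dual 𝔾.Dual
          (act 𝔾.bdd_comulRight 𝔾.dualAlgebra.bdd_mul.swap t z)))) =
        assoc 𝔾.Dual 𝔾.Dual 𝔾.Dual
          (act 𝔾.bdd_comulRight 𝔾.dualAlgebra.bdd_mul.swap (𝔾.comulRight x t) z)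
      rw [star₃_assoc_act, comul₃Left_assoc_act, ← starT_comulRight, ← star₃_assoc_act,
        BornStarAlgebra.star₃_star₃]
  γl := 𝔾.dualγ
  γl_bdd := 𝔾.dualγ_bdd
  γl_left x z t := by
    change 𝔾.dualAlgebra.mulT (𝔾.dualγ (tmul x z)) t = 𝔾.comulLeft x (𝔾.dualAlgebra.left₁ z t)
    exact ext_tmul (f := fun t => 𝔾.dualAlgebra.mulT (𝔾.dualγ (tmul x z)) t)
      (g := fun t => 𝔾.comulLeft x (𝔾.dualAlgebra.left₁ z t)) (by fun_prop) (by fun_prop)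
      (fun z' w' => 𝔾.eq_of_evT fun a b => by
        rw [evT_mulT_right, evT_dualγ, BornStarAlgebra.left₁_tmul, evT_comulLeft,
          dualAlgebra_mul, dualLeft_dualMul]) t
  γl_right x z t := by
    change 𝔾.dualAlgebra.mulT t (𝔾.dualγ (tmul x z)) =
      𝔾.dualAlgebra.right₁ z (𝔾.comulRight x t)
    exact ext_tmul (f := fun t => 𝔾.dualAlgebra.mulT t (𝔾.dualγ (tmul x z)))
      (g := fun t => 𝔾.dualAlgebra.right₁ z (𝔾.comulRight x t)) (by fun_prop) (by fun_prop)
      (fun z' w' => 𝔾.eq_of_evT fun a b => by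
        rw [evT_mulT_left, evT_dualγ, evT_right₁, evT_comulRight, dualRight_dualLeft]) t
  ρr := 𝔾.dualρ
  ρr_bdd := 𝔾.realBdd_dualρ.bdd
  ρr_left x z t := by
    change 𝔾.dualAlgebra.mulT (𝔾.dualρ (tmul x z)) t =
      𝔾.dualAlgebra.left₂ x (𝔾.comulLeft z t)
    exact ext_tmul (f := fun t => 𝔾.dualAlgebra.mulT (𝔾.dualρ (tmul x z)) t)
      (g := fun t => 𝔾.dualAlgebra.left₂ x (𝔾.comulLeft z t)) (by fun_prop) (by fun_prop)
      (fun z' w' => 𝔾.eq_of_evT fun a b => by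
        rw [evT_mulT_right, evT_dualρ, evT_left₂, evT_comulLeft, dualRight_dualLeft]) t
  ρr_right x z t := by
    change 𝔾.dualAlgebra.mulT t (𝔾.dualρ (tmul x z)) =
      𝔾.comulRight z (𝔾.dualAlgebra.right₂ x t)
    exact ext_tmul (f := fun t => 𝔾.dualAlgebra.mulT t (𝔾.dualρ (tmul x z)))
      (g := fun t => 𝔾.comulRight z (𝔾.dualAlgebra.right₂ x t)) (by fun_prop) (by fun_prop)
      (fun z' w' => 𝔾.eq_of_evT fun a b => by
        rw [evT_mulT_left, evT_dualρ, BornStarAlgebra.right₂_tmul, evT_comulRight,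
          dualAlgebra_mul, dualRight_dualMul]) t

end BornQuantumGroup

end

end

section

section

variable {V : Type u} [AddCommGroup V] [Module ℂ V] [Bornology V] [CompleteBornSpace V]

namespace BornQuantumGroup

open CTensor

variable (𝔾 : BornQuantumGroup V)

/-! ### The integral and the counit of the dual -/

/-- The left invariant integral of the dual. -/
noncomputable def dualφ : 𝔾.Dual →ₗ[ℂ] ℂ := 𝔾.ε ∘ₗ 𝔾.fourier.symm.toLinearMap

theorem dualφ_apply (x : 𝔾.Dual) : 𝔾.dualφ x = 𝔾.ε (𝔾.fourier.symm x) := rfl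

theorem dualφ_bdd : IsBdd 𝔾.dualφ := 𝔾.ε_bdd.comp 𝔾.fourier_symm_bdd

/-- The counit of the dual. -/
noncomputable def dualε : 𝔾.Dual →ₗ[ℂ] ℂ := 𝔾.φ ∘ₗ 𝔾.fourier.symm.toLinearMap

theorem dualε_apply (x : 𝔾.Dual) : 𝔾.dualε x = 𝔾.φ (𝔾.fourier.symm x) := rfl

theorem dualε_bdd : IsBdd 𝔾.dualε := 𝔾.φ_bdd.comp 𝔾.fourier_symm_bdd

theorem ε_conv (f g : V) : 𝔾.ε (𝔾.conv f g) = 𝔾.φ (𝔾.mul (𝔾.S.symm g) f) := by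
  rw [conv, ← slice_comm 𝔾.ε_bdd 𝔾.φ_bdd, slice₁_ε_ρr]

/-- The counit removes the coproduct from the convolution. The factor δ then inserts S under φ,
which cancels both the antipode in the adjoint and the inverse antipode acting on `g`. -/
theorem ε_conv_convStar (f g : V) :
    𝔾.ε (𝔾.conv (𝔾.convStar 𝔾.modular f) g) = 𝔾.φ (𝔾.mul (𝔾.star f) g) := by
  rw [ε_conv, convStar, ← 𝔾.modular.2.2.2.2.1, 𝔾.φ_modular 𝔾.isModularElement_modular, 𝔾.S_mul,
    S_star_S, LinearEquiv.apply_symm_apply]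

theorem dualφ_dualStar_mul (x : 𝔾.Dual) : 𝔾.dualφ (𝔾.dualMul (𝔾.dualStar x) x) =
    𝔾.φ (𝔾.mul (𝔾.star (𝔾.fourier.symm x)) (𝔾.fourier.symm x)) := by
  rw [dualφ_apply, dualMul, dualStar, LinearEquiv.symm_apply_apply, LinearEquiv.symm_apply_apply,
    ε_conv_convStar]

theorem dualφ_pos (x : 𝔾.Dual) : 0 ≤ (𝔾.dualφ (𝔾.dualMul (𝔾.dualStar x) x)).re ∧
    (𝔾.dualφ (𝔾.dualMul (𝔾.dualStar x) x)).im = 0 := by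
  rw [dualφ_dualStar_mul]
  exact 𝔾.φ_pos _

theorem dualφ_dualStar (x : 𝔾.Dual) : 𝔾.dualφ (𝔾.dualStar x) = (starRingEnd ℂ) (𝔾.dualφ x) :=
  𝔾.dualAlgebra.map_star_of_nonneg 𝔾.dualφ_bdd 𝔾.dualφ_pos x

theorem dualε_dualStar (x : 𝔾.Dual) : 𝔾.dualε (𝔾.dualStar x) = (starRingEnd ℂ) (𝔾.dualε x) := by
  rw [dualε_apply, dualStar, LinearEquiv.symm_apply_apply, convStar,
    𝔾.φ_modular 𝔾.isModularElement_modular, S_star_S, φ_star, dualε_apply]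

/-- The inverse antipode in the convolution product is cancelled by the S that appears when the
double integral of (1 ⊗ a)Δ(b) is computed. -/
theorem dualε_dualMul (x y : 𝔾.Dual) : 𝔾.dualε (𝔾.dualMul x y) = 𝔾.dualε x * 𝔾.dualε y := by
  rw [dualε_apply, dualMul, LinearEquiv.symm_apply_apply, conv, ← slice_comm 𝔾.φ_bdd 𝔾.φ_bdd,
    φ_slice₁_ρr, LinearEquiv.apply_symm_apply]
  rfl

theorem dualε_dualS (x : 𝔾.Dual) : 𝔾.dualε (𝔾.dualS x) = 𝔾.dualε x := by
  rw [dualε_apply, dualS_apply, LinearEquiv.symm_apply_apply, φ_transS, dualε_apply]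

theorem slice₁_ε_γl (a b : V) : slice₁ 𝔾.ε_bdd (𝔾.Γ.γl (tmul a b)) = 𝔾.ε b • a := by
  have h : ∀ t, slice₁ 𝔾.ε_bdd (𝔾.right₁ b t) = 𝔾.ε b • slice₁ 𝔾.ε_bdd t := fun t =>
    ext_tmul (f := fun t => slice₁ 𝔾.ε_bdd (𝔾.right₁ b t))
      (g := fun t => 𝔾.ε b • slice₁ 𝔾.ε_bdd t) (by fun_prop) (by fun_prop)
      (fun p q => by simp [𝔾.ε_mul, smul_smul, mul_comm]) t
  refine 𝔾.eq_of_mul_right fun c => ?_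
  rw [← 𝔾.slice₁_right₂, right₂_γl, h, slice₁_ε_γr, 𝔾.bdd_mul.smul_left]
  rfl

/-- This is (ε ⊗ ι)γ = ι ⊗ ε read along γ⁻¹; transported by 𝔉 it is left invariance of the dual
integral. -/
theorem slice₂_ε_γlInv (t : CTensor V V) :
    slice₂ 𝔾.ε_bdd (𝔾.γlInv t) = slice₁ 𝔾.ε_bdd t := by
  have h : ∀ s, slice₂ 𝔾.ε_bdd s = slice₁ 𝔾.ε_bdd (𝔾.Γ.γl s) := fun s =>
    ext_tmul (f := fun s => slice₂ 𝔾.ε_bdd s) (g := fun s => slice₁ 𝔾.ε_bdd (𝔾.Γ.γl s))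
      (by fun_prop) (by fun_prop) (fun p q => by rw [slice₁_ε_γl, slice₂_tmul]) s
  rw [h, γl_γlInv]

theorem slice₂_fourierT {η : V →ₗ[ℂ] ℂ} (hη : IsBdd η) {ω : 𝔾.Dual →ₗ[ℂ] ℂ} (hω : IsBdd ω)
    (h : ∀ x, ω x = η (𝔾.fourier.symm x)) (t : CTensor V V) :
    slice₂ hω (𝔾.fourierT t) = 𝔾.fourier (slice₂ hη t) :=
  ext_tmul (f := fun t => slice₂ hω (𝔾.fourierT t)) (g := fun t => 𝔾.fourier (slice₂ hη t))
    (by fun_prop) (by fun_prop) (fun p q => by simp [h]) t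

theorem slice₂_dualφ_dualγ (x z : 𝔾.Dual) :
    slice₂ 𝔾.dualφ_bdd (𝔾.dualγ (tmul x z)) = 𝔾.dualφ x • z := by
  rw [dualγ_apply, 𝔾.slice₂_fourierT 𝔾.ε_bdd 𝔾.dualφ_bdd 𝔾.dualφ_apply, slice₂_ε_γlInv,
    fourierTInv_tmul, slice₁_tmul, map_smul, LinearEquiv.apply_symm_apply, dualφ_apply]

/-- The dual counit is φ ∘ 𝔉⁻¹, so slicing the dual Galois map yields (ι ⊗ φ)γ⁻¹, which is the
convolution product. -/
theorem slice₂_dualε_dualγ (x z : 𝔾.Dual) :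
    slice₂ 𝔾.dualε_bdd (𝔾.dualγ (tmul x z)) = 𝔾.dualMul x z := by
  rw [dualγ_apply, 𝔾.slice₂_fourierT 𝔾.φ_bdd 𝔾.dualε_bdd 𝔾.dualε_apply, fourierTInv_tmul,
    ← conv_eq_slice₂_γlInv, dualMul]

/-- The other half of invariance follows by conjugation, because a positive functional is hermitian.
-/
theorem slice₂_dualφ_dualΓ_ρl (z x : 𝔾.Dual) :
    slice₂ 𝔾.dualφ_bdd (𝔾.dualΓ.ρl (tmul z x)) = 𝔾.dualφ x • z := by
  rw [𝔾.dualΓ.ρl_tmul, 𝔾.dualAlgebra.slice₂_starT 𝔾.dualφ_bdd 𝔾.dualφ_bdd 𝔾.dualφ_dualStar]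
  change 𝔾.dualStar (slice₂ 𝔾.dualφ_bdd (𝔾.dualγ (tmul (𝔾.dualStar x) (𝔾.dualStar z)))) = _
  rw [slice₂_dualφ_dualγ, dualStar_smul, dualφ_dualStar, dualStar_dualStar, Complex.conj_conj]

theorem slice₂_dualε_dualΓ_ρl (z x : 𝔾.Dual) :
    slice₂ 𝔾.dualε_bdd (𝔾.dualΓ.ρl (tmul z x)) = 𝔾.dualMul z x := by
  rw [𝔾.dualΓ.ρl_tmul, 𝔾.dualAlgebra.slice₂_starT 𝔾.dualε_bdd 𝔾.dualε_bdd 𝔾.dualε_dualStar]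
  change 𝔾.dualStar (slice₂ 𝔾.dualε_bdd (𝔾.dualγ (tmul (𝔾.dualStar x) (𝔾.dualStar z)))) = _
  rw [slice₂_dualε_dualγ, dualStar_dualMul, dualStar_dualStar, dualStar_dualStar]

theorem slice₁_dualε_dualFlipS (t : CTensor 𝔾.Dual 𝔾.Dual) :
    slice₁ 𝔾.dualε_bdd (𝔾.dualFlipS t) = 𝔾.dualS (slice₂ 𝔾.dualε_bdd t) :=
  ext_tmul (f := fun t => slice₁ 𝔾.dualε_bdd (𝔾.dualFlipS t))
    (g := fun t => 𝔾.dualS (slice₂ 𝔾.dualε_bdd t)) (by fun_prop) (by fun_prop)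
    (fun p q => by simp [dualε_dualS]) t

theorem slice₁_dualε_dualρ (z x : 𝔾.Dual) :
    slice₁ 𝔾.dualε_bdd (𝔾.dualρ (tmul z x)) = 𝔾.dualMul z x := by
  rw [dualρ_tmul, slice₁_dualε_dualFlipS, slice₂_dualε_dualγ, dualS_dualMul,
    LinearEquiv.apply_symm_apply, LinearEquiv.apply_symm_apply]

theorem slice₁_dualε_dualΓ_γr (x z : 𝔾.Dual) :
    slice₁ 𝔾.dualε_bdd (𝔾.dualΓ.γr (tmul x z)) = 𝔾.dualMul x z := by
  rw [𝔾.dualΓ.γr_tmul, 𝔾.dualAlgebra.slice₁_starT 𝔾.dualε_bdd 𝔾.dualε_bdd 𝔾.dualε_dualStar]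
  change 𝔾.dualStar (slice₁ 𝔾.dualε_bdd (𝔾.dualρ (tmul (𝔾.dualStar z) (𝔾.dualStar x)))) = _
  rw [slice₁_dualε_dualρ, dualStar_dualMul, dualStar_dualStar, dualStar_dualStar]

theorem dualε_essential : IsEssentialAction
    (isBddBilin_smul.compLinear (V' := 𝔾.Dual) (g := (LinearMap.id : ℂ →ₗ[ℂ] ℂ)) 𝔾.dualε_bdd
      IsBdd.id) :=
  .of_section (fun c => tmul (𝔾.fourier 𝔾.unitφ) c) (realBdd_tmul_right _).bdd fun c => by
    rw [lift_tmul, dualε_apply]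
    simp

/-! ### The antipode axioms of the dual -/

theorem dualS_bdd : IsBdd 𝔾.dualS.toLinearMap := 𝔾.realBdd_dualS.bdd

theorem dualS_symm_bdd : IsBdd 𝔾.dualS.symm.toLinearMap := 𝔾.realBdd_dualS_symm.bdd

theorem comulLeft_dualS (x : 𝔾.Dual) (t : CTensor 𝔾.Dual 𝔾.Dual) :
    𝔾.comulLeft (𝔾.dualS x) (𝔾.dualFlipS t) = 𝔾.dualFlipS (𝔾.comulRight x t) :=
  ext_tmul (f := fun t => 𝔾.comulLeft (𝔾.dualS x) (𝔾.dualFlipS t))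
    (g := fun t => 𝔾.dualFlipS (𝔾.comulRight x t)) (by fun_prop) (by fun_prop)
    (fun z w => 𝔾.eq_of_evT fun a b => by
      rw [dualFlipS_tmul, evT_comulLeft, evT_dualFlipS, evT_comulRight, ev_dualS, S_symm_mul,
        dualRight_S_symm, dualRight_S_symm]) t

theorem comulRight_dualS (x : 𝔾.Dual) (t : CTensor 𝔾.Dual 𝔾.Dual) :
    𝔾.comulRight (𝔾.dualS x) (𝔾.dualFlipS t) = 𝔾.dualFlipS (𝔾.comulLeft x t) :=
  ext_tmul (f := fun t => 𝔾.comulRight (𝔾.dualS x) (𝔾.dualFlipS t))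
    (g := fun t => 𝔾.dualFlipS (𝔾.comulLeft x t)) (by fun_prop) (by fun_prop)
    (fun z w => 𝔾.eq_of_evT fun a b => by
      rw [dualFlipS_tmul, evT_comulRight, evT_dualFlipS, evT_comulLeft, ev_dualS, S_symm_mul,
        dualLeft_S_symm, dualLeft_S_symm]) t

/-- The map `x ⊗ y ↦ Ŝ(x) y`. -/
noncomputable def dualMulS₁ : CTensor 𝔾.Dual 𝔾.Dual →ₗ[ℂ] 𝔾.Dual :=
  lift (𝔾.dualAlgebra.bdd_mul.compLinear (f := 𝔾.dualS.toLinearMap) (g := LinearMap.id)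
    𝔾.dualS_bdd IsBdd.id)

/-- The map `x ⊗ y ↦ x Ŝ(y)`. -/
noncomputable def dualMulS₂ : CTensor 𝔾.Dual 𝔾.Dual →ₗ[ℂ] 𝔾.Dual :=
  lift (𝔾.dualAlgebra.bdd_mul.compLinear (f := LinearMap.id) (g := 𝔾.dualS.toLinearMap)
    IsBdd.id 𝔾.dualS_bdd)

@[simp] theorem dualMulS₁_tmul (x y : 𝔾.Dual) :
    𝔾.dualMulS₁ (tmul x y) = 𝔾.dualMul (𝔾.dualS x) y := lift_tmul _ _ _

@[simp] theorem dualMulS₂_tmul (x y : 𝔾.Dual) :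
    𝔾.dualMulS₂ (tmul x y) = 𝔾.dualMul x (𝔾.dualS y) := lift_tmul _ _ _

@[fun_prop]
theorem realBdd_dualMulS₁ : IsRealBdd fun t => 𝔾.dualMulS₁ t := realBdd_lift _

@[fun_prop]
theorem realBdd_dualMulS₂ : IsRealBdd fun t => 𝔾.dualMulS₂ t := realBdd_lift _

/-- On 𝔉(p) ⊗ 𝔉(q), strong left invariance expresses the pairing of Ŝ(𝔉(p))𝔉(q) with `a` through (φ
⊗ ι)γ(p ⊗ q). Substituting γ⁻¹ for p ⊗ q cancels γ and leaves a plain integral. -/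
theorem dualMulS₁_dualγ (x z : 𝔾.Dual) :
    𝔾.dualMulS₁ (𝔾.dualγ (tmul x z)) = 𝔾.dualε x • 𝔾.dualS z := by
  refine 𝔾.ev_ext fun a => ?_
  have h : ∀ t, 𝔾.ev (𝔾.dualMulS₁ (𝔾.fourierT t)) a =
      𝔾.φ (𝔾.mul (𝔾.S.symm a) (slice₁ 𝔾.φ_bdd (𝔾.Γ.γl t))) := fun t =>
    ext_tmul (f := fun t => 𝔾.ev (𝔾.dualMulS₁ (𝔾.fourierT t)) a)
      (g := fun t => 𝔾.φ (𝔾.mul (𝔾.S.symm a) (slice₁ 𝔾.φ_bdd (𝔾.Γ.γl t)))) (by fun_prop)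
      (by fun_prop) (fun p q => by
        rw [← dualRight_fourier, φ_mul_dualRight, φ_S_dualLeft_mul, fourierT_tmul,
          dualMulS₁_tmul, ev_dualMul, ev_dualS, ev_fourier, LinearEquiv.apply_symm_apply]) t
  rw [dualγ_apply, h, γl_γlInv, fourierTInv_tmul, slice₁_tmul, 𝔾.bdd_mul.smul_right, map_smul,
    ← ev_eq, ← ev_dualS]
  rfl

/-- Since the composite of Ŝ, the involution and Ŝ is the involution, Ŝ(Ŝ(q)^*)Ŝ(p)^* = q^*Ŝ(p)^* =
(Ŝ(p)q)^*. This reduces the antipode axiom for `γr` to the formula for `dualγ`. -/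
theorem dualMulS₁_starT_dualFlipS (t : CTensor 𝔾.Dual 𝔾.Dual) :
    𝔾.dualMulS₁ (𝔾.dualAlgebra.starT (𝔾.dualFlipS t)) = 𝔾.dualStar (𝔾.dualMulS₁ t) :=
  ext_tmul (f := fun t => 𝔾.dualMulS₁ (𝔾.dualAlgebra.starT (𝔾.dualFlipS t)))
    (g := fun t => 𝔾.dualStar (𝔾.dualMulS₁ t)) (by fun_prop) (by fun_prop)
    (fun p q => by simp [dualS_dualStar_dualS, dualStar_dualMul]) t

theorem dualMulS₂_starT (t : CTensor 𝔾.Dual 𝔾.Dual) :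
    𝔾.dualMulS₂ (𝔾.dualAlgebra.starT t) = 𝔾.dualStar (𝔾.dualS.symm (𝔾.dualMulS₁ t)) :=
  ext_tmul (f := fun t => 𝔾.dualMulS₂ (𝔾.dualAlgebra.starT t))
    (g := fun t => 𝔾.dualStar (𝔾.dualS.symm (𝔾.dualMulS₁ t))) (by fun_prop) (by fun_prop)
    (fun p q => by
      have h₁ : 𝔾.dualS.symm (𝔾.dualMul (𝔾.dualS p) q) = 𝔾.dualMul (𝔾.dualS.symm q) p := by
        rw [LinearEquiv.symm_apply_eq, dualS_dualMul, LinearEquiv.apply_symm_apply]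
      have h₂ := 𝔾.dualS_dualStar_dualS (𝔾.dualS.symm q)
      rw [LinearEquiv.apply_symm_apply] at h₂
      rw [BornStarAlgebra.starT_tmul, dualMulS₂_tmul, dualMulS₁_tmul, h₁, dualStar_dualMul,
        dualAlgebra_star, dualAlgebra_star, h₂]) t

theorem dualMulS₁_dualΓ_γr (x z : 𝔾.Dual) :
    𝔾.dualMulS₁ (𝔾.dualΓ.γr (tmul x z)) = 𝔾.dualε x • z := by
  rw [𝔾.dualΓ.γr_tmul]
  change 𝔾.dualMulS₁ (𝔾.dualAlgebra.starT (𝔾.dualρ (tmul (𝔾.dualStar z) (𝔾.dualStar x)))) = _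
  rw [dualρ_tmul, dualMulS₁_starT_dualFlipS, dualMulS₁_dualγ, ← 𝔾.dualε_dualS,
    LinearEquiv.apply_symm_apply, LinearEquiv.apply_symm_apply, dualStar_smul, dualε_dualStar,
    dualStar_dualStar, Complex.conj_conj]

theorem dualMulS₂_dualΓ_ρl (x z : 𝔾.Dual) :
    𝔾.dualMulS₂ (𝔾.dualΓ.ρl (tmul x z)) = 𝔾.dualε z • x := by
  rw [𝔾.dualΓ.ρl_tmul, dualMulS₂_starT]
  change 𝔾.dualStar (𝔾.dualS.symm (𝔾.dualMulS₁ (𝔾.dualγ (tmul (𝔾.dualStar z)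
    (𝔾.dualStar x))))) = _
  rw [dualMulS₁_dualγ, map_smul, LinearEquiv.symm_apply_apply, dualStar_smul, dualε_dualStar,
    dualStar_dualStar, Complex.conj_conj]

/-- The Pontryagin dual as a bornological quantum group. -/
noncomputable def dual : BornQuantumGroup 𝔾.Dual where
  toBornStarAlgebra := 𝔾.dualAlgebra
  approximation := 𝔾.dual_approximation
  Γ := 𝔾.dualΓ
  φ := 𝔾.dualφ
  φ_bdd := 𝔾.dualφ_bdd
  φ_pos := 𝔾.dualφ_pos
  φ_faithful x hx := by
    have h : 𝔾.dualφ (𝔾.dualMul (𝔾.dualStar x) x) = 0 := hx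
    rw [dualφ_dualStar_mul] at h
    simpa using 𝔾.φ_faithful _ h
  φ_invariant x := Prod.ext (funext fun z => 𝔾.slice₂_dualφ_dualγ x z)
    (funext fun z => 𝔾.slice₂_dualφ_dualΓ_ρl z x)
  ε := 𝔾.dualε
  ε_bdd := 𝔾.dualε_bdd
  ε_mul := 𝔾.dualε_dualMul
  ε_essential := 𝔾.dualε_essential
  counit_left x := Prod.ext (funext fun z => 𝔾.slice₁_dualε_dualΓ_γr x z)
    (funext fun z => 𝔾.slice₁_dualε_dualρ z x)
  counit_right x := Prod.ext (funext fun z => 𝔾.slice₂_dualε_dualγ x z)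
    (funext fun z => 𝔾.slice₂_dualε_dualΓ_ρl z x)
  S := 𝔾.dualS
  S_bdd := 𝔾.dualS_bdd
  S_symm_bdd := 𝔾.dualS_symm_bdd
  S_mul := 𝔾.dualS_dualMul
  S_comul_left := 𝔾.comulLeft_dualS
  S_comul_right := 𝔾.comulRight_dualS
  antipode_left := 𝔾.dualMulS₁_dualΓ_γr
  antipode_right := 𝔾.dualMulS₂_dualΓ_ρl

/-- Integrating the second leg of Δ(a)(f ⊗ g) first gives ((ι ⊗ 𝔉(g))Δ(a))f, whose integral is the
product formula of the dual. -/
theorem pairMultiplier_Δ (x y : 𝔾.Dual) (a : V) :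
    𝔾.pairMultiplier x y (𝔾.Γ.Δ a) = 𝔾.ev (𝔾.dualMul x y) a := by
  have h : ∀ t, lift 𝔾.bdd_φφ t = 𝔾.φ (slice₂ 𝔾.φ_bdd t) := fun t =>
    ext_tmul (f := fun t => lift 𝔾.bdd_φφ t) (g := fun t => 𝔾.φ (slice₂ 𝔾.φ_bdd t))
      (realBdd_lift _) (𝔾.realBdd_φ.comp (realBdd_slice₂ _))
      (fun p q => by rw [lift_tmul, slice₂_tmul, map_smul, smul_eq_mul, mul_comm]) t
  rw [pairMultiplier, h, slice₂_φ_Δ_tmul, LinearEquiv.apply_symm_apply, ← ev_eq, ev_dualMul]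

end BornQuantumGroup

end

end

/-! ### The duality theorem -/

theorem mainTheorem11 {V : Type u} [AddCommGroup V] [Module ℂ V] [Bornology V]
    [CompleteBornSpace V] (𝔾 : BornQuantumGroup V) :
    ∃ (δ : multipliers 𝔾.bdd_mul) (𝔾' : BornQuantumGroup 𝔾.Dual),
      𝔾.IsModularElement δ ∧ (∀ δ₁, 𝔾.IsModularElement δ₁ → δ₁ = δ) ∧
      -- the Hopf operations of the dual are given by skew duality
      (∀ x y a, 𝔾.ev (𝔾'.mul x y) a = 𝔾.pairMultiplier x y (𝔾.Γ.Δ a)) ∧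
      (∀ x, 𝔾.PairsAs (𝔾'.Γ.Δ x).1 fun a b => 𝔾.ev x (𝔾.mul b a)) ∧
      (∀ f, 𝔾'.ε (𝔾.fourier f) = 𝔾.φ f) ∧
      (∀ x a, 𝔾.ev (𝔾'.S x) a = 𝔾.ev x (𝔾.S.symm a)) ∧
      (∀ x a, 𝔾.ev (𝔾'.S.symm x) a = 𝔾.ev x (𝔾.S a)) ∧
      -- the involution of the dual
      (∀ x a, 𝔾.ev (𝔾'.star x) a = (starRingEnd ℂ) (𝔾.ev x (𝔾.star (𝔾.S a)))) ∧
      (∀ x a, 𝔾.ev x (𝔾.star a) = (starRingEnd ℂ) (𝔾.ev (𝔾'.star (𝔾'.S.symm x)) a)) ∧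
      -- the left Haar integral of the dual
      (∀ a, 𝔾'.φ (𝔾.fourier a) = 𝔾.ε a) ∧
      -- product and involution of the dual under the Fourier map
      (∀ f g, 𝔾'.mul (𝔾.fourier f) (𝔾.fourier g) = 𝔾.fourier (𝔾.conv f g)) ∧
      (∀ f, 𝔾'.star (𝔾.fourier f) = 𝔾.fourier (𝔾.convStar δ f)) ∧
      (∀ f g, 𝔾.ε (𝔾.conv (𝔾.convStar δ f) g) = 𝔾.φ (𝔾.mul (𝔾.star f) g)) := by
  refine ⟨𝔾.modular, 𝔾.dual, 𝔾.isModularElement_modular,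
    fun δ₁ h => h.unique 𝔾 𝔾.isModularElement_modular,
    fun x y a => (𝔾.pairMultiplier_Δ x y a).symm,
    fun x z w a b => ⟨𝔾.evT_comulLeft a b x z w, 𝔾.evT_comulRight a b x z w⟩, fun f => ?_,
    𝔾.ev_dualS, 𝔾.ev_dualS_symm, 𝔾.ev_dualStar, fun x a => ?_, fun a => ?_, fun f g => ?_,
    fun f => ?_, 𝔾.ε_conv_convStar⟩
  · exact congrArg 𝔾.φ (𝔾.fourier.symm_apply_apply f)
  · exact (Complex.conj_conj _).symm.trans
      (congrArg (starRingEnd ℂ) (𝔾.ev_dualStar_dualS_symm x a)).symm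
  · exact congrArg 𝔾.ε (𝔾.fourier.symm_apply_apply a)
  · change 𝔾.fourier (𝔾.conv (𝔾.fourier.symm (𝔾.fourier f)) (𝔾.fourier.symm (𝔾.fourier g))) = _
    rw [LinearEquiv.symm_apply_apply, LinearEquiv.symm_apply_apply]
  · change 𝔾.fourier (𝔾.convStar 𝔾.modular (𝔾.fourier.symm (𝔾.fourier f))) = _
    rw [LinearEquiv.symm_apply_apply]
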